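/- **Theorem 3.5 (Riemann surface target).** Let $(M^m,g_M)$, $m>2$, be a smooth Riemannian manifold, let $(N^2,g_N)$ be a smooth Riemannian manifold of dimension $2$ (for instance a Riemann surface with a Riemannian metric), and let $u:M\to N$ be a horizontally conformal map, that is, a smooth submersion for which there is a smooth function $\lambda:M\to(0,\infty)$ with $$g_N(du_x X,du_x Y)=\lambda(x)^2\,g_M(X,Y)\qquad\text{for all } x\in M \text{ and all } X,Y\in\mathcal H_x=(\ker du_x)^{\perp}.$$ Let $e_u=\tfrac12|du|^2$ be its energy density, $|du|$ being the Hilbert–Schmidt norm. Let $F:[0,\infty)\to[0,\infty)$ be strictly increasing with $F(0)=0$ and of class $C^2$ on $(0,\infty)$, and let $Z=\{t>0:\,-2tF''(t)=0\}$. Assume that the zeros of $-2tF''(t)$ are not isolated, in the following sense: either * $F$ is real-analytic on $(0,\infty)$ and $Z$ has an accumulation point in $(0,\infty)$; or * every value $e_u(x)$, $x\in M$, is an interior point of $Z$ (for instance, $-2tF''(t)$ vanishes identically on $(0,\infty)$). Then the fibers of $u$ are minimal submanifolds of $M$ if and only if $u$ is $F$-harmonic, and $u$ is $F$-harmonic if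 and only if $u$ is harmonic. Here a smooth map $u$ is called $F$-harmonic if it is a critical point of $E_F(u)=\int_M F\!\left(\tfrac{|du|^2}{2}\right)dv_{g_M}$ with respect to all compactly supported smooth variations (the derivative being taken of the energy over a compact set containing the support of the variation), and harmonic if it is $F$-harmonic for $F(t)=t$. The fibers are minimal if their mean curvature vectors vanish. -/

import Mathlib

open Set Filter Topology MeasureTheory Manifold ContDiff

noncomputable section

namespace FHarmonic

/-- Euclidean `m`-space, the model of all `m`-dimensional manifolds below. -/
abbrev Model (m : ℕ) : Type := EuclideanSpace ℝ (Fin m)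

/-- A smooth Riemannian metric on a smooth `m`-manifold `M`: `g.inner x v w` is the inner product
of two tangent vectors `v, w` at the point `x`. -/
abbrev Metric (m : ℕ) (M : Type*) [TopologicalSpace M] [ChartedSpace (Model m) M]
    [IsManifold (𝓡 m) ∞ M] : Type _ :=
  Bundle.ContMDiffRiemannianMetric (𝓡 m) ∞ (Model m) (fun x : M => TangentSpace (𝓡 m) x)

section Manifold

variable {m : ℕ} {M : Type*} [TopologicalSpace M] [ChartedSpace (Model m) M]

/-- The `i`-th coordinate vector field `∂ᵢ` of the preferred chart around `p`, at the point of `M`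
with coordinates `y`. -/
def coordVec (p : M) (y : Model m) (i : Fin m) :
    TangentSpace (𝓡 m) ((extChartAt (𝓡 m) p).symm y) :=
  mfderiv (𝓡 m) (𝓡 m) (extChartAt (𝓡 m) p).symm y (EuclideanSpace.single i (1 : ℝ) : Model m)

/-- The vector field `W` written in the preferred chart around `p`: its coefficients with respect
to the coordinate vector fields, as a function of the coordinates. -/
def coordField (p : M) (W : (x : M) → TangentSpace (𝓡 m) x) (y : Model m) : Model m :=
  mfderiv (𝓡 m) (𝓡 m) (extChartAt (𝓡 m) p) ((extChartAt (𝓡 m) p).symm y)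
    (W ((extChartAt (𝓡 m) p).symm y))

variable [IsManifold (𝓡 m) ∞ M]

/-- The matrix `g_{ij} = g(∂ᵢ, ∂ⱼ)` of the metric in the preferred chart around `p`, as a function
of the coordinates. -/
def chartGram (g : Metric m M) (p : M) (y : Model m) : Matrix (Fin m) (Fin m) ℝ :=
  Matrix.of fun i j => g.inner ((extChartAt (𝓡 m) p).symm y) (coordVec p y i) (coordVec p y j)

/-! ### The Riemannian volume -/

/-- The measure `√(det g_{ij}) dy¹ ⋯ dyᵐ` of the preferred chart around `p`, seen as a measure on
`M` carried by the domain of that chart. -/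
def chartVolume [MeasurableSpace M] (g : Metric m M) (p : M) : Measure M :=
  Measure.map (extChartAt (𝓡 m) p).symm
    (((volume : Measure (Model m)).restrict (extChartAt (𝓡 m) p).target).withDensity
      fun y => ENNReal.ofReal (Real.sqrt (chartGram g p y).det))

/-- The Riemannian volume measure of `(M, g)`: the least measure that dominates
`√(det g_{ij}) dy¹ ⋯ dyᵐ` in each chart. By the change of variables formula the chart measures
agree on overlaps, so on a second countable manifold this measure restricts to
`√(det g_{ij}) dy¹ ⋯ dyᵐ` on the domain of each chart. -/
def riemVolume [MeasurableSpace M] (g : Metric m M) : Measure M :=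
  ⨆ p : M, chartVolume g p

/-! ### The Levi-Civita connection -/

/-- The Christoffel symbol `Γᵏᵢⱼ = ½ ∑ₗ gᵏˡ (∂ᵢ gⱼₗ + ∂ⱼ gᵢₗ - ∂ₗ gᵢⱼ)` of the Levi-Civita connection
in the preferred chart around `p`. -/
def christoffel (g : Metric m M) (p : M) (y : Model m) (k i j : Fin m) : ℝ :=
  (1 / 2 : ℝ) * ∑ l, (chartGram g p y)⁻¹ k l *
    (fderiv ℝ (fun z => chartGram g p z j l) y (EuclideanSpace.single i 1)
      + fderiv ℝ (fun z => chartGram g p z i l) y (EuclideanSpace.single j 1)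
      - fderiv ℝ (fun z => chartGram g p z i j) y (EuclideanSpace.single l 1))

/-- The Levi-Civita covariant derivative `∇_v W` at `p` of a vector field `W` in the direction
`v ∈ T_p M`: in the preferred chart around `p` (whose coordinate frame identifies `T_p M` with
Euclidean space), its `k`-th coefficient is `v(Wᵏ) + ∑ᵢⱼ Γᵏᵢⱼ vⁱ Wʲ`. -/
def covDeriv (g : Metric m M) (W : (x : M) → TangentSpace (𝓡 m) x) (p : M)
    (v : TangentSpace (𝓡 m) p) : TangentSpace (𝓡 m) p :=
  let y₀ : Model m := extChartAt (𝓡 m) p p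
  let v' : Model m := v
  (WithLp.toLp 2 fun k =>
    fderiv ℝ (coordField p W) y₀ v' k
      + ∑ i, ∑ j, christoffel g p y₀ k i j * v' i * coordField p W y₀ j : Model m)

end Manifold

section Maps

variable {m n : ℕ} {M : Type*} [TopologicalSpace M] [ChartedSpace (Model m) M]
  [IsManifold (𝓡 m) ∞ M]
  {N : Type*} [TopologicalSpace N] [ChartedSpace (Model n) N]

/-! ### Horizontally conformal maps -/

variable (n) in
/-- A tangent vector `v` at `x` is vertical if `du_x(v) = 0`. -/
def IsVertical (u : M → N) (x : M) (v : TangentSpace (𝓡 m) x) : Prop :=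
  mfderiv (𝓡 m) (𝓡 n) u x v = 0

variable (n) in
/-- A tangent vector `v` at `x` is horizontal if it is orthogonal to the kernel of `du_x`. -/
def IsHorizontal (g : Metric m M) (u : M → N) (x : M) (v : TangentSpace (𝓡 m) x) : Prop :=
  ∀ w : TangentSpace (𝓡 m) x, IsVertical n u x w → g.inner x v w = 0

/-- `u` is a horizontally conformal map: it is a smooth submersion, and there is a smooth positive
function `lam` on `M` (the dilation) with `h(du X, du Y) = lam² g(X, Y)` for horizontal `X, Y`. -/
def IsHorizontallyConformal [IsManifold (𝓡 n) ∞ N] (g : Metric m M) (h : Metric n N)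
    (u : M → N) : Prop :=
  ContMDiff (𝓡 m) (𝓡 n) ∞ u ∧
  (∀ x, Function.Surjective (mfderiv (𝓡 m) (𝓡 n) u x)) ∧
  ∃ lam : M → ℝ, ContMDiff (𝓡 m) 𝓘(ℝ, ℝ) ∞ lam ∧ (∀ x, 0 < lam x) ∧
    ∀ x, ∀ X Y : TangentSpace (𝓡 m) x, IsHorizontal n g u x X → IsHorizontal n g u x Y →
      h.inner (u x) (mfderiv (𝓡 m) (𝓡 n) u x X) (mfderiv (𝓡 m) (𝓡 n) u x Y)
        = lam x ^ 2 * g.inner x X Y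

/-! ### Minimal fibers -/

variable (n) in
/-- `W` is a smooth orthonormal frame, on the open set `V`, of the vertical distribution `ker du` of
a submersion `u : Mᵐ → Nⁿ`; along each fiber it is an orthonormal tangent frame of that fiber,
whose dimension is `m - n`. -/
def IsVerticalFrame (g : Metric m M) (u : M → N) (V : Set M)
    (W : Fin (m - n) → (x : M) → TangentSpace (𝓡 m) x) : Prop :=
  IsOpen V ∧
  (∀ a, ContMDiffOn (𝓡 m) (𝓡 m).tangent ∞
    (fun x => (⟨x, W a x⟩ : TangentBundle (𝓡 m) M)) V) ∧
  (∀ x ∈ V, ∀ a, IsVertical n u x (W a x)) ∧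
  ∀ x ∈ V, ∀ a b, g.inner x (W a x) (W b x) = if a = b then 1 else 0

variable (n) in
/-- The fibers of the submersion `u` are minimal submanifolds: their mean curvature vanishes. The
second fundamental form of a fiber is `II(X, Y) = (∇_X Y)^⊥` for tangent fields `X, Y`, the normal
space of the fiber being the horizontal space; so minimality says that at each point the trace
`∑ₐ II(Wₐ, Wₐ) = (∑ₐ ∇_{Wₐ} Wₐ)^⊥` over orthonormal tangent frames has no normal component. -/
def FibersMinimal (g : Metric m M) (u : M → N) : Prop :=
  ∀ (p : M) (V : Set M) (W : Fin (m - n) → (x : M) → TangentSpace (𝓡 m) x),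
    p ∈ V → IsVerticalFrame n g u V W →
      ∀ Z : TangentSpace (𝓡 m) p, IsHorizontal n g u p Z →
        g.inner p (∑ a, covDeriv g (W a) p (W a p)) Z = 0

/-! ### Energy -/

/-- The `i`-th standard basis vector of `T_x M` (the coordinate vector at `x` of the preferred chart
around `x`). -/
def stdVec (x : M) (i : Fin m) : TangentSpace (𝓡 m) x :=
  (EuclideanSpace.single i (1 : ℝ) : Model m)

/-- The matrix of `g` at `x` in the standard basis of `T_x M`. -/
def gramAt (g : Metric m M) (x : M) : Matrix (Fin m) (Fin m) ℝ :=
  Matrix.of fun i j => g.inner x (stdVec x i) (stdVec x j)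

variable [IsManifold (𝓡 n) ∞ N]

/-- The energy density `e_u(x) = ½ |du_x|² = ½ ∑ᵢⱼ gⁱʲ h(du ∂ᵢ, du ∂ⱼ)`, where `|du_x|` is the
Hilbert-Schmidt norm. -/
def energyDensity (g : Metric m M) (h : Metric n N) (u : M → N) (x : M) : ℝ :=
  (1 / 2 : ℝ) * ∑ i, ∑ j, (gramAt g x)⁻¹ i j *
    h.inner (u x) (mfderiv (𝓡 m) (𝓡 n) u x (stdVec x i)) (mfderiv (𝓡 m) (𝓡 n) u x (stdVec x j))

/-- The `F`-energy `∫_K F(|du|² / 2) dv_g` of `u` over `K`. -/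
def energyOn [MeasurableSpace M] (g : Metric m M) (h : Metric n N) (F : ℝ → ℝ)
    (K : Set M) (u : M → N) : ℝ :=
  ∫ x in K, F (energyDensity g h u x) ∂(riemVolume g)

/-- `u` is `F`-harmonic: it is smooth, and it is a critical point of the `F`-energy with respect to
all compactly supported smooth variations `(U t)` of `u = U 0`. If the variation is supported in the
compact set `K`, only the energy over `K` varies. -/
def IsFHarmonic [MeasurableSpace M] (g : Metric m M) (h : Metric n N) (F : ℝ → ℝ)
    (u : M → N) : Prop :=
  ContMDiff (𝓡 m) (𝓡 n) ∞ u ∧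
  ∀ (U : ℝ → M → N) (K : Set M), IsCompact K →
    ContMDiff (𝓘(ℝ, ℝ).prod (𝓡 m)) (𝓡 n) ∞ (fun q : ℝ × M => U q.1 q.2) →
    U 0 = u → (∀ t, ∀ x ∉ K, U t x = u x) →
      HasDerivAt (fun t => energyOn g h F K (U t)) 0 0

/-- `u` is harmonic: it is a critical point of the energy `∫ |du|² / 2`. -/
def IsHarmonic [MeasurableSpace M] (g : Metric m M) (h : Metric n N) (u : M → N) : Prop :=
  IsFHarmonic g h (fun t => t) u

end Maps

/-- For every `g`-orthonormal basis `e₁, …, e_m` of `T_x M`, one has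
`e_u(x) = ½ ∑ₖ h(du eₖ, du eₖ)`. -/
theorem energyDensity_eq_sum {m n : ℕ} {M : Type*} [TopologicalSpace M] [ChartedSpace (Model m) M]
    [IsManifold (𝓡 m) ∞ M] {N : Type*} [TopologicalSpace N] [ChartedSpace (Model n) N]
    [IsManifold (𝓡 n) ∞ N] (g : Metric m M) (h : Metric n N) (u : M → N) (x : M)
    (e : Fin m → TangentSpace (𝓡 m) x)
    (he : ∀ a b, g.inner x (e a) (e b) = if a = b then 1 else 0) :
    energyDensity g h u x = (1 / 2 : ℝ) * ∑ k,
      h.inner (u x) (mfderiv (𝓡 m) (𝓡 n) u x (e k)) (mfderiv (𝓡 m) (𝓡 n) u x (e k)) := by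
  have hexp : ∀ v : TangentSpace (𝓡 m) x, v = ∑ i, (show Model m from v) i • stdVec x i := by
    intro v
    exact ((EuclideanSpace.basisFun (Fin m) ℝ).sum_repr v).symm.trans (by simp [stdVec]; rfl)
  let B : Matrix (Fin m) (Fin m) ℝ := Matrix.of fun i k => (show Model m from e k) i
  have hB : B.transpose * (gramAt g x * B) = 1 := by
    ext a b
    rw [Matrix.one_apply, ← he a b]
    conv_rhs => rw [hexp (e a), hexp (e b)]
    simp [Matrix.mul_apply, B, gramAt, map_sum, Finset.mul_sum]
    rw [Finset.sum_comm]
    refine Finset.sum_congr rfl fun i _ => Finset.sum_congr rfl fun j _ => ?_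
    ring
  have hinv : (gramAt g x)⁻¹ = B * B.transpose := by
    apply Matrix.inv_eq_right_inv
    rw [← Matrix.mul_assoc]
    exact mul_eq_one_comm.mp hB
  unfold energyDensity
  rw [hinv]
  congr 1
  have key : ∀ k, h.inner (u x) (mfderiv (𝓡 m) (𝓡 n) u x (e k)) (mfderiv (𝓡 m) (𝓡 n) u x (e k))
      = ∑ i, ∑ j, B i k * B j k * h.inner (u x) (mfderiv (𝓡 m) (𝓡 n) u x (stdVec x i))
        (mfderiv (𝓡 m) (𝓡 n) u x (stdVec x j)) := by
    intro k
    conv_lhs => rw [hexp (e k)]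
    simp [map_sum, Finset.mul_sum, B]
    rw [Finset.sum_comm]
    refine Finset.sum_congr rfl fun i _ => Finset.sum_congr rfl fun j _ => ?_
    ring
  simp_rw [key, Matrix.mul_apply, Matrix.transpose_apply, Finset.sum_mul]
  rw [Finset.sum_comm]
  conv_rhs => rw [Finset.sum_comm]
  rw [Finset.sum_comm]
  refine Finset.sum_congr rfl fun i _ => ?_
  rw [Finset.sum_comm]

/-- The zeros in `(0, ∞)` of the function `t ↦ -2 t F''(t)`. -/
def zeroSet (F : ℝ → ℝ) : Set ℝ :=
  {t | 0 < t ∧ -2 * t * deriv (deriv F) t = 0}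

end FHarmonic

end

/-! In charts, let `G` and `H` be the matrices of the two metrics (`H` taken along `u`), `A` the
Jacobian matrix of `u`, `ρ = √det G`, `J = √det H` and `K = A G⁻¹ Aᵀ`. Horizontal conformality
becomes the identity `H K = λ² I` (`chartGram_mul_jac`), whose trace gives `e_u = λ² > 0`. It also
puts the first variation of the energy density along a variation field `V` into the form `J⁻¹ ∑ (H A
G⁻¹)_{βj} ∂ⱼ(J V^β)` (`hasDerivAt_matrixEnergy`): the variation of `H` is exactly what
differentiating the factor `J` produces. Integration by parts then yields a tension, namely `ρ⁻¹`
times the coordinate divergence of the flux `(ρ / J) H A G⁻¹` (`setIntegral_deriv_energyDensity`).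

The dimension of the target enters next. Conformality gives `H = λ² K⁻¹`, and `J √det K = λⁿ` for an
`n`-dimensional target; for `n = 2` the powers of `λ` cancel and the flux is `ρ √det K X_β`, with
`X_β` the horizontal lift of the coordinate field `∂_β` (`chartFlux_eq_chartLift`). By the coarea
formula `ρ √det K` is the density of fiber volume times Lebesgue measure in the target coordinates.
The flow of `X_β` maps fibers to fibers, so the divergence measures the rate of change of fiber
volume, which is half the trace of `L_X g` over the vertical space (`sum_fderiv_density_mul`). Since
`g(∇_W W, X) = -½ (L_X g)(W, W)` for vertical `W` (`inner_covDeriv_self`), the tension equals `-√det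
K` times the inner product of the mean curvature of the fiber with `X_β`
(`chartTension_eq_inner_covDeriv`). The lifts span the horizontal space, so the fibers are minimal
iff the tension vanishes.

Finally, the first variation of the `F`-energy is the integral of `F'(e_u)` times the first
variation of the energy density. Where `F''` vanishes around the values of `e_u`, the function
`F'(e_u)` is locally constant, and it is positive because `F` is strictly increasing; in the
analytic case the identity theorem makes `F''` vanish everywhere. For variations with small support
the `F`-energy thus varies like a positive multiple of the energy. The fundamental lemma of the
calculus of variations gives one implication, a partition of unity the other
(`fibersMinimal_iff_isFHarmonic`). Applying this to `F` and to the identity function gives both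
equivalences. -/

noncomputable section

namespace FHarmonic

/-! ### Calculus of matrix-valued curves -/

section MatrixCalculus

open Matrix

variable {ι κ μ : Type*}

/-- The matrix-valued curve `A` has entrywise derivative `A'` at `0`. -/
def HasEntryDeriv (A : ℝ → Matrix ι κ ℝ) (A' : Matrix ι κ ℝ) : Prop :=
  ∀ i j, HasDerivAt (fun s => A s i j) (A' i j) 0

theorem HasEntryDeriv.mul [Fintype κ] {A : ℝ → Matrix ι κ ℝ} {A' : Matrix ι κ ℝ} {B : ℝ → Matrix κ μ ℝ}
    {B' : Matrix κ μ ℝ} (hA : HasEntryDeriv A A') (hB : HasEntryDeriv B B') :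
    HasEntryDeriv (fun s => A s * B s) (A' * B 0 + A 0 * B') := by
  intro i j
  simp only [Matrix.mul_apply, Matrix.add_apply]
  rw [← Finset.sum_add_distrib]
  exact HasDerivAt.fun_sum fun k _ => (hA i k).mul (hB k j)

theorem HasEntryDeriv.transpose {A : ℝ → Matrix ι κ ℝ} {A' : Matrix ι κ ℝ}
    (hA : HasEntryDeriv A A') : HasEntryDeriv (fun s => (A s)ᵀ) A'ᵀ :=
  fun i j => hA j i

theorem HasEntryDeriv.trace [Fintype ι] {A : ℝ → Matrix ι ι ℝ} {A' : Matrix ι ι ℝ}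
    (hA : HasEntryDeriv A A') : HasDerivAt (fun s => (A s).trace) A'.trace 0 := by
  simp only [Matrix.trace, Matrix.diag]
  exact HasDerivAt.fun_sum fun k _ => hA k k

theorem differentiable_det [Fintype ι] [DecidableEq ι] :
    Differentiable ℝ (fun B : ι → ι → ℝ => (Matrix.of B).det) := by
  simp only [Matrix.det_apply, Matrix.of_apply]
  fun_prop

/-- The determinant is a polynomial in `s` with constant term `1` and linear coefficient the trace;
the rest is `s ^ 2` times a polynomial and does not contribute at `0`. -/
theorem hasDerivAt_det_one_add_smul [Fintype ι] [DecidableEq ι] (M : Matrix ι ι ℝ) :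
    HasDerivAt (fun s : ℝ => (1 + s • M).det) M.trace 0 := by
  have h := fun s : ℝ => Matrix.det_one_add_smul s M
  simp_rw [h]
  generalize (det (1 + (Polynomial.X : Polynomial ℝ) • M.map ⇑Polynomial.C)).divX.divX = P
  have h1 : HasDerivAt (fun s : ℝ => P.eval s * s ^ 2) 0 0 := by
    simpa using (P.hasDerivAt (0 : ℝ)).fun_mul ((hasDerivAt_id (0 : ℝ)).fun_pow 2)
  simpa using ((hasDerivAt_const (0 : ℝ) (1 : ℝ)).fun_add
    ((hasDerivAt_id (0 : ℝ)).const_mul M.trace)).fun_add h1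

/-- Jacobi's formula for the derivative of a determinant. -/
theorem HasEntryDeriv.det [Fintype ι] [DecidableEq ι] {A : ℝ → Matrix ι ι ℝ} {A' : Matrix ι ι ℝ}
    (hA : HasEntryDeriv A A') (h0 : IsUnit (A 0).det) :
    HasDerivAt (fun s => (A s).det) ((A 0).det * ((A 0)⁻¹ * A').trace) 0 := by
  have hd : DifferentiableAt ℝ (fun B : ι → ι → ℝ => (Matrix.of B).det) (fun i j => A 0 i j) :=
    differentiable_det _
  -- By the chain rule the derivative depends only on the value and the velocity of the curve at
  -- `0`. So `A` can be compared with `A 0 * (1 + s • ((A 0)⁻¹ * A'))`, whose determinant is known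
  -- to first order.
  have key : ∀ B : ℝ → Matrix ι ι ℝ, B 0 = A 0 → HasEntryDeriv B A' →
      HasDerivAt (fun s => (B s).det)
        (fderiv ℝ (fun B : ι → ι → ℝ => (Matrix.of B).det) (fun i j => A 0 i j)
          (fun i j => A' i j)) 0 := by
    intro B hB0 hB
    have hB' : HasDerivAt (fun s => (fun i j => B s i j : ι → ι → ℝ)) (fun i j => A' i j) 0 :=
      hasDerivAt_pi.2 fun i => hasDerivAt_pi.2 fun j => hB i j
    have hd' : HasFDerivAt (fun B : ι → ι → ℝ => (Matrix.of B).det)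
      (fderiv ℝ (fun B : ι → ι → ℝ => (Matrix.of B).det) (fun i j => A 0 i j))
      ((fun s => (fun i j => B s i j : ι → ι → ℝ)) 0) := by
      simp only [hB0]; exact hd.hasFDerivAt
    exact hd'.comp_hasDerivAt (0 : ℝ) hB'
  have h1 := key A rfl hA
  have h2 := key (fun s => A 0 * (1 + s • ((A 0)⁻¹ * A'))) (by simp) (by
    intro i j
    have : ∀ s : ℝ, (A 0 * (1 + s • ((A 0)⁻¹ * A'))) i j = A 0 i j + s * A' i j := by
      intro s
      rw [mul_add, mul_one, Matrix.mul_smul, Matrix.mul_nonsing_inv_cancel_left _ _ h0]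
      simp
    simp_rw [this]
    simpa using ((hasDerivAt_id (0 : ℝ)).mul_const (A' i j)).const_add (A 0 i j))
  have h3 : HasDerivAt (fun s : ℝ => (A 0 * (1 + s • ((A 0)⁻¹ * A'))).det)
      ((A 0).det * ((A 0)⁻¹ * A').trace) 0 := by
    simp_rw [Matrix.det_mul]
    exact (hasDerivAt_det_one_add_smul _).const_mul _
  rwa [h2.unique h3] at h1

/-- Cramer's rule gives differentiability of the entries; the value then follows by differentiating
`A * A⁻¹ = 1`, which holds near `0`. -/
theorem HasEntryDeriv.inv [Fintype ι] [DecidableEq ι] {A : ℝ → Matrix ι ι ℝ} {A' : Matrix ι ι ℝ}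
    (hA : HasEntryDeriv A A') (h0 : IsUnit (A 0).det) :
    HasEntryDeriv (fun s => (A s)⁻¹) (-((A 0)⁻¹ * A' * (A 0)⁻¹)) := by
  have hdet := hA.det h0
  have hne : (A 0).det ≠ 0 := h0.ne_zero
  have hdiff : ∀ i j, DifferentiableAt ℝ (fun s => (A s)⁻¹ i j) 0 := by
    intro i j
    simp only [Matrix.inv_def, Ring.inverse_eq_inv', Matrix.smul_apply, smul_eq_mul,
      Matrix.adjugate_apply]
    refine (hdet.differentiableAt.inv hne).mul ?_
    have hAd : DifferentiableAt ℝ (fun s => (fun k l => (A s).updateRow j (Pi.single i 1) k l)) 0 := by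
      refine differentiableAt_pi.2 fun k => differentiableAt_pi.2 fun l => ?_
      by_cases hk : k = j
      · subst hk; simp
      · simpa [Matrix.updateRow_ne hk] using (hA k l).differentiableAt
    exact (differentiable_det (ι := ι) _).comp (0 : ℝ) hAd
  set B : Matrix ι ι ℝ := Matrix.of fun i j => deriv (fun s => (A s)⁻¹ i j) 0 with hBdef
  have hB : HasEntryDeriv (fun s => (A s)⁻¹) B := fun i j => (hdiff i j).hasDerivAt
  have hprod := hA.mul hB
  have hone : HasEntryDeriv (fun s => A s * (A s)⁻¹) 0 := by
    intro i j
    have hev : ∀ᶠ s in 𝓝 (0 : ℝ), (A s).det ≠ 0 := hdet.continuousAt.eventually_ne hne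
    refine (hasDerivAt_const (0 : ℝ) ((1 : Matrix ι ι ℝ) i j)).congr_of_eventuallyEq ?_
    filter_upwards [hev] with s hs
    rw [Matrix.mul_nonsing_inv _ (isUnit_iff_ne_zero.2 hs)]
  have heq : A' * (A 0)⁻¹ + A 0 * B = 0 := by
    ext i j; exact (hprod i j).unique (hone i j)
  have : B = -((A 0)⁻¹ * A' * (A 0)⁻¹) := by
    have h := congrArg (fun M => (A 0)⁻¹ * M) (eq_neg_of_add_eq_zero_right heq)
    simpa [Matrix.nonsing_inv_mul_cancel_left _ _ h0, Matrix.mul_assoc] using h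
  rwa [this] at hB

theorem HasEntryDeriv.sqrt_det [Fintype ι] [DecidableEq ι] {A : ℝ → Matrix ι ι ℝ} {A' : Matrix ι ι ℝ}
    (hA : HasEntryDeriv A A') (h0 : 0 < (A 0).det) :
    HasDerivAt (fun s => √((A s).det)) (√((A 0).det) * ((1 / 2) * ((A 0)⁻¹ * A').trace)) 0 := by
  have h := (hA.det (isUnit_iff_ne_zero.2 h0.ne')).sqrt h0.ne'
  convert! h using 1
  have hs : √((A 0).det) ≠ 0 := (Real.sqrt_pos.2 h0).ne'
  have := Real.mul_self_sqrt h0.le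
  field_simp
  rw [sq, this, mul_comm]

/-! ### The derivative of the volume of a submersion along a horizontal lift -/

variable {η : Type*}

/-- A matrix `W` of `G`-orthonormal columns spanning the kernel of `A` provides a splitting of
`G⁻¹` into a vertical and a horizontal part. -/
theorem mul_transpose_eq_inv_sub [Fintype ι] [DecidableEq ι] [Fintype κ] [DecidableEq κ]
    [Fintype η] [DecidableEq η]
    {G : Matrix ι ι ℝ} {A : Matrix κ ι ℝ} {X : Matrix ι κ ℝ} {W : Matrix ι η ℝ}
    (hcard : Fintype.card η + Fintype.card κ = Fintype.card ι)
    (hGu : IsUnit G.det) (hAX : A * X = 1) (hAW : A * W = 0) (hWW : Wᵀ * G * W = 1)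
    (hWX : Wᵀ * G * X = 0) :
    W * Wᵀ = G⁻¹ - X * A * G⁻¹ := by
  have e : ι ≃ η ⊕ κ := Fintype.equivOfCardEq (by simp [hcard])
  -- The hypotheses say that two block matrices have product `1`. By `hcard` they are square up to
  -- reindexing, so the product in the other order is also `1`, which reads `W Wᵀ G + X A = 1`.
  have h1 : (Matrix.fromRows (Wᵀ * G) A) * (Matrix.fromCols W X) = 1 := by
    rw [Matrix.fromRows_mul_fromCols, hWW, hWX, hAW, hAX, Matrix.fromBlocks_one]
  have h2 := (Matrix.mul_eq_one_comm_of_equiv e).2 h1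
  rw [Matrix.fromCols_mul_fromRows] at h2
  have h3 : W * Wᵀ * G = 1 - X * A := by rw [Matrix.mul_assoc, ← h2]; abel
  calc W * Wᵀ = W * Wᵀ * G * G⁻¹ := by rw [Matrix.mul_nonsing_inv_cancel_right _ _ hGu]
    _ = _ := by rw [h3, Matrix.sub_mul, Matrix.one_mul]

/-- Let `G` be a curve of metrics and `A` a curve of surjective linear maps such that
`A' = -A N`. Then the logarithmic derivative of `√det G √det (A G⁻¹ Aᵀ)` is half of the trace
of `G' + Nᵀ G + G N` over the kernel of `A`, up to the trace of `N`. -/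
theorem hasDerivAt_sqrt_det_mul_sqrt_det [Fintype ι] [DecidableEq ι] [Fintype κ] [DecidableEq κ]
    [Fintype η] [DecidableEq η]
    {G : ℝ → Matrix ι ι ℝ} {A : ℝ → Matrix κ ι ℝ} {G' : Matrix ι ι ℝ} {N : Matrix ι ι ℝ}
    {W : Matrix ι η ℝ}
    (hcard : Fintype.card η + Fintype.card κ = Fintype.card ι)
    (hG : HasEntryDeriv G G') (hA : HasEntryDeriv A (-(A 0 * N)))
    (hGs : (G 0)ᵀ = G 0) (hGd : 0 < (G 0).det)
    (hKd : 0 < (A 0 * (G 0)⁻¹ * (A 0)ᵀ).det)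
    (hAW : A 0 * W = 0) (hWW : Wᵀ * G 0 * W = 1) :
    HasDerivAt (fun s => √((G s).det) * √((A s * (G s)⁻¹ * (A s)ᵀ).det))
      (√((G 0).det) * √((A 0 * (G 0)⁻¹ * (A 0)ᵀ).det) *
        ((1 / 2) * (Wᵀ * (G' + Nᵀ * G 0 + G 0 * N) * W).trace - N.trace)) 0 := by
  have hGu : IsUnit (G 0).det := isUnit_iff_ne_zero.2 hGd.ne'
  set g := G 0 with hg
  set a := A 0 with ha
  set K := a * g⁻¹ * aᵀ with hK
  have hKu : IsUnit K.det := isUnit_iff_ne_zero.2 hKd.ne'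
  have hgis : (g⁻¹)ᵀ = g⁻¹ := by rw [Matrix.transpose_nonsing_inv, hGs]
  set X := g⁻¹ * aᵀ * K⁻¹ with hX
  have hAX : a * X = 1 := by
    rw [hX, ← Matrix.mul_assoc, ← Matrix.mul_assoc, ← hK, Matrix.mul_nonsing_inv _ hKu]
  have hWX : Wᵀ * g * X = 0 := by
    have : Wᵀ * aᵀ = 0 := by rw [← Matrix.transpose_mul, hAW, Matrix.transpose_zero]
    rw [hX, Matrix.mul_assoc Wᵀ, ← Matrix.mul_assoc g, ← Matrix.mul_assoc g,
      Matrix.mul_nonsing_inv _ hGu, Matrix.one_mul, ← Matrix.mul_assoc, this, Matrix.zero_mul]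
  have hsplit := mul_transpose_eq_inv_sub hcard hGu hAX hAW hWW hWX
  -- When `N` is the Jacobian of a vector field and `G'` the derivative of the metric along it, `L`
  -- is the Lie derivative of the metric.
  set L := G' + Nᵀ * g + g * N with hL
  have h1 : g⁻¹ * L = g⁻¹ * G' + g⁻¹ * Nᵀ * g + N := by
    rw [hL, Matrix.mul_add, Matrix.mul_add, Matrix.nonsing_inv_mul_cancel_left _ _ hGu,
      Matrix.mul_assoc]
  have ht1 : (g⁻¹ * L).trace = (g⁻¹ * G').trace + 2 * N.trace := by
    rw [h1, Matrix.trace_add, Matrix.trace_add, Matrix.trace_mul_cycle,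
      Matrix.mul_nonsing_inv _ hGu, Matrix.one_mul, Matrix.trace_transpose]
    ring
  -- Because `A' = -A N`, the derivatives of `A`, `G⁻¹` and `Aᵀ` combine into a single term in `L`.
  have hKder : HasEntryDeriv (fun s => A s * (G s)⁻¹ * (A s)ᵀ) (-(a * (g⁻¹ * L * g⁻¹) * aᵀ)) := by
    have h := (hA.mul (hG.inv hGu)).mul hA.transpose
    convert! h using 1
    have h2 : g⁻¹ * L * g⁻¹ = g⁻¹ * G' * g⁻¹ + g⁻¹ * Nᵀ + N * g⁻¹ := by
      rw [h1, Matrix.add_mul, Matrix.add_mul, Matrix.mul_nonsing_inv_cancel_right _ _ hGu]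
    rw [h2]
    simp only [← hg, ← ha, Matrix.transpose_neg, Matrix.transpose_mul, Matrix.mul_add,
      Matrix.add_mul, Matrix.mul_neg, Matrix.neg_mul, Matrix.mul_assoc]
    abel
  have ht2 : (K⁻¹ * -(a * (g⁻¹ * L * g⁻¹) * aᵀ)).trace = -(X * a * g⁻¹ * L).trace := by
    rw [Matrix.mul_neg, Matrix.trace_neg, ← Matrix.mul_assoc, ← Matrix.mul_assoc,
      Matrix.trace_mul_comm, hX]
    congr 1
    rw [show aᵀ * (K⁻¹ * a * (g⁻¹ * L * g⁻¹)) = (aᵀ * K⁻¹ * a * g⁻¹ * L) * g⁻¹ by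
      simp only [Matrix.mul_assoc], Matrix.trace_mul_comm]
    simp only [Matrix.mul_assoc]
  -- The trace over the kernel is the full trace minus its horizontal part; the former comes from
  -- `det G`, the latter from `det K`.
  have ht3 : (Wᵀ * L * W).trace = (g⁻¹ * L).trace - (X * a * g⁻¹ * L).trace := by
    rw [Matrix.trace_mul_comm, ← Matrix.mul_assoc, hsplit, Matrix.sub_mul, Matrix.trace_sub]
  have hd := (hG.sqrt_det hGd).fun_mul (hKder.sqrt_det hKd)
  convert! hd using 1
  simp only [← hg, ← ha, ← hK]
  rw [ht2, ht3, ht1]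
  ring

end MatrixCalculus

/-! ### Calculus in Euclidean coordinates -/

section Coordinates

open Matrix

variable {m n : ℕ}

/-- The Jacobian matrix of a map between Euclidean spaces. -/
def jac (f : Model m → Model n) (y : Model m) : Matrix (Fin n) (Fin m) ℝ :=
  Matrix.of fun α i => fderiv ℝ f y (EuclideanSpace.single i 1) α

theorem one_le_infty : (1 : WithTop ℕ∞) ≤ ∞ := by exact_mod_cast le_top

theorem two_le_infty : (2 : WithTop ℕ∞) ≤ ∞ := WithTop.coe_le_coe.2 (le_top : (2 : ℕ∞) ≤ ⊤)

theorem clm_apply_eq_sum {F : Type*} [NormedAddCommGroup F] [NormedSpace ℝ F]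
    (L : Model m →L[ℝ] F) (v : Model m) :
    L v = ∑ i, v i • L (EuclideanSpace.single i 1) := by
  conv_lhs => rw [← (EuclideanSpace.basisFun (Fin m) ℝ).sum_repr v]
  simp

theorem jac_mulVec (f : Model m → Model n) (y v : Model m) :
    jac f y *ᵥ v.ofLp = (fderiv ℝ f y v).ofLp := by
  ext α
  rw [clm_apply_eq_sum (fderiv ℝ f y) v]
  simp [Matrix.mulVec, dotProduct, jac, mul_comm]

section Smooth

variable {E : Type*} [NormedAddCommGroup E] [NormedSpace ℝ E] {ι κ μ : Type*} {k : WithTop ℕ∞}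
  {y : E}

theorem contDiffAt_det [Fintype ι] [DecidableEq ι] {G : E → Matrix ι ι ℝ}
    (hG : ∀ i j, ContDiffAt ℝ k (fun z => G z i j) y) :
    ContDiffAt ℝ k (fun z => (G z).det) y := by
  simp only [Matrix.det_apply]
  refine ContDiffAt.sum fun σ _ => ?_
  exact (contDiffAt_prod fun i _ => hG _ _).const_smul _

theorem contDiffAt_inv [Fintype ι] [DecidableEq ι] {G : E → Matrix ι ι ℝ}
    (hG : ∀ i j, ContDiffAt ℝ k (fun z => G z i j) y) (h0 : (G y).det ≠ 0) (i j : ι) :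
    ContDiffAt ℝ k (fun z => (G z)⁻¹ i j) y := by
  simp only [Matrix.inv_def, Ring.inverse_eq_inv', Matrix.smul_apply, smul_eq_mul,
    Matrix.adjugate_apply]
  refine ((contDiffAt_det hG).inv h0).mul (contDiffAt_det fun a b => ?_)
  by_cases ha : a = j
  · subst ha; simpa using contDiffAt_const
  · simpa [Matrix.updateRow_ne ha] using hG a b

theorem contDiffAt_matrix_mul [Fintype κ] {A : E → Matrix ι κ ℝ} {B : E → Matrix κ μ ℝ}
    (hA : ∀ i j, ContDiffAt ℝ k (fun z => A z i j) y)
    (hB : ∀ i j, ContDiffAt ℝ k (fun z => B z i j) y) (i : ι) (j : μ) :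
    ContDiffAt ℝ k (fun z => (A z * B z) i j) y := by
  simp only [Matrix.mul_apply]
  exact ContDiffAt.sum fun a _ => (hA i a).mul (hB a j)

theorem hasEntryDeriv_of_contDiffAt {A : E → Matrix ι κ ℝ} (v : E)
    (hA : ∀ i j, ContDiffAt ℝ 1 (fun z => A z i j) y) :
    HasEntryDeriv (fun s => A (y + s • v)) (Matrix.of fun i j => fderiv ℝ (fun z => A z i j) y v) :=
  fun i j => ((hA i j).differentiableAt one_ne_zero).hasFDerivAt.hasLineDerivAt v

theorem contDiffAt_jac {f : Model m → Model n} {y : Model m} (hf : ContDiffAt ℝ ∞ f y)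
    (α : Fin n) (i : Fin m) : ContDiffAt ℝ ∞ (fun z => jac f z α i) y := by
  have h1 : ContDiffAt ℝ ∞ (fderiv ℝ f) y := hf.fderiv_right (by simp)
  have h2 : ContDiffAt ℝ ∞ (fun z => fderiv ℝ f z (EuclideanSpace.single i 1)) y :=
    h1.clm_apply contDiffAt_const
  exact (contDiffAt_euclidean.1 h2) α

end Smooth

/-- The derivative of the Jacobian matrix in direction `X`, when `jac f * X` is constant. -/
theorem fderiv_jac_of_const {f : Model m → Model n} {X : Model m → Model m} {y : Model m}
    (hf : ContDiffAt ℝ ∞ f y) (hX : ContDiffAt ℝ ∞ X y) {c : Model n}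
    (hc : ∀ᶠ z in 𝓝 y, fderiv ℝ f z (X z) = c) :
    (Matrix.of fun α i => fderiv ℝ (fun z => jac f z α i) y (X y)) = -(jac f y * jac X y) := by
  have h1 : DifferentiableAt ℝ (fderiv ℝ f) y :=
    (hf.fderiv_right (m := 1) (one_add_one_eq_two.trans_le two_le_infty)).differentiableAt one_ne_zero
  have hX1 : DifferentiableAt ℝ X y := hX.differentiableAt (by simp)
  have hsymm : IsSymmSndFDerivAt ℝ f y := hf.isSymmSndFDerivAt (by simpa using two_le_infty)
  ext α i
  -- Differentiating `Df(X) = c` along `eᵢ` gives `D²f(eᵢ, X) + Df(DX eᵢ) = 0`; symmetry of `D²f`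
  -- turns the first term into the derivative of the Jacobian along `X`.
  have h2 : HasFDerivAt (fun z => fderiv ℝ f z (X z)) 0 y :=
    (hasFDerivAt_const (𝕜 := ℝ) c y).congr_of_eventuallyEq hc
  have h3 := h1.hasFDerivAt.clm_apply hX1.hasFDerivAt
  have h4 := congrArg (fun L : Model m →L[ℝ] Model n => L (EuclideanSpace.single i 1) α)
    (h2.unique h3)
  simp only [_root_.zero_apply, PiLp.zero_apply, _root_.add_apply,
    ContinuousLinearMap.comp_apply, ContinuousLinearMap.flip_apply, PiLp.add_apply] at h4
  have h5 : fderiv ℝ (fun z => jac f z α i) y (X y)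
      = fderiv ℝ (fderiv ℝ f) y (X y) (EuclideanSpace.single i 1) α := by
    have h6 : HasFDerivAt (fun z => jac f z α i)
        ((EuclideanSpace.proj α : Model n →L[ℝ] ℝ).comp
          ((ContinuousLinearMap.apply ℝ (Model n) (EuclideanSpace.single i (1 : ℝ))).comp
            (fderiv ℝ (fderiv ℝ f) y))) y := by
      have := (ContinuousLinearMap.hasFDerivAt (ContinuousLinearMap.apply ℝ (Model n)
        (EuclideanSpace.single i (1 : ℝ) : Model m))).comp y h1.hasFDerivAt
      exact (ContinuousLinearMap.hasFDerivAt (EuclideanSpace.proj α : Model n →L[ℝ] ℝ)).comp y this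
    rw [h6.fderiv]; rfl
  have h7 : (jac f y * jac X y) α i
      = fderiv ℝ f y (fderiv ℝ X y (EuclideanSpace.single i 1)) α := by
    have := congrFun (jac_mulVec f y (fderiv ℝ X y (EuclideanSpace.single i 1))) α
    rw [← this]; rfl
  rw [Matrix.of_apply, Matrix.neg_apply, h5, h7, hsymm.eq]
  linarith

/-- The divergence-type expression `∑ⱼ ∂ⱼ(ρ κ Xʲ)`, where `ρ = √det G`, `κ = √det (A G⁻¹ Aᵀ)`,
`A` is the Jacobian matrix of `f`, and `X` is a lift of a constant vector field by `f`. -/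
theorem sum_fderiv_density_mul {G : Model m → Matrix (Fin m) (Fin m) ℝ} {f : Model m → Model n}
    {X : Model m → Model m} {y : Model m} {W : Matrix (Fin m) (Fin (m - n)) ℝ} (hmn : n ≤ m)
    (hf : ContDiffAt ℝ ∞ f y) (hX : ContDiffAt ℝ ∞ X y) {c : Model n}
    (hc : ∀ᶠ z in 𝓝 y, fderiv ℝ f z (X z) = c)
    (hG : ∀ i j, ContDiffAt ℝ ∞ (fun z => G z i j) y)
    (hGs : (G y)ᵀ = G y) (hGd : 0 < (G y).det)
    (hKd : 0 < (jac f y * (G y)⁻¹ * (jac f y)ᵀ).det)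
    (hAW : jac f y * W = 0) (hWW : Wᵀ * G y * W = 1) :
    ∑ j, fderiv ℝ (fun z => √((G z).det) * √((jac f z * (G z)⁻¹ * (jac f z)ᵀ).det) * X z j) y
        (EuclideanSpace.single j 1)
      = √((G y).det) * √((jac f y * (G y)⁻¹ * (jac f y)ᵀ).det) * ((1 / 2) * (Wᵀ *
        ((Matrix.of fun i j => fderiv ℝ (fun z => G z i j) y (X y)) + (jac X y)ᵀ * G y
          + G y * jac X y) * W).trace) := by
  set ψ : Model m → ℝ := fun z => √((G z).det) * √((jac f z * (G z)⁻¹ * (jac f z)ᵀ).det) with hψ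
  have hA := contDiffAt_jac hf
  have hψd : DifferentiableAt ℝ ψ y := by
    have h1 : ContDiffAt ℝ ∞ (fun z => (G z).det) y := contDiffAt_det hG
    have h2 : ContDiffAt ℝ ∞ (fun z => (jac f z * (G z)⁻¹ * (jac f z)ᵀ).det) y :=
      contDiffAt_det (contDiffAt_matrix_mul
        (contDiffAt_matrix_mul hA (contDiffAt_inv hG hGd.ne')) fun i j => hA j i)
    exact ((h1.differentiableAt (by simp)).sqrt hGd.ne').mul
      ((h2.differentiableAt (by simp)).sqrt hKd.ne')
  have hXd : DifferentiableAt ℝ X y := hX.differentiableAt (by simp)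
  have hAe : HasEntryDeriv (fun s : ℝ => jac f (y + s • X y)) (-(jac f y * jac X y)) := by
    rw [← fderiv_jac_of_const hf hX hc]
    exact hasEntryDeriv_of_contDiffAt (A := jac f) (X y)
      fun i j => (hA i j).of_le one_le_infty
  have hGe : HasEntryDeriv (fun s : ℝ => G (y + s • X y)) _ :=
    hasEntryDeriv_of_contDiffAt (A := G) (X y)
      fun i j => (hG i j).of_le one_le_infty
  have hmain := hasDerivAt_sqrt_det_mul_sqrt_det (W := W) (N := jac X y) (A := fun s : ℝ => jac f (y + s • X y))
    (by simp only [Fintype.card_fin]; omega) hGe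
    (by simpa using hAe) (by simpa using hGs) (by simpa using hGd) (by simpa using hKd)
    (by simpa using hAW) (by simpa using hWW)
  have hline := (hψd.hasFDerivAt.hasLineDerivAt (X y)).unique hmain
  simp only [zero_smul, add_zero] at hline
  have hj : ∀ j, fderiv ℝ (fun z => ψ z * X z j) y (EuclideanSpace.single j 1)
      = X y j * fderiv ℝ ψ y (EuclideanSpace.single j 1) + ψ y * jac X y j j := by
    intro j
    have hXj : HasFDerivAt (fun z => X z j)
        ((EuclideanSpace.proj j : Model m →L[ℝ] ℝ).comp (fderiv ℝ X y)) y :=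
      (ContinuousLinearMap.hasFDerivAt (EuclideanSpace.proj j : Model m →L[ℝ] ℝ)).comp y
        hXd.hasFDerivAt
    rw [(hψd.hasFDerivAt.fun_mul hXj).fderiv]
    simp [jac]
    ring
  -- The divergence of `X` arising from the product rule cancels the `-N.trace` in the derivative of
  -- the density.
  refine (Finset.sum_congr rfl fun j _ => hj j).trans ?_
  rw [Finset.sum_add_distrib, ← Finset.mul_sum,
    show ∑ j, X y j * fderiv ℝ ψ y (EuclideanSpace.single j 1) = fderiv ℝ ψ y (X y) by
      rw [clm_apply_eq_sum (fderiv ℝ ψ y) (X y)]; rfl, hline]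
  simp only [hψ, Matrix.trace, Matrix.diag]
  ring

/-- The Christoffel symbols of a matrix-valued function on Euclidean space. -/
def chartChristoffel (G : Model m → Matrix (Fin m) (Fin m) ℝ) (y : Model m) (k i j : Fin m) : ℝ :=
  (1 / 2 : ℝ) * ∑ l, (G y)⁻¹ k l *
    (fderiv ℝ (fun z => G z j l) y (EuclideanSpace.single i 1)
      + fderiv ℝ (fun z => G z i l) y (EuclideanSpace.single j 1)
      - fderiv ℝ (fun z => G z i j) y (EuclideanSpace.single l 1))

/-- For a vector field `w` orthogonal to `X`, `g(∇_w w, X) = -½ (L_X g)(w, w)`. -/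
theorem inner_covDeriv_self {G : Model m → Matrix (Fin m) (Fin m) ℝ} {w X : Model m → Model m}
    {y : Model m} (hG : ∀ i j, DifferentiableAt ℝ (fun z => G z i j) y)
    (hw : DifferentiableAt ℝ w y) (hX : DifferentiableAt ℝ X y)
    (hGs : (G y)ᵀ = G y) (hGd : IsUnit (G y).det)
    (hort : ∀ᶠ z in 𝓝 y, ∑ k, ∑ l, G z k l * w z k * X z l = 0) :
    (∑ k, ∑ l, G y k l * (fderiv ℝ w y (w y) k
        + ∑ i, ∑ j, chartChristoffel G y k i j * w y i * w y j) * X y l)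
      = -(1 / 2) * (w y).ofLp ⬝ᵥ (((Matrix.of fun i j => fderiv ℝ (fun z => G z i j) y (X y))
          + (jac X y)ᵀ * G y + G y * jac X y) *ᵥ (w y).ofLp) := by
  have hcoord : ∀ {V : Model m → Model m}, DifferentiableAt ℝ V y → ∀ k,
      HasFDerivAt (fun z => V z k) ((EuclideanSpace.proj k : Model m →L[ℝ] ℝ).comp (fderiv ℝ V y))
        y := fun hV k =>
    (ContinuousLinearMap.hasFDerivAt (EuclideanSpace.proj k : Model m →L[ℝ] ℝ)).comp y
      hV.hasFDerivAt
  set dG : Fin m → Fin m → Fin m → ℝ :=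
    fun l i j => fderiv ℝ (fun z => G z i j) y (EuclideanSpace.single l 1) with hdG
  have hdGv : ∀ (v : Model m) i j, fderiv ℝ (fun z => G z i j) y v = ∑ l, v l * dG l i j :=
    fun v i j => clm_apply_eq_sum _ v
  set a := w y with ha
  set x := X y with hx
  have hsym : ∀ i j, G y i j = G y j i := fun i j => by
    conv_lhs => rw [← hGs]
    rfl
  -- differentiating the orthogonality relation
  have h1 : ∑ k, ∑ l, ((∑ i, a i * dG i k l) * a k * x l + G y k l * fderiv ℝ w y a k * x l
      + G y k l * a k * fderiv ℝ X y a l) = 0 := by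
    have h2 := (hasFDerivAt_const (𝕜 := ℝ) (0 : ℝ) y).congr_of_eventuallyEq hort
    have h3 := HasFDerivAt.fun_sum (𝕜 := ℝ) (u := Finset.univ) fun k _ =>
      HasFDerivAt.fun_sum (𝕜 := ℝ) (u := Finset.univ) fun l _ =>
      (((hG k l).hasFDerivAt.fun_mul (hcoord hw k)).fun_mul (hcoord hX l))
    have h4 := congrArg (fun L : Model m →L[ℝ] ℝ => L a) (h2.unique h3)
    simp only [_root_.zero_apply, _root_.sum_apply,
      _root_.add_apply, _root_.smul_apply,
      ContinuousLinearMap.comp_apply, hdGv, smul_eq_mul] at h4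
    rw [h4]
    refine Finset.sum_congr rfl fun k _ => Finset.sum_congr rfl fun l _ => ?_
    simp only [PiLp.proj_apply, ← ha, ← hx]
    ring
  -- the Christoffel term
  have h2 : ∑ k, ∑ l, G y k l * (∑ i, ∑ j, chartChristoffel G y k i j * a i * a j) * x l
      = ∑ l, ∑ i, ∑ j, (1 / 2) * x l * (dG i j l + dG j i l - dG l i j) * a i * a j := by
    set b : Fin m → ℝ := fun l => ∑ i, ∑ j, (1 / 2) * (dG i j l + dG j i l - dG l i j) * a i * a j
      with hb
    have hk : ∀ k, ∑ i, ∑ j, chartChristoffel G y k i j * a i * a j = ((G y)⁻¹ *ᵥ b) k := by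
      intro k
      simp only [chartChristoffel, Matrix.mulVec, dotProduct, hb, Finset.mul_sum, Finset.sum_mul]
      rw [Finset.sum_comm]
      conv_rhs => rw [Finset.sum_comm]
      rw [Finset.sum_comm]
      refine Finset.sum_congr rfl fun i _ => ?_
      conv_rhs => rw [Finset.sum_comm]
      refine Finset.sum_congr rfl fun j _ => Finset.sum_congr rfl fun l _ => ?_
      simp only [hdG]; ring
    simp_rw [hk]
    have h3 : ∀ l, ∑ k, G y k l * ((G y)⁻¹ *ᵥ b) k = b l := by
      intro l
      have : G y *ᵥ ((G y)⁻¹ *ᵥ b) = b := by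
        rw [Matrix.mulVec_mulVec, Matrix.mul_nonsing_inv _ hGd, Matrix.one_mulVec]
      conv_rhs => rw [← this]
      simp only [Matrix.mulVec, dotProduct, hsym _ l]
    rw [Finset.sum_comm]
    refine Finset.sum_congr rfl fun l _ => ?_
    rw [← Finset.sum_mul, h3, hb, mul_comm]
    simp only [Finset.mul_sum]
    refine Finset.sum_congr rfl fun i _ => Finset.sum_congr rfl fun j _ => ?_
    ring
  have hNa : ∀ k, fderiv ℝ X y a k = ∑ i, jac X y k i * a i := fun k =>
    (congrFun (jac_mulVec X y a) k).symm
  have hL : a.ofLp ⬝ᵥ (((Matrix.of fun i j => fderiv ℝ (fun z => G z i j) y x)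
          + (jac X y)ᵀ * G y + G y * jac X y) *ᵥ a.ofLp)
      = (∑ l, ∑ i, ∑ j, x l * dG l i j * a i * a j)
        + 2 * ∑ k, ∑ l, G y k l * a k * fderiv ℝ X y a l := by
    have e1 : a.ofLp ⬝ᵥ ((Matrix.of fun i j => fderiv ℝ (fun z => G z i j) y x) *ᵥ a.ofLp)
        = ∑ l, ∑ i, ∑ j, x l * dG l i j * a i * a j := by
      simp only [Matrix.mulVec, dotProduct, Matrix.of_apply, hdGv, Finset.mul_sum, Finset.sum_mul]
      rw [Finset.sum_comm]
      conv_rhs => rw [Finset.sum_comm]; enter [2, i]; rw [Finset.sum_comm]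
      rw [Finset.sum_comm]
      refine Finset.sum_congr rfl fun i _ => Finset.sum_congr rfl fun j _ =>
        Finset.sum_congr rfl fun l _ => ?_
      ring
    have e3 : a.ofLp ⬝ᵥ ((G y * jac X y) *ᵥ a.ofLp) = ∑ k, ∑ l, G y k l * a k * fderiv ℝ X y a l := by
      rw [← Matrix.mulVec_mulVec, jac_mulVec]
      simp only [Matrix.mulVec, dotProduct, Finset.mul_sum]
      refine Finset.sum_congr rfl fun i _ => Finset.sum_congr rfl fun j _ => ?_
      ring
    have e2 : a.ofLp ⬝ᵥ (((jac X y)ᵀ * G y) *ᵥ a.ofLp) = a.ofLp ⬝ᵥ ((G y * jac X y) *ᵥ a.ofLp) := by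
      have : (jac X y)ᵀ * G y = (G y * jac X y)ᵀ := by rw [Matrix.transpose_mul, hGs]
      rw [this, Matrix.mulVec_transpose, dotProduct_comm, Matrix.dotProduct_mulVec]
    rw [Matrix.add_mulVec, Matrix.add_mulVec, dotProduct_add, dotProduct_add, e1, e2, e3]
    ring
  rw [hL]
  have h5 : ∑ k, ∑ l, (∑ i, a i * dG i k l) * a k * x l
      = ∑ l, ∑ i, ∑ j, x l * dG i j l * a i * a j := by
    rw [Finset.sum_comm]
    refine Finset.sum_congr rfl fun l _ => ?_
    rw [Finset.sum_comm]
    refine Finset.sum_congr rfl fun k _ => ?_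
    simp only [Finset.sum_mul]
    refine Finset.sum_congr rfl fun i _ => ?_
    ring
  have h6 : ∑ l, ∑ i, ∑ j, x l * dG j i l * a i * a j
      = ∑ l, ∑ i, ∑ j, x l * dG i j l * a i * a j := by
    refine Finset.sum_congr rfl fun l _ => ?_
    rw [Finset.sum_comm]
    refine Finset.sum_congr rfl fun k _ => Finset.sum_congr rfl fun i _ => ?_
    ring
  have h7 : ∑ l, ∑ i, ∑ j, (1 / 2) * x l * (dG i j l + dG j i l - dG l i j) * a i * a j
      = (1 / 2) * (∑ l, ∑ i, ∑ j, x l * dG i j l * a i * a j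
        + ∑ l, ∑ i, ∑ j, x l * dG j i l * a i * a j
        - ∑ l, ∑ i, ∑ j, x l * dG l i j * a i * a j) := by
    simp only [← Finset.sum_add_distrib, ← Finset.sum_sub_distrib, Finset.mul_sum]
    refine Finset.sum_congr rfl fun l _ => Finset.sum_congr rfl fun i _ =>
      Finset.sum_congr rfl fun j _ => ?_
    ring
  -- By symmetry in `i` and `j`, the first two Christoffel terms add up to the derivative of `G`
  -- along `w`, paired with `w` and `X`. The differentiated orthogonality relation trades it,
  -- together with the `∂_w w` term, for `-G(w, ∂_w X)`; the third term is `-½ (∂_X G)(w, w)`.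
  simp only [mul_add, add_mul, Finset.sum_add_distrib] at h1 ⊢
  rw [h2, h7, h6]
  rw [h5] at h1
  linarith

end Coordinates

/-! ### First variation of the energy density in Euclidean coordinates -/

section FirstVariation

open Matrix

variable {m n : ℕ}

theorem trace_transpose_mul_eq_sum (C B : Matrix (Fin n) (Fin m) ℝ) :
    (Cᵀ * B).trace = ∑ β, ∑ j, C β j * B β j := by
  rw [Finset.sum_comm]
  simp only [Matrix.trace, Matrix.diag, Matrix.mul_apply, Matrix.transpose_apply]

theorem jac_slice {w : ℝ × Model m → Model n} {t : ℝ} {y : Model m}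
    (hw : DifferentiableAt ℝ w (t, y)) (α : Fin n) (i : Fin m) :
    jac (fun z => w (t, z)) y α i = fderiv ℝ w (t, y) (0, EuclideanSpace.single i 1) α := by
  have h : HasFDerivAt (fun z => w (t, z))
      ((fderiv ℝ w (t, y)).comp (ContinuousLinearMap.inr ℝ ℝ (Model m))) y :=
    hw.hasFDerivAt.comp y (hasFDerivAt_prodMk_right t y)
  simp [jac, h.fderiv]

/-- The time derivative of the spatial Jacobian is the Jacobian of the variation field. -/
theorem hasEntryDeriv_jac_slice {w : ℝ × Model m → Model n} {y : Model m}
    (hw : ContDiffAt ℝ ∞ w (0, y)) :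
    HasEntryDeriv (fun t => jac (fun z => w (t, z)) y)
      (jac (fun z => fderiv ℝ w (0, z) (1, 0)) y) := by
  have h1 : DifferentiableAt ℝ (fderiv ℝ w) (0, y) :=
    (hw.fderiv_right (m := 1) (one_add_one_eq_two.trans_le two_le_infty)).differentiableAt one_ne_zero
  have hsymm : IsSymmSndFDerivAt ℝ w (0, y) :=
    hw.isSymmSndFDerivAt (by simpa using two_le_infty)
  intro α i
  have hev : ∀ᶠ q in 𝓝 ((0 : ℝ), y), DifferentiableAt ℝ w q :=
    ((hw.of_le one_le_infty).eventually (by simp)).mono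
      fun q hq => hq.differentiableAt one_ne_zero
  have hev' : ∀ᶠ t in 𝓝 (0 : ℝ), DifferentiableAt ℝ w (t, y) :=
    (Continuous.prodMk_left y).continuousAt.eventually hev
  have h2 : HasFDerivAt (fun z => fderiv ℝ w (0, z) (1, 0))
      ((ContinuousLinearMap.apply ℝ (Model n) ((1 : ℝ), (0 : Model m))).comp
        ((fderiv ℝ (fderiv ℝ w) (0, y)).comp (ContinuousLinearMap.inr ℝ ℝ (Model m)))) y :=
    HasFDerivAt.comp (g := fun L : (ℝ × Model m) →L[ℝ] Model n => L ((1 : ℝ), (0 : Model m))) y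
      (ContinuousLinearMap.apply ℝ (Model n) ((1 : ℝ), (0 : Model m))).hasFDerivAt
      (HasFDerivAt.comp (g := fderiv ℝ w) y h1.hasFDerivAt
        (hasFDerivAt_prodMk_right (0 : ℝ) y))
  have h3 : HasDerivAt (fun t : ℝ => fderiv ℝ w (t, y) (0, EuclideanSpace.single i 1) α)
      (fderiv ℝ (fderiv ℝ w) (0, y) (1, 0) (0, EuclideanSpace.single i 1) α) 0 := by
    have h4 : HasDerivAt (fun t : ℝ => fderiv ℝ w (t, y))
        (fderiv ℝ (fderiv ℝ w) (0, y) (1, 0)) 0 := by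
      exact HasFDerivAt.comp_hasDerivAt (l := fderiv ℝ w) (f := fun t : ℝ => (t, y)) (0 : ℝ)
        h1.hasFDerivAt ((hasDerivAt_id (0 : ℝ)).prodMk (hasDerivAt_const (0 : ℝ) y))
    have h5 := (ContinuousLinearMap.hasFDerivAt ((EuclideanSpace.proj α : Model n →L[ℝ] ℝ).comp
      (ContinuousLinearMap.apply ℝ (Model n) ((0 : ℝ), (EuclideanSpace.single i 1 : Model m))))
      (x := fderiv ℝ w (0, y))).comp_hasDerivAt (0 : ℝ) h4
    exact h5
  have h6 : jac (fun z => fderiv ℝ w (0, z) (1, 0)) y α i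
      = fderiv ℝ (fderiv ℝ w) (0, y) (1, 0) (0, EuclideanSpace.single i 1) α := by
    rw [jac, Matrix.of_apply, h2.fderiv, hsymm.eq]
    rfl
  rw [h6]
  exact h3.congr_of_eventuallyEq (hev'.mono fun t ht => jac_slice ht α i)

/-- The energy density in coordinates: `½ tr(G⁻¹ Aᵀ H A)`. -/
def matrixEnergy (G : Matrix (Fin m) (Fin m) ℝ) (H : Matrix (Fin n) (Fin n) ℝ)
    (A : Matrix (Fin n) (Fin m) ℝ) : ℝ :=
  (1 / 2) * (G⁻¹ * Aᵀ * H * A).trace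

/-- The first variation of the energy density of a conformal map in coordinates. -/
theorem hasDerivAt_matrixEnergy {G : Matrix (Fin m) (Fin m) ℝ}
    {H : Model 2 → Matrix (Fin 2) (Fin 2) ℝ} {w : ℝ × Model m → Model 2} {y : Model m} {c : ℝ}
    (hw : ContDiffAt ℝ ∞ w (0, y)) (hGs : Gᵀ = G)
    (hH : ∀ α β, ContDiffAt ℝ ∞ (fun z => H z α β) (w (0, y)))
    (hHs : (H (w (0, y)))ᵀ = H (w (0, y))) (hHd : 0 < (H (w (0, y))).det)
    (hconf : H (w (0, y)) * jac (fun z => w (0, z)) y * G⁻¹ * (jac (fun z => w (0, z)) y)ᵀ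
      = c • (1 : Matrix (Fin 2) (Fin 2) ℝ)) :
    HasDerivAt (fun t => matrixEnergy G (H (w (t, y))) (jac (fun z => w (t, z)) y))
      (∑ β, ∑ j, (H (w (0, y)) * jac (fun z => w (0, z)) y * G⁻¹) β j / √((H (w (0, y))).det) *
        fderiv ℝ (fun z => √((H (w (0, z))).det) * (fderiv ℝ w (0, z) (1, 0)) β) y
          (EuclideanSpace.single j 1)) 0 := by
  have hA := hasEntryDeriv_jac_slice hw
  set A : ℝ → Matrix (Fin 2) (Fin m) ℝ := fun t => jac (fun z => w (t, z)) y with hAdef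
  set V : Model m → Model 2 := fun z => fderiv ℝ w (0, z) (1, 0) with hV
  have hwd : DifferentiableAt ℝ w (0, y) := hw.differentiableAt (by simp)
  have hwt : HasDerivAt (fun t => w (t, y)) (V y) 0 := by
    exact HasFDerivAt.comp_hasDerivAt (l := w) (f := fun t : ℝ => (t, y)) (0 : ℝ)
      hwd.hasFDerivAt ((hasDerivAt_id (0 : ℝ)).prodMk (hasDerivAt_const (0 : ℝ) y))
  set H0 := H (w (0, y)) with hH0
  set H' : Matrix (Fin 2) (Fin 2) ℝ :=
    Matrix.of fun α β => fderiv ℝ (fun z => H z α β) (w (0, y)) (V y) with hH'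
  have hHt : HasEntryDeriv (fun t => H (w (t, y))) H' := fun α β =>
    HasFDerivAt.comp_hasDerivAt (l := fun z => H z α β) (0 : ℝ)
      ((hH α β).differentiableAt (by simp)).hasFDerivAt hwt
  set J : Model 2 → ℝ := fun z => √((H z).det) with hJ
  have hJd : DifferentiableAt ℝ J (w (0, y)) :=
    ((contDiffAt_det hH).differentiableAt (by simp)).sqrt hHd.ne'
  have hJ0 : 0 < J (w (0, y)) := Real.sqrt_pos.2 hHd
  have hHu : IsUnit H0.det := isUnit_iff_ne_zero.2 hHd.ne'
  have hJ' : fderiv ℝ J (w (0, y)) (V y) = J (w (0, y)) * ((1 / 2) * (H0⁻¹ * H').trace) :=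
    (HasFDerivAt.comp_hasDerivAt (l := J) (0 : ℝ) hJd.hasFDerivAt hwt).unique (hHt.sqrt_det hHd)
  have hGc : HasEntryDeriv (fun _ : ℝ => G⁻¹) 0 := fun i j => hasDerivAt_const _ _
  have hE := ((((hGc.mul hA.transpose).mul hHt).mul hA).trace).const_mul (1 / 2 : ℝ)
  have hgs : (G⁻¹)ᵀ = G⁻¹ := by rw [Matrix.transpose_nonsing_inv, hGs]
  set a := A 0 with ha
  have haG : a * G⁻¹ * aᵀ = c • H0⁻¹ := by
    have := congrArg (fun M => H0⁻¹ * M) hconf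
    simpa [Matrix.mul_assoc, Matrix.nonsing_inv_mul_cancel_left _ _ hHu] using this
  set B := jac V y with hB
  have ht1 : (G⁻¹ * aᵀ * H0 * B).trace = ∑ β, ∑ j, (H0 * a * G⁻¹) β j * B β j := by
    have : G⁻¹ * aᵀ * H0 = (H0 * a * G⁻¹)ᵀ := by
      rw [Matrix.transpose_mul, Matrix.transpose_mul, hgs, hHs, Matrix.mul_assoc]
    rw [this, trace_transpose_mul_eq_sum]
  have ht2 : (G⁻¹ * Bᵀ * H0 * a).trace = (G⁻¹ * aᵀ * H0 * B).trace := by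
    rw [← Matrix.trace_transpose]
    simp only [Matrix.transpose_mul, Matrix.transpose_transpose, hgs, hHs]
    rw [show aᵀ * (H0 * (B * G⁻¹)) = (aᵀ * H0 * B) * G⁻¹ by simp only [Matrix.mul_assoc],
      Matrix.trace_mul_comm]
    simp only [Matrix.mul_assoc]
  -- Conformality replaces `a G⁻¹ aᵀ` by `c H⁻¹`, so the variation of the target metric enters only
  -- through `tr(H⁻¹ H')`, twice the logarithmic derivative of `J`.
  have ht3 : (G⁻¹ * aᵀ * H' * a).trace = c * (H0⁻¹ * H').trace := by
    rw [Matrix.trace_mul_comm, ← Matrix.mul_assoc, ← Matrix.mul_assoc, haG, Matrix.smul_mul,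
      Matrix.trace_smul, smul_eq_mul]
  have hVd : ContDiffAt ℝ ∞ V y := by
    have h1 : ContDiffAt ℝ ∞ (fderiv ℝ w) (0, y) := hw.fderiv_right (by simp)
    have h2 : ContDiffAt ℝ ∞ (fun z => fderiv ℝ w (0, z)) y :=
      h1.comp y (contDiffAt_const.prodMk contDiffAt_id)
    exact h2.clm_apply contDiffAt_const
  have hwy : HasFDerivAt (fun z => w (0, z)) (fderiv ℝ (fun z => w (0, z)) y) y := by
    have h : HasFDerivAt (fun z => w (0, z))
      ((fderiv ℝ w (0, y)).comp (ContinuousLinearMap.inr ℝ ℝ (Model m))) y :=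
      hwd.hasFDerivAt.comp y (hasFDerivAt_prodMk_right (0 : ℝ) y)
    exact h.differentiableAt.hasFDerivAt
  have hfd : ∀ β j, fderiv ℝ (fun z => J (w (0, z)) * V z β) y (EuclideanSpace.single j 1)
      = J (w (0, y)) * B β j + V y β * ∑ γ, a γ j * fderiv ℝ J (w (0, y)) (EuclideanSpace.single γ 1) := by
    intro β j
    have h1 : HasFDerivAt (fun z => V z β)
        ((EuclideanSpace.proj β : Model 2 →L[ℝ] ℝ).comp (fderiv ℝ V y)) y :=
      (ContinuousLinearMap.hasFDerivAt (EuclideanSpace.proj β : Model 2 →L[ℝ] ℝ)).comp y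
        (hVd.differentiableAt (by simp)).hasFDerivAt
    have h2 : HasFDerivAt (fun z => J (w (0, z)))
        ((fderiv ℝ J (w (0, y))).comp (fderiv ℝ (fun z => w (0, z)) y)) y :=
      HasFDerivAt.comp (g := J) y hJd.hasFDerivAt hwy
    rw [(h2.fun_mul h1).fderiv]
    simp only [_root_.add_apply, _root_.smul_apply,
      ContinuousLinearMap.comp_apply, smul_eq_mul, PiLp.proj_apply]
    rw [clm_apply_eq_sum (fderiv ℝ J (w (0, y)))]
    rfl
  have hCA : ∀ β γ, ∑ j, (H0 * a * G⁻¹) β j * a γ j = if β = γ then c else 0 := by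
    intro β γ
    have := congrFun (congrFun hconf β) γ
    rw [Matrix.mul_apply] at this
    simpa [Matrix.one_apply] using this
  convert! hE using 1
  simp only [Matrix.zero_mul, zero_add, Matrix.add_mul, Matrix.trace_add]
  change _ = 1 / 2 * ((G⁻¹ * Bᵀ * H0 * a).trace + (G⁻¹ * aᵀ * H' * a).trace
    + (G⁻¹ * aᵀ * H0 * B).trace)
  rw [ht2, ht3, ht1]
  have hJV : fderiv ℝ J (w (0, y)) (V y)
      = ∑ β, V y β * fderiv ℝ J (w (0, y)) (EuclideanSpace.single β 1) := by
    rw [clm_apply_eq_sum (fderiv ℝ J (w (0, y)))]; rfl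
  -- Conformality again: contracting the gradient of `J ∘ w` with `H A G⁻¹` returns `c` times the
  -- partial derivative of `J`. Summed over `β`, this is the contribution of `ht3`.
  have hsum : ∀ β, ∑ j, (H0 * a * G⁻¹) β j / J (w (0, y)) *
      fderiv ℝ (fun z => J (w (0, z)) * V z β) y (EuclideanSpace.single j 1)
      = ∑ j, (H0 * a * G⁻¹) β j * B β j
        + c / J (w (0, y)) * (V y β * fderiv ℝ J (w (0, y)) (EuclideanSpace.single β 1)) := by
    intro β
    have h1 : ∑ j, (H0 * a * G⁻¹) β j * ∑ γ, a γ j * fderiv ℝ J (w (0, y)) (EuclideanSpace.single γ 1)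
        = c * fderiv ℝ J (w (0, y)) (EuclideanSpace.single β 1) := by
      simp only [Finset.mul_sum]
      rw [Finset.sum_comm]
      simp only [← mul_assoc, ← Finset.sum_mul, hCA]
      simp
    have h2 : ∀ j, (H0 * a * G⁻¹) β j / J (w (0, y)) *
        fderiv ℝ (fun z => J (w (0, z)) * V z β) y (EuclideanSpace.single j 1)
        = (H0 * a * G⁻¹) β j * B β j + V y β / J (w (0, y)) * ((H0 * a * G⁻¹) β j *
          ∑ γ, a γ j * fderiv ℝ J (w (0, y)) (EuclideanSpace.single γ 1)) := by
      intro j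
      rw [hfd]
      field_simp
    rw [Finset.sum_congr rfl fun j _ => h2 j, Finset.sum_add_distrib, ← Finset.mul_sum, h1]
    ring
  refine (Finset.sum_congr rfl fun β _ => hsum β).trans ?_
  rw [Finset.sum_add_distrib, ← Finset.mul_sum, ← hJV, hJ']
  field_simp
  ring

end FirstVariation

/-! ### Integration by parts and differentiation under the integral sign -/

section Integration

variable {m : ℕ}

/-- Integration by parts against the constant function `1`. -/
theorem integral_fderiv_eq_zero {F : Model m → ℝ} (hF : ContDiff ℝ 1 F) (hc : HasCompactSupport F)
    (v : Model m) : ∫ y, fderiv ℝ F y v = 0 := by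
  have hint : Integrable (fun y => fderiv ℝ F y v) :=
    ((hF.continuous_fderiv one_ne_zero).clm_apply continuous_const).integrable_of_hasCompactSupport
      (hc.fderiv_apply ℝ v)
  have h := integral_mul_fderiv_eq_neg_fderiv_mul_of_integrable (μ := (volume : Measure (Model m)))
    (f := fun _ : Model m => (1 : ℝ)) (g := F) (v := v) (by simp) (by simpa using hint)
    (by simpa using hF.continuous.integrable_of_hasCompactSupport hc)
    (fun x _ => differentiableAt_const _) (fun x _ => hF.differentiable one_ne_zero x)
  simpa using h

/-- The divergence theorem for `f S`, where the function `f` is supported in a compact subset `k`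
of the open set `O` and the vector field `S` is of class `C¹` on `O`. -/
theorem setIntegral_sum_mul_fderiv {O k : Set (Model m)} (hO : IsOpen O) (hk : IsCompact k)
    (hkO : k ⊆ O) {f : Model m → ℝ} {S : Fin m → Model m → ℝ}
    (hf : ∀ y ∈ O, ContDiffAt ℝ 1 f y) (hf0 : ∀ y ∈ O, y ∉ k → f y = 0)
    (hS : ∀ j, ∀ y ∈ O, ContDiffAt ℝ 1 (S j) y) :
    ∫ y in k, ∑ j, S j y * fderiv ℝ f y (EuclideanSpace.single j 1)
      = -∫ y in k, f y * ∑ j, fderiv ℝ (S j) y (EuclideanSpace.single j 1) := by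
  classical
  -- Extension by zero of `f S`, which is only controlled on `O`. It is `C¹` on the whole space:
  -- near a point of `k` it equals `f S`, since `f` vanishes on `O` outside `k`, and the complement
  -- of `k` is open.
  let F : Fin m → Model m → ℝ := fun j => k.indicator fun y => f y * S j y
  have hFe : ∀ j, ∀ y ∈ O, F j =ᶠ[𝓝 y] fun z => f z * S j z := by
    intro j y hy
    filter_upwards [hO.mem_nhds hy] with z hz
    by_cases hzk : z ∈ k
    · simp [F, hzk]
    · simp [F, hzk, hf0 z hz hzk]
  have hFz : ∀ j, ∀ y, y ∉ k → F j =ᶠ[𝓝 y] fun _ => 0 := by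
    intro j y hy
    filter_upwards [hk.isClosed.isOpen_compl.mem_nhds hy] with z hz
    simp [F, show z ∉ k from hz]
  have hFc : ∀ j, ContDiff ℝ 1 (F j) := by
    intro j
    rw [contDiff_iff_contDiffAt]
    intro y
    by_cases hy : y ∈ k
    · exact ((hf y (hkO hy)).mul (hS j y (hkO hy))).congr_of_eventuallyEq (hFe j y (hkO hy))
    · exact contDiffAt_const.congr_of_eventuallyEq (hFz j y hy)
  have hFs : ∀ j, HasCompactSupport (F j) := fun j =>
    HasCompactSupport.intro hk fun y hy => by simp [F, hy]
  have h0 : ∀ j, ∫ y in k, fderiv ℝ (F j) y (EuclideanSpace.single j 1) = 0 := by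
    intro j
    rw [setIntegral_eq_integral_of_forall_compl_eq_zero, integral_fderiv_eq_zero (hFc j) (hFs j)]
    intro y hy
    rw [(hFz j y hy).fderiv_eq]
    simp
  have hder : ∀ j, ∀ y ∈ k, fderiv ℝ (F j) y (EuclideanSpace.single j 1)
      = S j y * fderiv ℝ f y (EuclideanSpace.single j 1)
        + f y * fderiv ℝ (S j) y (EuclideanSpace.single j 1) := by
    intro j y hy
    rw [(hFe j y (hkO hy)).fderiv_eq,
      (((hf y (hkO hy)).differentiableAt one_ne_zero).hasFDerivAt.fun_mul
        ((hS j y (hkO hy)).differentiableAt one_ne_zero).hasFDerivAt).fderiv]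
    simp only [_root_.add_apply, _root_.smul_apply, smul_eq_mul]
    ring
  have hcf : ContinuousOn (fun y => fderiv ℝ f y) k := fun y hy =>
    ((hf y (hkO hy)).continuousAt_fderiv one_ne_zero).continuousWithinAt
  have hcS : ∀ j, ContinuousOn (fun y => fderiv ℝ (S j) y) k := fun j y hy =>
    ((hS j y (hkO hy)).continuousAt_fderiv one_ne_zero).continuousWithinAt
  have hcf0 : ContinuousOn f k := fun y hy => (hf y (hkO hy)).continuousAt.continuousWithinAt
  have hcS0 : ∀ j, ContinuousOn (S j) k := fun j y hy =>
    (hS j y (hkO hy)).continuousAt.continuousWithinAt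
  have i1 : ∀ j, IntegrableOn (fun y => S j y * fderiv ℝ f y (EuclideanSpace.single j 1)) k :=
    fun j => ((hcS0 j).mul (hcf.clm_apply continuousOn_const)).integrableOn_compact hk
  have i2 : ∀ j, IntegrableOn (fun y => f y * fderiv ℝ (S j) y (EuclideanSpace.single j 1)) k :=
    fun j => (hcf0.mul ((hcS j).clm_apply continuousOn_const)).integrableOn_compact hk
  simp only [Finset.mul_sum]
  rw [integral_finsetSum _ fun j _ => i1 j, integral_finsetSum _ fun j _ => i2 j,
    ← Finset.sum_neg_distrib]
  refine Finset.sum_congr rfl fun j _ => ?_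
  have h1 := h0 j
  rw [setIntegral_congr_fun hk.measurableSet (hder j), integral_add (i1 j) (i2 j)] at h1
  linarith

/-- Differentiation under the integral sign over a compact set. -/
theorem hasDerivAt_setIntegral_of_continuousOn {M : Type*} [TopologicalSpace M] [T2Space M]
    [MeasurableSpace M] [BorelSpace M] [SecondCountableTopology M]
    {μ : Measure M} {K : Set M} (hK : IsCompact K) (hμ : μ K < ⊤) {Ω : Set (ℝ × M)}
    (hΩ : IsOpen Ω) (hKΩ : ∀ x ∈ K, ((0 : ℝ), x) ∈ Ω) {Φ Φ' : ℝ × M → ℝ}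
    (hΦ : ContinuousOn Φ Ω) (hΦ' : ContinuousOn Φ' Ω)
    (hd : ∀ q ∈ Ω, HasDerivAt (fun t => Φ (t, q.2)) (Φ' q) q.1) :
    HasDerivAt (fun t => ∫ x in K, Φ (t, x) ∂μ) (∫ x in K, Φ' (0, x) ∂μ) 0 := by
  have hfin : IsFiniteMeasure (μ.restrict K) := ⟨by simpa using hμ⟩
  -- Tube lemma: `Ω` is a neighbourhood of the compact slice at time `0`, hence contains a uniform
  -- time interval times `K`. The derivative is bounded on a smaller closed tube.
  obtain ⟨δ, hδ, hδΩ⟩ : ∃ δ > 0, ∀ t ∈ Metric.ball (0 : ℝ) δ, ∀ x ∈ K, (t, x) ∈ Ω := by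
    have := hK.eventually_forall_of_forall_eventually (x₀ := (0 : ℝ))
      (P := fun t x => (t, x) ∈ Ω) fun x hx => hΩ.mem_nhds (hKΩ x hx)
    obtain ⟨δ, hδ, h⟩ := Metric.eventually_nhds_iff_ball.1 this
    exact ⟨δ, hδ, h⟩
  have hcompact : IsCompact (Metric.closedBall (0 : ℝ) (δ / 2) ×ˢ K) :=
    (isCompact_closedBall _ _).prod hK
  have hsub : Metric.closedBall (0 : ℝ) (δ / 2) ×ˢ K ⊆ Ω := fun q hq =>
    hδΩ q.1 (Metric.closedBall_subset_ball (by linarith) hq.1) q.2 hq.2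
  obtain ⟨C, hC⟩ := hcompact.exists_bound_of_continuousOn (hΦ'.mono hsub)
  have hslice : ∀ t ∈ Metric.ball (0 : ℝ) δ, ∀ {Ψ : ℝ × M → ℝ}, ContinuousOn Ψ Ω →
      ContinuousOn (fun x => Ψ (t, x)) K := fun t ht Ψ hΨ =>
    hΨ.comp (Continuous.prodMk_right t).continuousOn fun x hx => hδΩ t ht x hx
  have hmeas : ∀ t ∈ Metric.ball (0 : ℝ) δ, ∀ {Ψ : ℝ × M → ℝ}, ContinuousOn Ψ Ω →
      AEStronglyMeasurable (fun x => Ψ (t, x)) (μ.restrict K) := fun t ht Ψ hΨ =>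
    (hslice t ht hΨ).aestronglyMeasurable_of_isCompact hK hK.measurableSet
  have h0 : (0 : ℝ) ∈ Metric.ball (0 : ℝ) δ := Metric.mem_ball_self hδ
  refine (hasDerivAt_integral_of_dominated_loc_of_deriv_le (F := fun t x => Φ (t, x))
    (F' := fun t x => Φ' (t, x)) (bound := fun _ => C)
    (Metric.ball_mem_nhds (0 : ℝ) (half_pos hδ)) ?_ ?_ (hmeas 0 h0 hΦ') ?_
    (integrable_const C) ?_).2
  · filter_upwards [Metric.ball_mem_nhds (0 : ℝ) hδ] with t ht using hmeas t ht hΦ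
  · obtain ⟨C₀, hC₀⟩ := hK.exists_bound_of_continuousOn (hslice 0 h0 hΦ)
    exact Integrable.of_bound (hmeas 0 h0 hΦ) C₀
      ((ae_restrict_iff' hK.measurableSet).2 (Eventually.of_forall hC₀))
  · refine (ae_restrict_iff' hK.measurableSet).2 (Eventually.of_forall fun x hx t ht => ?_)
    exact hC (t, x) ⟨Metric.ball_subset_closedBall ht, hx⟩
  · refine (ae_restrict_iff' hK.measurableSet).2 (Eventually.of_forall fun x hx t ht => ?_)
    exact hd (t, x) (hδΩ t (Metric.ball_subset_ball (by linarith) ht) x hx)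

end Integration

/-! ### Orthonormal frames of a kernel for a variable metric -/

section GramSchmidt

open Matrix

variable {m n : ℕ}

/-- Smooth Gram–Schmidt orthonormalisation of a family of vector fields that is orthonormal at the
point `y`, with respect to a variable metric `G`, inside the kernel of `L`. -/
theorem exists_orthonormal_fields {G : Model m → Matrix (Fin m) (Fin m) ℝ} {y : Model m}
    {F : Type*} [NormedAddCommGroup F] [NormedSpace ℝ F]
    (hG : ∀ᶠ z in 𝓝 y, ∀ i j, ContDiffAt ℝ ∞ (fun z => G z i j) z)
    (hGs : ∀ᶠ z in 𝓝 y, (G z)ᵀ = G z) (L : Model m → Model m →L[ℝ] F) :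
    ∀ (k : ℕ) (P : Fin k → Model m → Model m),
      (∀ᶠ z in 𝓝 y, ∀ a, ContDiffAt ℝ ∞ (P a) z) → (∀ᶠ z in 𝓝 y, ∀ a, L z (P a z) = 0) →
      (∀ a b, (P a y).ofLp ⬝ᵥ (G y *ᵥ (P b y).ofLp) = if a = b then 1 else 0) →
      ∃ Q : Fin k → Model m → Model m,
        (∀ᶠ z in 𝓝 y, ∀ a, ContDiffAt ℝ ∞ (Q a) z) ∧ (∀ᶠ z in 𝓝 y, ∀ a, L z (Q a z) = 0) ∧
        (∀ᶠ z in 𝓝 y, ∀ a b, (Q a z).ofLp ⬝ᵥ (G z *ᵥ (Q b z).ofLp) = if a = b then 1 else 0) ∧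
        ∀ a, Q a y = P a y := by
  have hsm : ∀ {U V : Model m → Model m} {z : Model m},
      (∀ i j, ContDiffAt ℝ ∞ (fun z => G z i j) z) → ContDiffAt ℝ ∞ U z → ContDiffAt ℝ ∞ V z →
      ContDiffAt ℝ ∞ (fun z => (U z).ofLp ⬝ᵥ (G z *ᵥ (V z).ofLp)) z := by
    intro U V z hGz hU hV
    simp only [dotProduct, Matrix.mulVec]
    exact ContDiffAt.sum fun i _ => (contDiffAt_euclidean.1 hU i).mul
      (ContDiffAt.sum fun j _ => (hGz i j).mul (contDiffAt_euclidean.1 hV j))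
  intro k
  induction k with
  | zero => exact fun P _ _ _ => ⟨P, by simp, by simp, by simp, by simp⟩
  | succ k ih =>
    intro P hP hL ho
    obtain ⟨Q, hQ, hQL, hQo, hQP⟩ := ih (fun a => P a.castSucc)
      (hP.mono fun z hz a => hz _) (hL.mono fun z hz a => hz _)
      (fun a b => by simpa using ho a.castSucc b.castSucc)
    set B : Model m → Model m → Model m → ℝ := fun z v w => v.ofLp ⬝ᵥ (G z *ᵥ w.ofLp) with hB
    have hBadd : ∀ z v v' w, B z (v - v') w = B z v w - B z v' w := fun z v v' w => by
      simp [hB, sub_dotProduct]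
    have hBsmul : ∀ z (c : ℝ) v w, B z (c • v) w = c * B z v w := fun z c v w => by simp [hB]
    have hBsum : ∀ z (v : Fin k → Model m) w, B z (∑ a, v a) w = ∑ a, B z (v a) w :=
      fun z v w => by simp [hB, sum_dotProduct]
    have hBsymm : ∀ᶠ z in 𝓝 y, ∀ v w, B z v w = B z w v := by
      filter_upwards [hGs] with z hz v w
      simp only [hB]
      rw [Matrix.dotProduct_mulVec, ← Matrix.mulVec_transpose, hz, dotProduct_comm]
    set p := P (Fin.last k) with hp
    -- Keeping the values at `y` fixed is part of the induction: it makes the correction vanish at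
    -- `y`, so `R` has unit length there and can be normalised smoothly nearby.
    set R : Model m → Model m := fun z => p z - ∑ a, B z (p z) (Q a z) • Q a z with hR
    have hRy : R y = p y := by
      have : ∀ a, B y (p y) (Q a y) = 0 := fun a => by
        rw [hQP]; simpa [(Fin.castSucc_ne_last a).symm] using! ho (Fin.last k) a.castSucc
      simp [hR, this]
    have hRR : B y (R y) (R y) = 1 := by
      rw [hRy]; simpa using ho (Fin.last k) (Fin.last k)
    have hRs : ∀ᶠ z in 𝓝 y, ContDiffAt ℝ ∞ R z := by
      filter_upwards [hG, hP, hQ] with z h1 h2 h3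
      exact (h2 _).sub (ContDiffAt.sum fun a _ => (hsm h1 (h2 _) (h3 a)).smul (h3 a))
    have hRRs : ∀ᶠ z in 𝓝 y, ContDiffAt ℝ ∞ (fun z => B z (R z) (R z)) z := by
      filter_upwards [hG, hRs] with z h1 h2 using hsm h1 h2 h2
    have hpos : ∀ᶠ z in 𝓝 y, 0 < B z (R z) (R z) :=
      hRRs.self_of_nhds.continuousAt.eventually (lt_mem_nhds (by simp [hRR]))
    set q : Model m → Model m := fun z => (√(B z (R z) (R z)))⁻¹ • R z with hq
    have hRQ : ∀ᶠ z in 𝓝 y, ∀ a, B z (R z) (Q a z) = 0 := by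
      filter_upwards [hQo] with z hz a
      have hz' : ∀ a b, B z (Q a z) (Q b z) = if a = b then 1 else 0 := hz
      simp only [hR]
      rw [hBadd, hBsum]
      simp [hBsmul, hz']
    refine ⟨Fin.snoc Q q, ?_, ?_, ?_, ?_⟩
    · filter_upwards [hQ, hRs, hRRs, hpos] with z h1 h2 h3 h4 a
      refine Fin.lastCases ?_ (fun a => ?_) a
      · rw [Fin.snoc_last]
        exact ((h3.sqrt h4.ne').inv (Real.sqrt_pos.2 h4).ne').smul h2
      · rw [Fin.snoc_castSucc]; exact h1 a
    · filter_upwards [hL, hQL] with z h1 h2 a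
      refine Fin.lastCases ?_ (fun a => ?_) a
      · rw [Fin.snoc_last]; simp [hq, hR, h1, h2, hp]
      · rw [Fin.snoc_castSucc]; exact h2 a
    · filter_upwards [hQo, hRQ, hpos, hBsymm] with z h1 h2 h3 h4 a b
      change B z _ _ = _
      refine Fin.lastCases ?_ (fun a => ?_) a <;> refine Fin.lastCases ?_ (fun b => ?_) b
      · simp only [Fin.snoc_last, hq, if_true]
        rw [hBsmul, h4 (R z) ((√(B z (R z) (R z)))⁻¹ • R z), hBsmul]
        have := Real.mul_self_sqrt h3.le
        have hne := (Real.sqrt_pos.2 h3).ne'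
        field_simp
        rw [sq, this]
      · simp only [Fin.snoc_last, Fin.snoc_castSucc, hq, hBsmul, h2, mul_zero]
        simp [(Fin.castSucc_ne_last b).symm]
      · simp only [Fin.snoc_last, Fin.snoc_castSucc]
        rw [h4]
        simp only [hq, hBsmul, h2, mul_zero]
        simp [Fin.castSucc_ne_last]
      · simp only [Fin.snoc_castSucc]
        simpa using h1 a b
    · intro a
      refine Fin.lastCases ?_ (fun a => ?_) a
      · rw [Fin.snoc_last]
        change (√(B y (R y) (R y)))⁻¹ • R y = p y
        rw [hRR, hRy]
        simp
      · rw [Fin.snoc_castSucc]; exact hQP a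

/-- The kernel of a surjective linear map has an orthonormal basis with respect to `G`. -/
theorem exists_orthonormal_ker {G : Matrix (Fin m) (Fin m) ℝ} (hGs : Gᵀ = G)
    (hpos : ∀ v : Model m, v ≠ 0 → 0 < v.ofLp ⬝ᵥ (G *ᵥ v.ofLp)) (L : Model m →L[ℝ] Model n)
    (hL : Function.Surjective L) :
    ∃ w : Fin (m - n) → Model m, (∀ a, L (w a) = 0) ∧
      ∀ a b, (w a).ofLp ⬝ᵥ (G *ᵥ (w b).ofLp) = if a = b then 1 else 0 := by
  let Bf : LinearMap.BilinForm ℝ (Model m) :=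
    (Matrix.toBilin' G).compl₁₂ (WithLp.linearEquiv 2 ℝ (Fin m → ℝ)).toLinearMap
      (WithLp.linearEquiv 2 ℝ (Fin m → ℝ)).toLinearMap
  have hBf : ∀ v w : Model m, Bf v w = v.ofLp ⬝ᵥ (G *ᵥ w.ofLp) := fun v w => by
    simp [Bf, Matrix.toBilin'_apply']
  let k : Submodule ℝ (Model m) := LinearMap.ker L.toLinearMap
  have hdim : Module.finrank ℝ k = m - n := by
    have h1 := LinearMap.finrank_range_add_finrank_ker L.toLinearMap
    rw [LinearMap.range_eq_top.2 hL, finrank_top, finrank_euclideanSpace_fin,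
      finrank_euclideanSpace_fin] at h1
    change _ + Module.finrank ℝ k = m at h1
    omega
  have hsymm : (Bf.restrict k).IsSymm := by
    refine ⟨fun v w => ?_⟩
    simp only [LinearMap.BilinForm.restrict_apply, LinearMap.domRestrict_apply, hBf]
    rw [Matrix.dotProduct_mulVec, ← Matrix.mulVec_transpose, hGs, dotProduct_comm]
  obtain ⟨v, hv⟩ := LinearMap.BilinForm.exists_orthogonal_basis (V := k) (B := Bf.restrict k)
    (LinearMap.BilinForm.isSymm_iff.1 hsymm)
  have hvpos : ∀ a, 0 < Bf (v a : Model m) (v a : Model m) := fun a => by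
    rw [hBf]
    exact hpos _ fun h => v.ne_zero a (Subtype.ext h)
  let e : Fin (m - n) ≃ Fin (Module.finrank ℝ k) := finCongr hdim.symm
  refine ⟨fun a => (√(Bf (v (e a) : Model m) (v (e a) : Model m)))⁻¹ • (v (e a) : Model m),
    fun a => ?_, fun a b => ?_⟩
  · have : L (v (e a) : Model m) = 0 := (v (e a)).2
    simp [this]
  · rw [← hBf]
    simp only [map_smul, LinearMap.smul_apply, smul_eq_mul]
    by_cases hab : a = b
    · subst hab
      have := Real.mul_self_sqrt (hvpos (e a)).le
      have hne := (Real.sqrt_pos.2 (hvpos (e a))).ne'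
      simp only [if_true]
      field_simp
      rw [sq, this]
    · have : Bf (v (e a) : Model m) (v (e b) : Model m) = 0 :=
        hv (fun h => hab (e.injective h))
      simp [this, hab]

end GramSchmidt

/-! ### Charts, with tangent spaces identified with Euclidean space -/

section Charts

open Matrix

variable {m n : ℕ} {M : Type*} [TopologicalSpace M] [ChartedSpace (Model m) M]
  {N : Type*} [TopologicalSpace N] [ChartedSpace (Model n) N]

variable (m n) in
/-- The differential of a map, as a linear map between Euclidean spaces. -/
def dMap (u : M → N) (x : M) : Model m →L[ℝ] Model n := mfderiv (𝓡 m) (𝓡 n) u x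

/-- The differential of the preferred chart around `p`. -/
def dChart (p x : M) : Model m →L[ℝ] Model m :=
  mfderiv (𝓡 m) (𝓡 m) (extChartAt (𝓡 m) p) x

/-- The differential of the inverse of the preferred chart around `p`. -/
def dChartSymm (p : M) (y : Model m) : Model m →L[ℝ] Model m :=
  mfderiv (𝓡 m) (𝓡 m) (extChartAt (𝓡 m) p).symm y

variable (m n) in
/-- The map `u` in the preferred charts around `p` and `q`. -/
def chartRep (p : M) (q : N) (u : M → N) (y : Model m) : Model n :=
  extChartAt (𝓡 n) q (u ((extChartAt (𝓡 m) p).symm y))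

variable [IsManifold (𝓡 m) ∞ M]

/-- The metric as a bilinear form on Euclidean space. -/
def metricForm (g : Metric m M) (x : M) : Model m →L[ℝ] Model m →L[ℝ] ℝ := g.inner x

theorem isManifold_one : IsManifold (𝓡 m) 1 M := IsManifold.of_le (n := ∞) one_le_infty

theorem contMDiffAt_chart {p x : M} (hx : x ∈ (extChartAt (𝓡 m) p).source) :
    ContMDiffAt (𝓡 m) (𝓡 m) ∞ (extChartAt (𝓡 m) p) x :=
  contMDiffAt_extChartAt' (by rwa [extChartAt_source] at hx)

theorem contMDiffAt_chart_symm {p : M} {y : Model m} (hy : y ∈ (extChartAt (𝓡 m) p).target) :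
    ContMDiffAt (𝓡 m) (𝓡 m) ∞ (extChartAt (𝓡 m) p).symm y :=
  (contMDiffOn_extChartAt_symm p).contMDiffAt ((isOpen_extChartAt_target p).mem_nhds hy)

theorem dChart_dChartSymm {p : M} {y : Model m} (hy : y ∈ (extChartAt (𝓡 m) p).target)
    (v : Model m) : dChart p ((extChartAt (𝓡 m) p).symm y) (dChartSymm p y v) = v := by
  have := isManifold_one (m := m) (M := M)
  have h := mfderiv_extChartAt_comp_mfderivWithin_extChartAt_symm (I := 𝓡 m) hy
  rw [ModelWithCorners.range_eq_univ, mfderivWithin_univ] at h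
  exact DFunLike.congr_fun h v

theorem dChartSymm_dChart {p : M} {y : Model m} (hy : y ∈ (extChartAt (𝓡 m) p).target)
    (v : Model m) : dChartSymm p y (dChart p ((extChartAt (𝓡 m) p).symm y) v) = v := by
  have := isManifold_one (m := m) (M := M)
  have h := mfderivWithin_extChartAt_symm_comp_mfderiv_extChartAt (I := 𝓡 m) hy
  rw [ModelWithCorners.range_eq_univ, mfderivWithin_univ] at h
  exact DFunLike.congr_fun h v

theorem dChart_self (p : M) : dChart p p = ContinuousLinearMap.id ℝ (Model m) := by
  have := isManifold_one (m := m) (M := M)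
  exact mfderiv_extChartAt_self (I := 𝓡 m) (x := p)

/-- A vector field is smooth iff its coefficients in a chart are. -/
theorem contMDiffAt_section_iff_dChart {p x : M} (hx : x ∈ (extChartAt (𝓡 m) p).source)
    (W : (x : M) → TangentSpace (𝓡 m) x) :
    ContMDiffAt (𝓡 m) (𝓡 m).tangent ∞ (fun x => (⟨x, W x⟩ : TangentBundle (𝓡 m) M)) x ↔
      ContMDiffAt (𝓡 m) (𝓡 m) ∞ (fun x => dChart p x (W x)) x := by
  have := isManifold_one (m := m) (M := M)
  have hx' : x ∈ (chartAt (Model m) p).source := by rwa [extChartAt_source] at hx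
  have h := Bundle.Trivialization.contMDiffAt_section_iff (IB := 𝓡 m) (n := ∞) (s := W) (x₀ := x)
    (e := trivializationAt (Model m) (TangentSpace (𝓡 m)) p) (by simpa using hx')
  refine h.trans ?_
  refine Filter.EventuallyEq.contMDiffAt_iff ?_
  filter_upwards [(chartAt (Model m) p).open_source.mem_nhds hx'] with z hz
  have h2 := DFunLike.congr_fun
    (TangentBundle.continuousLinearMapAt_trivializationAt (I := 𝓡 m) (x₀ := p) hz) (W z)
  refine Eq.trans ?_ h2
  rw [Bundle.Trivialization.continuousLinearMapAt_apply, Bundle.Trivialization.linearMapAt_apply]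
  rw [if_pos (by simpa using hz)]

theorem metricForm_dChartSymm (g : Metric m M) (p : M) (y v w : Model m) :
    metricForm g ((extChartAt (𝓡 m) p).symm y) (dChartSymm p y v) (dChartSymm p y w)
      = v.ofLp ⬝ᵥ (chartGram g p y *ᵥ w.ofLp) := by
  rw [clm_apply_eq_sum (dChartSymm p y) v, clm_apply_eq_sum (dChartSymm p y) w]
  simp only [map_sum, map_smul, _root_.sum_apply, _root_.smul_apply, dotProduct, Matrix.mulVec,
    smul_eq_mul, Finset.mul_sum]
  rw [Finset.sum_comm]
  refine Finset.sum_congr rfl fun i _ => Finset.sum_congr rfl fun j _ => ?_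
  rw [show chartGram g p y i j = metricForm g ((extChartAt (𝓡 m) p).symm y)
    (dChartSymm p y (EuclideanSpace.single i 1)) (dChartSymm p y (EuclideanSpace.single j 1))
    from rfl]
  ring

theorem metricForm_symm (g : Metric m M) (x : M) (v w : Model m) :
    metricForm g x v w = metricForm g x w v := g.symm x v w

theorem metricForm_pos (g : Metric m M) (x : M) {v : Model m} (hv : v ≠ 0) :
    0 < metricForm g x v v := g.pos x v hv

theorem chartGram_transpose (g : Metric m M) (p : M) (y : Model m) :
    (chartGram g p y)ᵀ = chartGram g p y := by
  ext i j
  exact g.symm _ _ _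

theorem dotProduct_chartGram_pos (g : Metric m M) {p : M} {y : Model m}
    (hy : y ∈ (extChartAt (𝓡 m) p).target) {v : Model m} (hv : v ≠ 0) :
    0 < v.ofLp ⬝ᵥ (chartGram g p y *ᵥ v.ofLp) := by
  rw [← metricForm_dChartSymm]
  refine metricForm_pos g _ fun h => hv ?_
  rw [← dChart_dChartSymm hy v, h, map_zero]

theorem chartGram_posDef (g : Metric m M) {p : M} {y : Model m}
    (hy : y ∈ (extChartAt (𝓡 m) p).target) : (chartGram g p y).PosDef := by
  refine Matrix.PosDef.of_dotProduct_mulVec_pos ?_ fun v hv => ?_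
  · rw [Matrix.IsHermitian, Matrix.conjTranspose_eq_transpose_of_trivial, chartGram_transpose]
  · simpa using dotProduct_chartGram_pos g hy (v := WithLp.toLp 2 v)
      (fun h => hv (by simpa using congrArg WithLp.ofLp h))

theorem chartGram_det_pos (g : Metric m M) {p : M} {y : Model m}
    (hy : y ∈ (extChartAt (𝓡 m) p).target) : 0 < (chartGram g p y).det :=
  (chartGram_posDef g hy).det_pos

theorem contDiffAt_chartGram (g : Metric m M) {p : M} {y : Model m}
    (hy : y ∈ (extChartAt (𝓡 m) p).target) (i j : Fin m) :
    ContDiffAt ℝ ∞ (fun z => chartGram g p z i j) y := by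
  set x := (extChartAt (𝓡 m) p).symm y with hx
  have hxs : x ∈ (extChartAt (𝓡 m) p).source := (extChartAt (𝓡 m) p).map_target hy
  -- The coordinate vector fields are smooth sections, having constant coefficients in the chart;
  -- the Gram matrix is the smooth bundle metric evaluated on them.
  have hsec : ∀ i : Fin m, ContMDiffAt (𝓡 m) (𝓡 m).tangent ∞ (fun x => (⟨x,
      dChartSymm p (extChartAt (𝓡 m) p x) (EuclideanSpace.single i 1)⟩ :
        TangentBundle (𝓡 m) M)) x := by
    intro i
    rw [contMDiffAt_section_iff_dChart hxs
      (fun x => dChartSymm p (extChartAt (𝓡 m) p x) (EuclideanSpace.single i 1))]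
    refine (contMDiffAt_const (c := (EuclideanSpace.single i (1 : ℝ) : Model m))).congr_of_eventuallyEq ?_
    filter_upwards [(isOpen_extChartAt_source (I := 𝓡 m) p).mem_nhds hxs] with z hz
    have := dChart_dChartSymm ((extChartAt (𝓡 m) p).map_source hz) (EuclideanSpace.single i 1)
    rwa [(extChartAt (𝓡 m) p).left_inv hz] at this
  have h := ContMDiffAt.clm_bundle_apply₂ (E₃ := Bundle.Trivial M ℝ) (b := fun x : M => x)
    (g.contMDiff x) (hsec i) (hsec j)
  have h2 : ContMDiffAt (𝓡 m) 𝓘(ℝ, ℝ) ∞ (fun x => metricForm g x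
      (dChartSymm p (extChartAt (𝓡 m) p x) (EuclideanSpace.single i 1))
      (dChartSymm p (extChartAt (𝓡 m) p x) (EuclideanSpace.single j 1))) x := by
    simp only [Bundle.contMDiffAt_totalSpace] at h
    exact h.2
  have h3 := h2.comp y (contMDiffAt_chart_symm hy)
  refine ContMDiffAt.contDiffAt (h3.congr_of_eventuallyEq ?_)
  filter_upwards [(isOpen_extChartAt_target (I := 𝓡 m) p).mem_nhds hy] with z hz
  change metricForm g ((extChartAt (𝓡 m) p).symm z) (dChartSymm p z _) (dChartSymm p z _)
    = metricForm g ((extChartAt (𝓡 m) p).symm z)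
      (dChartSymm p (extChartAt (𝓡 m) p ((extChartAt (𝓡 m) p).symm z)) _)
      (dChartSymm p (extChartAt (𝓡 m) p ((extChartAt (𝓡 m) p).symm z)) _)
  rw [(extChartAt (𝓡 m) p).right_inv hz]

end Charts

/-! ### The energy density in arbitrary charts and its regularity -/

section EnergyInCharts

open Matrix

variable {m n k : ℕ}

/-- The matrix of a linear map between Euclidean spaces. -/
def clmMat (L : Model m →L[ℝ] Model n) : Matrix (Fin n) (Fin m) ℝ :=
  Matrix.of fun α i => L (EuclideanSpace.single i 1) α

theorem clmMat_mulVec (L : Model m →L[ℝ] Model n) (v : Model m) :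
    clmMat L *ᵥ v.ofLp = (L v).ofLp := by
  ext α
  rw [clm_apply_eq_sum L v]
  simp [Matrix.mulVec, dotProduct, clmMat, mul_comm]

theorem clmMat_comp (L : Model n →L[ℝ] Model k) (L' : Model m →L[ℝ] Model n) :
    clmMat (L.comp L') = clmMat L * clmMat L' := by
  ext α i
  exact (congrFun (clmMat_mulVec L (L' (EuclideanSpace.single i 1))) α).symm

theorem clmMat_id : clmMat (ContinuousLinearMap.id ℝ (Model m)) = 1 := by
  ext α i
  simp [clmMat, Matrix.one_apply]

/-- Invariance under changes of basis `T` in the source and `R` in the target, by cyclicity of the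
trace. It allows arbitrary charts although `energyDensity` is defined in the basis of the chart
preferred at each point. -/
theorem matrixEnergy_congr {G T : Matrix (Fin m) (Fin m) ℝ} {H R : Matrix (Fin n) (Fin n) ℝ}
    {A A' : Matrix (Fin n) (Fin m) ℝ} (hT : IsUnit T.det) (hA : R * A' = A * T) :
    matrixEnergy (Tᵀ * G * T) (Rᵀ * H * R) A' = matrixEnergy G H A := by
  have hT' : IsUnit (Tᵀ).det := by rwa [Matrix.det_transpose]
  have h1 : A'ᵀ * (Rᵀ * H * R) * A' = Tᵀ * (Aᵀ * H * A * T) := by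
    calc A'ᵀ * (Rᵀ * H * R) * A' = (R * A')ᵀ * H * (R * A') := by
          simp only [Matrix.transpose_mul, Matrix.mul_assoc]
      _ = _ := by rw [hA]; simp only [Matrix.transpose_mul, Matrix.mul_assoc]
  have h2 : (Tᵀ * G * T)⁻¹ * A'ᵀ * (Rᵀ * H * R) * A' = T⁻¹ * (G⁻¹ * (Aᵀ * H * A * T)) := by
    calc _ = (Tᵀ * G * T)⁻¹ * (A'ᵀ * (Rᵀ * H * R) * A') := by simp only [Matrix.mul_assoc]
      _ = _ := by
        rw [h1, Matrix.mul_inv_rev, Matrix.mul_inv_rev, Matrix.mul_assoc, Matrix.mul_assoc,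
          Matrix.nonsing_inv_mul_cancel_left _ _ hT']
  rw [matrixEnergy, h2, Matrix.trace_mul_comm, Matrix.mul_assoc, Matrix.mul_assoc,
    Matrix.mul_nonsing_inv _ hT, Matrix.mul_one, matrixEnergy]
  simp only [Matrix.mul_assoc]

variable {M : Type*} [TopologicalSpace M] [ChartedSpace (Model m) M]
  {N : Type*} [TopologicalSpace N] [ChartedSpace (Model n) N]

theorem contMDiff_slice {U : ℝ → M → N}
    (hU : ContMDiff (𝓘(ℝ, ℝ).prod (𝓡 m)) (𝓡 n) ∞ (fun q : ℝ × M => U q.1 q.2)) (t : ℝ) :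
    ContMDiff (𝓡 m) (𝓡 n) ∞ (U t) :=
  hU.comp (contMDiff_const.prodMk contMDiff_id)

theorem eventually_mem_charts {p : M} {q : N} {U : ℝ → M → N} {t : ℝ} {x : M}
    (hx : x ∈ (extChartAt (𝓡 m) p).source) (hq : U t x ∈ (extChartAt (𝓡 n) q).source)
    (hU : Continuous (fun q : ℝ × M => U q.1 q.2)) :
    ∀ᶠ z in 𝓝 (t, x), z.2 ∈ (extChartAt (𝓡 m) p).source ∧
      U z.1 z.2 ∈ (extChartAt (𝓡 n) q).source :=
  (continuous_snd.continuousAt.eventually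
    ((isOpen_extChartAt_source (I := 𝓡 m) p).mem_nhds hx)).and
    (hU.continuousAt.eventually ((isOpen_extChartAt_source (I := 𝓡 n) q).mem_nhds hq))

variable [IsManifold (𝓡 m) ∞ M]

theorem metricForm_eq_gramAt (g : Metric m M) (x : M) (v w : Model m) :
    metricForm g x v w = v.ofLp ⬝ᵥ (gramAt g x *ᵥ w.ofLp) := by
  conv_lhs => rw [← (EuclideanSpace.basisFun (Fin m) ℝ).sum_repr v,
    ← (EuclideanSpace.basisFun (Fin m) ℝ).sum_repr w]
  simp only [map_sum, map_smul, _root_.sum_apply, _root_.smul_apply, dotProduct, Matrix.mulVec,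
    smul_eq_mul, Finset.mul_sum]
  rw [Finset.sum_comm]
  refine Finset.sum_congr rfl fun i _ => Finset.sum_congr rfl fun j _ => ?_
  rw [EuclideanSpace.basisFun_repr, EuclideanSpace.basisFun_repr, EuclideanSpace.basisFun_apply,
    EuclideanSpace.basisFun_apply, show gramAt g x i j = metricForm g x
    (EuclideanSpace.single i 1) (EuclideanSpace.single j 1) from rfl]
  ring

/-- Change of basis between the coordinate frame of the chart around `p` and the standard basis of
the tangent space at the given point. -/
theorem chartGram_eq (g : Metric m M) (p : M) (y : Model m) :
    chartGram g p y = (clmMat (dChartSymm p y))ᵀ * gramAt g ((extChartAt (𝓡 m) p).symm y)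
      * clmMat (dChartSymm p y) := by
  ext i j
  rw [show chartGram g p y i j = metricForm g ((extChartAt (𝓡 m) p).symm y)
    (dChartSymm p y (EuclideanSpace.single i 1)) (dChartSymm p y (EuclideanSpace.single j 1))
    from rfl, metricForm_eq_gramAt, Matrix.mul_assoc, Matrix.mul_apply']
  rfl

theorem det_clmMat_dChartSymm {p : M} {y : Model m} (hy : y ∈ (extChartAt (𝓡 m) p).target) :
    IsUnit (clmMat (dChartSymm p y)).det := by
  have h : clmMat (dChart p ((extChartAt (𝓡 m) p).symm y)) * clmMat (dChartSymm p y) = 1 := by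
    rw [← clmMat_comp, ← clmMat_id]
    congr 1
    ext v : 1
    exact dChart_dChartSymm hy v
  exact IsUnit.of_mul_eq_one_right _ (by rw [← Matrix.det_mul, h, Matrix.det_one])

/-- The derivative of the coordinate expression of a map. -/
theorem hasFDerivAt_chartRep [IsManifold (𝓡 n) ∞ N] {p : M} {q : N} {u : M → N} {y : Model m}
    (hy : y ∈ (extChartAt (𝓡 m) p).target)
    (hq : u ((extChartAt (𝓡 m) p).symm y) ∈ (extChartAt (𝓡 n) q).source)
    (hu : MDifferentiableAt (𝓡 m) (𝓡 n) u ((extChartAt (𝓡 m) p).symm y)) :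
    HasFDerivAt (chartRep m n p q u) ((dChart q (u ((extChartAt (𝓡 m) p).symm y))).comp
      ((dMap m n u ((extChartAt (𝓡 m) p).symm y)).comp (dChartSymm p y))) y := by
  have h1 := ((contMDiffAt_chart_symm hy).mdifferentiableAt (by simp)).hasMFDerivAt
  have h2 := hu.hasMFDerivAt
  have h3 := ((contMDiffAt_chart hq).mdifferentiableAt (by simp)).hasMFDerivAt
  exact (HasMFDerivAt.comp y h3 (HasMFDerivAt.comp y h2 h1)).hasFDerivAt

theorem energyDensity_eq_gramAt [IsManifold (𝓡 n) ∞ N] (g : Metric m M) (h : Metric n N)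
    (u : M → N) (x : M) :
    energyDensity g h u x = matrixEnergy (gramAt g x) (gramAt h (u x)) (clmMat (dMap m n u x)) := by
  have h1 : ∀ i j, h.inner (u x) (mfderiv (𝓡 m) (𝓡 n) u x (stdVec x i))
      (mfderiv (𝓡 m) (𝓡 n) u x (stdVec x j))
      = ((clmMat (dMap m n u x))ᵀ * gramAt h (u x) * clmMat (dMap m n u x)) j i := by
    intro i j
    rw [h.symm]
    change metricForm h (u x) (dMap m n u x (EuclideanSpace.single j 1))
      (dMap m n u x (EuclideanSpace.single i 1)) = _
    rw [metricForm_eq_gramAt, Matrix.mul_assoc, Matrix.mul_apply']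
    rfl
  rw [energyDensity, matrixEnergy]
  simp only [h1]
  congr 1
  rw [show (gramAt g x)⁻¹ * (clmMat (dMap m n u x))ᵀ * gramAt h (u x) * clmMat (dMap m n u x)
    = (gramAt g x)⁻¹ * ((clmMat (dMap m n u x))ᵀ * gramAt h (u x) * clmMat (dMap m n u x)) by
    simp only [Matrix.mul_assoc]]
  generalize (clmMat (dMap m n u x))ᵀ * gramAt h (u x) * clmMat (dMap m n u x) = B
  simp only [Matrix.trace, Matrix.diag, Matrix.mul_apply]

/-- The energy density in charts. -/
theorem energyDensity_eq_matrixEnergy [IsManifold (𝓡 n) ∞ N] (g : Metric m M) (h : Metric n N)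
    {p : M} {q : N} {u : M → N} {y : Model m} (hy : y ∈ (extChartAt (𝓡 m) p).target)
    (hq : u ((extChartAt (𝓡 m) p).symm y) ∈ (extChartAt (𝓡 n) q).source)
    (hu : MDifferentiableAt (𝓡 m) (𝓡 n) u ((extChartAt (𝓡 m) p).symm y)) :
    energyDensity g h u ((extChartAt (𝓡 m) p).symm y)
      = matrixEnergy (chartGram g p y) (chartGram h q (chartRep m n p q u y))
          (jac (chartRep m n p q u) y) := by
  have hqt : chartRep m n p q u y ∈ (extChartAt (𝓡 n) q).target := (extChartAt (𝓡 n) q).map_source hq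
  have hqs : (extChartAt (𝓡 n) q).symm (chartRep m n p q u y) = u ((extChartAt (𝓡 m) p).symm y) :=
    (extChartAt (𝓡 n) q).left_inv hq
  rw [energyDensity_eq_gramAt, chartGram_eq g, chartGram_eq h, hqs]
  refine (matrixEnergy_congr (det_clmMat_dChartSymm hy) ?_).symm
  have hj : jac (chartRep m n p q u) y = clmMat (fderiv ℝ (chartRep m n p q u) y) := rfl
  rw [hj, (hasFDerivAt_chartRep hy hq hu).fderiv, ← clmMat_comp, ← clmMat_comp]
  congr 1
  ext v : 1
  have := dChartSymm_dChart hqt (dMap m n u ((extChartAt (𝓡 m) p).symm y) (dChartSymm p y v))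
  rw [hqs] at this
  exact this

variable (m n) in
/-- A variation in the preferred charts around `p` and `q`. -/
def chartVar (p : M) (q : N) (U : ℝ → M → N) (z : ℝ × Model m) : Model n :=
  chartRep m n p q (U z.1) z.2

theorem contDiffAt_chartVar [IsManifold (𝓡 n) ∞ N] {p : M} {q : N} {U : ℝ → M → N} {t : ℝ}
    {y : Model m} (hy : y ∈ (extChartAt (𝓡 m) p).target)
    (hq : U t ((extChartAt (𝓡 m) p).symm y) ∈ (extChartAt (𝓡 n) q).source)
    (hU : ContMDiff (𝓘(ℝ, ℝ).prod (𝓡 m)) (𝓡 n) ∞ (fun q : ℝ × M => U q.1 q.2)) :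
    ContDiffAt ℝ ∞ (chartVar m n p q U) (t, y) := by
  rw [← contMDiffAt_iff_contDiffAt]
  have h1 : ContMDiffAt 𝓘(ℝ, ℝ × Model m) (𝓘(ℝ, ℝ).prod (𝓡 m)) ∞
      (fun z : ℝ × Model m => (z.1, (extChartAt (𝓡 m) p).symm z.2)) (t, y) :=
    ContMDiffAt.prodMk contDiff_fst.contDiffAt.contMDiffAt
      (ContMDiffAt.comp (t, y) (contMDiffAt_chart_symm hy) contDiff_snd.contDiffAt.contMDiffAt)
  have h2 := ContMDiffAt.comp (t, y) (hU.contMDiffAt (x := (t, (extChartAt (𝓡 m) p).symm y))) h1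
  exact ContMDiffAt.comp (t, y) (contMDiffAt_chart hq) h2

theorem contDiffAt_chartRep [IsManifold (𝓡 n) ∞ N] {p : M} {q : N} {u : M → N}
    {y : Model m} (hy : y ∈ (extChartAt (𝓡 m) p).target)
    (hq : u ((extChartAt (𝓡 m) p).symm y) ∈ (extChartAt (𝓡 n) q).source)
    (hu : ContMDiff (𝓡 m) (𝓡 n) ∞ u) :
    ContDiffAt ℝ ∞ (chartRep m n p q u) y := by
  rw [← contMDiffAt_iff_contDiffAt]
  exact (contMDiffAt_chart hq).comp y (hu.contMDiffAt.comp y (contMDiffAt_chart_symm hy))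

/-- The energy density of a variation is a smooth function in charts. -/
theorem exists_contDiffAt_energyDensity [IsManifold (𝓡 n) ∞ N] (g : Metric m M) (h : Metric n N)
    {U : ℝ → M → N}
    (hU : ContMDiff (𝓘(ℝ, ℝ).prod (𝓡 m)) (𝓡 n) ∞ (fun q : ℝ × M => U q.1 q.2)) (t : ℝ) (x : M) :
    ∃ L : ℝ × Model m → ℝ, ContDiffAt ℝ 1 L (t, extChartAt (𝓡 m) x x) ∧
      ∀ᶠ z in 𝓝 (t, x), energyDensity g h (U z.1) z.2 = L (z.1, extChartAt (𝓡 m) x z.2) := by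
  set q := U t x with hq
  have hxs := mem_extChartAt_source (I := 𝓡 m) x
  have hqs := mem_extChartAt_source (I := 𝓡 n) q
  set y := extChartAt (𝓡 m) x x with hy
  have hyt : y ∈ (extChartAt (𝓡 m) x).target := (extChartAt (𝓡 m) x).map_source hxs
  have hyx : (extChartAt (𝓡 m) x).symm y = x := (extChartAt (𝓡 m) x).left_inv hxs
  have hV : ContDiffAt ℝ ∞ (chartVar m n x q U) (t, y) :=
    contDiffAt_chartVar hyt (by rw [hyx]; exact hqs) hU
  -- The spatial Jacobian is read off from the joint derivative in time and space, so that its joint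
  -- regularity is immediate.
  let A : ℝ × Model m → Matrix (Fin n) (Fin m) ℝ := fun z =>
    Matrix.of fun α i => fderiv ℝ (chartVar m n x q U) z (0, EuclideanSpace.single i 1) α
  have hA : ∀ α i, ContDiffAt ℝ 1 (fun z => A z α i) (t, y) := by
    intro α i
    have h1 : ContDiffAt ℝ 1 (fderiv ℝ (chartVar m n x q U)) (t, y) :=
      hV.fderiv_right (one_add_one_eq_two.trans_le two_le_infty)
    exact contDiffAt_euclidean.1 (h1.clm_apply contDiffAt_const) α
  have hG : ∀ i j, ContDiffAt ℝ 1 (fun z : ℝ × Model m => chartGram g x z.2 i j) (t, y) :=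
    fun i j => ContDiffAt.comp (t, y) (g := fun z => chartGram g x z i j)
      ((contDiffAt_chartGram g hyt i j).of_le one_le_infty) contDiffAt_snd
  have hH : ∀ α β, ContDiffAt ℝ 1 (fun z : ℝ × Model m => chartGram h q (chartVar m n x q U z) α β)
      (t, y) := by
    intro α β
    refine ContDiffAt.comp (t, y) (g := fun z => chartGram h q z α β)
      ((contDiffAt_chartGram h ?_ α β).of_le one_le_infty) (hV.of_le one_le_infty)
    exact (extChartAt (𝓡 n) q).map_source (by rw [hyx]; exact hqs)
  refine ⟨fun z => matrixEnergy (chartGram g x z.2) (chartGram h q (chartVar m n x q U z)) (A z),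
    ?_, ?_⟩
  · simp only [matrixEnergy, Matrix.trace, Matrix.diag]
    refine contDiffAt_const.mul (ContDiffAt.sum fun i _ => ?_)
    exact contDiffAt_matrix_mul (contDiffAt_matrix_mul (contDiffAt_matrix_mul
      (contDiffAt_inv hG (chartGram_det_pos g hyt).ne') fun i α => hA α i) hH) hA i i
  · filter_upwards [eventually_mem_charts hxs hqs hU.continuous] with z hz
    have hz1 : (extChartAt (𝓡 m) x).symm (extChartAt (𝓡 m) x z.2) = z.2 :=
      (extChartAt (𝓡 m) x).left_inv hz.1
    have hzt := (extChartAt (𝓡 m) x).map_source hz.1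
    have h1 := energyDensity_eq_matrixEnergy g h (p := x) (q := q) (u := U z.1) hzt
      (by rw [hz1]; exact hz.2) ((contMDiff_slice hU z.1).contMDiffAt.mdifferentiableAt (by simp))
    rw [hz1] at h1
    rw [h1]
    have h2 : jac (chartRep m n x q (U z.1)) (extChartAt (𝓡 m) x z.2)
        = A (z.1, extChartAt (𝓡 m) x z.2) := by
      ext α i
      exact jac_slice (w := chartVar m n x q U) ((contDiffAt_chartVar hzt (by rw [hz1]; exact hz.2)
        hU).differentiableAt (by simp)) α i
    rw [h2]
    rfl

/-- This and the next two results are what differentiation under the integral sign requires of the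
energy density. -/
theorem continuous_energyDensity_variation [IsManifold (𝓡 n) ∞ N] (g : Metric m M) (h : Metric n N)
    {U : ℝ → M → N}
    (hU : ContMDiff (𝓘(ℝ, ℝ).prod (𝓡 m)) (𝓡 n) ∞ (fun q : ℝ × M => U q.1 q.2)) :
    Continuous fun z : ℝ × M => energyDensity g h (U z.1) z.2 := by
  rw [continuous_iff_continuousAt]
  rintro ⟨t, x⟩
  obtain ⟨L, hL, hev⟩ := exists_contDiffAt_energyDensity g h hU t x
  refine ContinuousAt.congr ?_ (hev.mono fun z hz => hz.symm)
  have hc : ContinuousAt (fun z : ℝ × M => (z.1, extChartAt (𝓡 m) x z.2)) (t, x) :=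
    continuousAt_fst.prodMk (ContinuousAt.comp (f := Prod.snd) (continuousAt_extChartAt x)
      continuousAt_snd)
  exact ContinuousAt.comp (g := L) hL.continuousAt hc

theorem hasDerivAt_energyDensity_variation [IsManifold (𝓡 n) ∞ N] (g : Metric m M)
    (h : Metric n N) {U : ℝ → M → N}
    (hU : ContMDiff (𝓘(ℝ, ℝ).prod (𝓡 m)) (𝓡 n) ∞ (fun q : ℝ × M => U q.1 q.2)) (t : ℝ) (x : M) :
    HasDerivAt (fun s => energyDensity g h (U s) x)
      (deriv (fun s => energyDensity g h (U s) x) t) t := by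
  obtain ⟨L, hL, hev⟩ := exists_contDiffAt_energyDensity g h hU t x
  have h1 : ∀ᶠ s in 𝓝 t, energyDensity g h (U s) x = L (s, extChartAt (𝓡 m) x x) :=
    (Continuous.prodMk_left x).continuousAt.eventually hev
  have h2 : DifferentiableAt ℝ (fun s => L (s, extChartAt (𝓡 m) x x)) t :=
    DifferentiableAt.comp (g := L) t (hL.differentiableAt one_ne_zero)
      (differentiableAt_id.prodMk (differentiableAt_const _))
  exact (h2.congr_of_eventuallyEq h1).hasDerivAt

theorem continuous_deriv_energyDensity_variation [IsManifold (𝓡 n) ∞ N] (g : Metric m M)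
    (h : Metric n N) {U : ℝ → M → N}
    (hU : ContMDiff (𝓘(ℝ, ℝ).prod (𝓡 m)) (𝓡 n) ∞ (fun q : ℝ × M => U q.1 q.2)) :
    Continuous fun z : ℝ × M => deriv (fun s => energyDensity g h (U s) z.2) z.1 := by
  rw [continuous_iff_continuousAt]
  rintro ⟨t, x⟩
  obtain ⟨L, hL, hev⟩ := exists_contDiffAt_energyDensity g h hU t x
  have hc : ContinuousAt (fun z : ℝ × M => (z.1, extChartAt (𝓡 m) x z.2)) (t, x) :=
    continuousAt_fst.prodMk (ContinuousAt.comp (f := Prod.snd) (continuousAt_extChartAt x)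
      continuousAt_snd)
  have hd : ∀ᶠ z in 𝓝 (t, x), DifferentiableAt ℝ L (z.1, extChartAt (𝓡 m) x z.2) :=
    hc.eventually ((hL.eventually (by simp)).mono fun z hz => hz.differentiableAt one_ne_zero)
  have h1 : ∀ᶠ z in 𝓝 (t, x), deriv (fun s => energyDensity g h (U s) z.2) z.1
      = fderiv ℝ L (z.1, extChartAt (𝓡 m) x z.2) (1, 0) := by
    filter_upwards [hev.eventually_nhds, hd] with z hz hzd
    have h2 : ∀ᶠ s in 𝓝 z.1, energyDensity g h (U s) z.2 = L (s, extChartAt (𝓡 m) x z.2) :=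
      (Continuous.prodMk_left z.2).continuousAt.eventually hz
    rw [Filter.EventuallyEq.deriv_eq h2]
    exact (HasFDerivAt.comp_hasDerivAt (l := L) z.1 hzd.hasFDerivAt
      ((hasDerivAt_id z.1).prodMk (hasDerivAt_const z.1 _))).deriv
  refine ContinuousAt.congr ?_ (h1.mono fun z hz => hz.symm)
  have hc2 : ContinuousAt (fun z : ℝ × M => fderiv ℝ L (z.1, extChartAt (𝓡 m) x z.2)) (t, x) :=
    ContinuousAt.comp (g := fderiv ℝ L) (f := fun z : ℝ × M => (z.1, extChartAt (𝓡 m) x z.2))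
      (hL.continuousAt_fderiv one_ne_zero) hc
  exact hc2.clm_apply continuousAt_const

end EnergyInCharts

/-! ### The Riemannian volume measure in charts -/

section Volume

open Matrix
open scoped ENNReal

variable {m : ℕ} {M : Type*} [TopologicalSpace M] [ChartedSpace (Model m) M]

variable [MeasurableSpace M] [BorelSpace M] in
theorem aemeasurable_extChartAt_symm (p : M) {μ : Measure (Model m)}
    (hμ : μ ≪ (volume : Measure (Model m)).restrict (extChartAt (𝓡 m) p).target) :
    AEMeasurable (extChartAt (𝓡 m) p).symm μ :=
  ((continuousOn_extChartAt_symm p).aemeasurable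
    (isOpen_extChartAt_target p).measurableSet).mono_ac hμ

variable [IsManifold (𝓡 m) ∞ M]

/-- The volume density `√(det g_{ij})` in a chart. -/
def chartDensity (g : Metric m M) (p : M) (y : Model m) : ℝ := √((chartGram g p y).det)

theorem chartDensity_pos (g : Metric m M) {p : M} {y : Model m}
    (hy : y ∈ (extChartAt (𝓡 m) p).target) : 0 < chartDensity g p y :=
  Real.sqrt_pos.2 (chartGram_det_pos g hy)

theorem contDiffAt_chartDensity (g : Metric m M) {p : M} {y : Model m}
    (hy : y ∈ (extChartAt (𝓡 m) p).target) : ContDiffAt ℝ ∞ (chartDensity g p) y :=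
  (contDiffAt_det fun i j => contDiffAt_chartGram g hy i j).sqrt (chartGram_det_pos g hy).ne'

theorem continuousOn_chartDensity (g : Metric m M) (p : M) :
    ContinuousOn (chartDensity g p) (extChartAt (𝓡 m) p).target := fun _ hy =>
  (contDiffAt_chartDensity g hy).continuousAt.continuousWithinAt

theorem aemeasurable_chartDensity (g : Metric m M) (p : M) :
    AEMeasurable (fun y => ENNReal.ofReal (chartDensity g p y))
      ((volume : Measure (Model m)).restrict (extChartAt (𝓡 m) p).target) :=
  ((continuousOn_chartDensity g p).aemeasurable
    (isOpen_extChartAt_target p).measurableSet).ennreal_ofReal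

theorem det_clmMat (L : Model m →L[ℝ] Model m) : (clmMat L).det = L.det := by
  have : clmMat L = LinearMap.toMatrix (EuclideanSpace.basisFun (Fin m) ℝ).toBasis
      (EuclideanSpace.basisFun (Fin m) ℝ).toBasis L.toLinearMap := by
    ext i j
    simp [clmMat, LinearMap.toMatrix_apply]
  rw [this, LinearMap.det_toMatrix]

/-- The change of variables formula for the volume densities of two charts. -/
theorem chartDensity_eq_mul (g : Metric m M) {p q : M} {y : Model m}
    (hy : y ∈ (extChartAt (𝓡 m) p).target)
    (hq : (extChartAt (𝓡 m) p).symm y ∈ (extChartAt (𝓡 m) q).source) :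
    chartDensity g p y = |(fderiv ℝ (chartRep m m p q id) y).det|
      * chartDensity g q (chartRep m m p q id y) := by
  set x := (extChartAt (𝓡 m) p).symm y with hx
  have hqt : chartRep m m p q id y ∈ (extChartAt (𝓡 m) q).target :=
    (extChartAt (𝓡 m) q).map_source hq
  have hqs : (extChartAt (𝓡 m) q).symm (chartRep m m p q id y) = x :=
    (extChartAt (𝓡 m) q).left_inv hq
  have hd := hasFDerivAt_chartRep (u := (id : M → M)) hy hq mdifferentiableAt_id
  have hT : clmMat (dChartSymm q (chartRep m m p q id y))
      * clmMat (fderiv ℝ (chartRep m m p q id) y) = clmMat (dChartSymm p y) := by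
    rw [← clmMat_comp, hd.fderiv]
    congr 1
    ext v : 1
    have hid : dMap m m (id : M → M) x = ContinuousLinearMap.id ℝ (Model m) := mfderiv_id
    have := dChartSymm_dChart hqt (dChartSymm p y v)
    rw [hqs] at this
    change dChartSymm q _ (dChart q x (dMap m m (id : M → M) x (dChartSymm p y v))) = _
    rw [hid]
    exact this
  have hG : (chartGram g p y).det = (fderiv ℝ (chartRep m m p q id) y).det ^ 2
      * (chartGram g q (chartRep m m p q id y)).det := by
    rw [chartGram_eq g p, chartGram_eq g q, hqs, ← hT]
    simp only [Matrix.det_mul, Matrix.det_transpose, det_clmMat]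
    ring
  rw [chartDensity, hG, Real.sqrt_mul (sq_nonneg _), Real.sqrt_sq_eq_abs, chartDensity]

variable [MeasurableSpace M] [BorelSpace M]

theorem chartVolume_apply (g : Metric m M) (p : M) {s : Set M} (hs : MeasurableSet s) :
    chartVolume g p s = ∫⁻ y in (extChartAt (𝓡 m) p).symm ⁻¹' s ∩ (extChartAt (𝓡 m) p).target,
      ENNReal.ofReal (chartDensity g p y) := by
  rw [chartVolume, Measure.map_apply_of_aemeasurable
    (aemeasurable_extChartAt_symm p (withDensity_absolutelyContinuous _ _)) hs,
    withDensity_apply', Measure.restrict_restrict' (isOpen_extChartAt_target p).measurableSet]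
  rfl

theorem chartVolume_inter_source (g : Metric m M) (p : M) {s : Set M} (hs : MeasurableSet s) :
    chartVolume g p s = chartVolume g p (s ∩ (extChartAt (𝓡 m) p).source) := by
  rw [chartVolume_apply g p hs,
    chartVolume_apply g p (hs.inter (isOpen_extChartAt_source p).measurableSet)]
  congr 2
  ext y
  simp only [mem_inter_iff, mem_preimage]
  exact ⟨fun h => ⟨⟨h.1, (extChartAt (𝓡 m) p).map_target h.2⟩, h.2⟩, fun h => ⟨h.1.1, h.2⟩⟩

/-- Change of variables along the transition map, whose Jacobian determinant is the quotient of the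
two densities by `chartDensity_eq_mul`. -/
theorem chartVolume_eq_of_subset (g : Metric m M) {p q : M} {s : Set M} (hs : MeasurableSet s)
    (hp : s ⊆ (extChartAt (𝓡 m) p).source) (hq : s ⊆ (extChartAt (𝓡 m) q).source) :
    chartVolume g p s = chartVolume g q s := by
  have hmeas : MeasurableSet ((extChartAt (𝓡 m) p).symm ⁻¹' s ∩ (extChartAt (𝓡 m) p).target) := by
    rw [inter_comm]
    have h1 : Measurable ((extChartAt (𝓡 m) p).target.domRestrict (extChartAt (𝓡 m) p).symm) :=
      (continuousOn_iff_continuous_domRestrict.1 (continuousOn_extChartAt_symm p)).measurable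
    have h2 := (isOpen_extChartAt_target (I := 𝓡 m) p).measurableSet.subtype_image (h1 hs)
    convert! h2 using 1
    ext y
    refine ⟨fun h => ⟨⟨y, h.1⟩, h.2, rfl⟩, ?_⟩
    rintro ⟨⟨z, hz⟩, hzs, rfl⟩
    exact ⟨hz, hzs⟩
  set A := (extChartAt (𝓡 m) p).symm ⁻¹' s ∩ (extChartAt (𝓡 m) p).target with hA
  have hAq : ∀ y ∈ A, (extChartAt (𝓡 m) p).symm y ∈ (extChartAt (𝓡 m) q).source :=
    fun y hy => hq hy.1
  have himage : chartRep m m p q id '' A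
      = (extChartAt (𝓡 m) q).symm ⁻¹' s ∩ (extChartAt (𝓡 m) q).target := by
    ext z
    constructor
    · rintro ⟨y, hy, rfl⟩
      refine ⟨?_, (extChartAt (𝓡 m) q).map_source (hAq y hy)⟩
      change (extChartAt (𝓡 m) q).symm (extChartAt (𝓡 m) q ((extChartAt (𝓡 m) p).symm y)) ∈ s
      rw [(extChartAt (𝓡 m) q).left_inv (hAq y hy)]
      exact hy.1
    · rintro ⟨hz, hzt⟩
      refine ⟨extChartAt (𝓡 m) p ((extChartAt (𝓡 m) q).symm z), ⟨?_, ?_⟩, ?_⟩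
      · rw [mem_preimage, (extChartAt (𝓡 m) p).left_inv (hp hz)]
        exact hz
      · exact (extChartAt (𝓡 m) p).map_source (hp hz)
      · change extChartAt (𝓡 m) q ((extChartAt (𝓡 m) p).symm _) = z
        rw [(extChartAt (𝓡 m) p).left_inv (hp hz), (extChartAt (𝓡 m) q).right_inv hzt]
  have hinj : InjOn (chartRep m m p q id) A := by
    intro y hy z hz hyz
    have h1 : (extChartAt (𝓡 m) p).symm y = (extChartAt (𝓡 m) p).symm z :=
      (extChartAt (𝓡 m) q).injOn (hAq y hy) (hAq z hz) hyz
    exact (extChartAt (𝓡 m) p).symm.injOn hy.2 hz.2 h1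
  rw [chartVolume_apply g p hs, chartVolume_apply g q hs, ← himage,
    lintegral_image_eq_lintegral_abs_det_fderiv_mul volume hmeas
      (fun y hy => (hasFDerivAt_chartRep (u := (id : M → M)) hy.2 (hAq y hy)
        mdifferentiableAt_id).differentiableAt.hasFDerivAt.hasFDerivWithinAt) hinj]
  refine setLIntegral_congr_fun hmeas fun y hy => ?_
  rw [← ENNReal.ofReal_mul (abs_nonneg _), ← chartDensity_eq_mul g hy.2 (hAq y hy)]

variable [SecondCountableTopology M]

/-- On the domain of a chart, the Riemannian volume is the volume of that chart. -/
theorem riemVolume_apply (g : Metric m M) (p : M) {s : Set M} (hs : MeasurableSet s)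
    (hp : s ⊆ (extChartAt (𝓡 m) p).source) : riemVolume g s = chartVolume g p s := by
  obtain ⟨T, hTc, hT⟩ := TopologicalSpace.countable_cover_nhds
    (fun x : M => extChartAt_source_mem_nhds (I := 𝓡 m) x)
  have hTne : T.Nonempty := by
    rcases T.eq_empty_or_nonempty with h | h
    · have : p ∈ ⋃ x ∈ T, (extChartAt (𝓡 m) x).source := hT ▸ mem_univ p
      simp [h] at this
    · exact h
  obtain ⟨e, he⟩ := hTc.exists_eq_range hTne
  -- A countable family of chart domains, made disjoint, allows the chart volumes to be glued into a
  -- measure `ν` that agrees with every chart volume on the domain of its chart.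
  let B : ℕ → Set M := disjointed fun k => (extChartAt (𝓡 m) (e k)).source
  have hBm : ∀ k, MeasurableSet (B k) := fun k =>
    MeasurableSet.disjointed (fun k => (isOpen_extChartAt_source (e k)).measurableSet) k
  have hBd : Pairwise (Function.onFun Disjoint B) := disjoint_disjointed _
  have hBU : ⋃ k, B k = univ := by
    rw [iUnion_disjointed, ← hT, he, biUnion_range]
  have hBs : ∀ k, B k ⊆ (extChartAt (𝓡 m) (e k)).source := fun k => disjointed_subset _ _
  let ν : Measure M := Measure.sum fun k => (chartVolume g (e k)).restrict (B k)
  have hν : ∀ s, MeasurableSet s → ν s = ∑' k, chartVolume g (e k) (s ∩ B k) := fun s hs => by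
    rw [Measure.sum_apply _ hs]
    exact tsum_congr fun k => Measure.restrict_apply hs
  have hsplit : ∀ q s, MeasurableSet s → chartVolume g q s = ∑' k, chartVolume g q (s ∩ B k) := by
    intro q s hs
    rw [← measure_iUnion (fun i j hij => (hBd hij).mono inter_subset_right inter_subset_right)
      (fun k => hs.inter (hBm k)), ← inter_iUnion, hBU, inter_univ]
  have hloc : ∀ q s, MeasurableSet s → s ⊆ (extChartAt (𝓡 m) q).source →
      ν s = chartVolume g q s := by
    intro q s hs hq
    rw [hν s hs, hsplit q s hs]
    exact tsum_congr fun k => chartVolume_eq_of_subset g (hs.inter (hBm k))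
      (inter_subset_right.trans (hBs k)) (inter_subset_left.trans hq)
  -- A chart volume is carried by its own domain, where it equals `ν`. So `ν` dominates all of them,
  -- hence also their supremum.
  have hle : riemVolume g ≤ ν := by
    refine iSup_le fun q => Measure.le_iff.2 fun s hs => ?_
    rw [chartVolume_inter_source g q hs,
      ← hloc q _ (hs.inter (isOpen_extChartAt_source q).measurableSet) inter_subset_right]
    exact measure_mono inter_subset_left
  refine le_antisymm ((hle s).trans_eq (hloc p s hs hp)) ?_
  exact (le_iSup (fun q => chartVolume g q) p : chartVolume g p ≤ riemVolume g) s

/-- The density is continuous, hence bounded on a closed ball contained in the target of a chart. -/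
instance isLocallyFiniteMeasure_riemVolume (g : Metric m M) :
    IsLocallyFiniteMeasure (riemVolume g) := by
  refine ⟨fun x => ?_⟩
  set φ := extChartAt (𝓡 m) x with hφ
  have hxt : φ x ∈ φ.target := mem_extChartAt_target x
  obtain ⟨r, hr, hball⟩ := Metric.nhds_basis_closedBall.mem_iff.1
    ((isOpen_extChartAt_target (I := 𝓡 m) x).mem_nhds hxt)
  refine ⟨φ.source ∩ φ ⁻¹' Metric.ball (φ x) r, ?_, ?_⟩
  · exact inter_mem (extChartAt_source_mem_nhds x)
      ((continuousAt_extChartAt x).preimage_mem_nhds (Metric.ball_mem_nhds _ hr))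
  · have hopen : IsOpen (φ.source ∩ φ ⁻¹' Metric.ball (φ x) r) :=
      (continuousOn_extChartAt x).isOpen_inter_preimage (isOpen_extChartAt_source x)
        Metric.isOpen_ball
    rw [riemVolume_apply g x hopen.measurableSet inter_subset_left,
      chartVolume_apply g x hopen.measurableSet]
    have hK : IsCompact (Metric.closedBall (φ x) r) := isCompact_closedBall _ _
    obtain ⟨C, hC⟩ := hK.exists_bound_of_continuousOn ((continuousOn_chartDensity g x).mono hball)
    calc _ ≤ ∫⁻ y in Metric.closedBall (φ x) r, ENNReal.ofReal (chartDensity g x y) := by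
          refine lintegral_mono_set fun y hy => ?_
          have h1 : φ (φ.symm y) ∈ Metric.ball (φ x) r := hy.1.2
          rw [φ.right_inv hy.2] at h1
          exact Metric.ball_subset_closedBall h1
      _ ≤ ∫⁻ _ in Metric.closedBall (φ x) r, ENNReal.ofReal C :=
          setLIntegral_mono' hK.measurableSet fun y hy =>
            ENNReal.ofReal_le_ofReal ((le_abs_self _).trans (hC y hy))
      _ < ⊤ := by
          rw [setLIntegral_const]
          exact ENNReal.mul_lt_top ENNReal.ofReal_lt_top hK.measure_lt_top

/-- The chart density is strictly positive. This is what later upgrades almost everywhere equality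
of continuous functions to equality. -/
instance isOpenPosMeasure_riemVolume (g : Metric m M) : (riemVolume g).IsOpenPosMeasure := by
  refine ⟨fun O hO ⟨x, hx⟩ h0 => ?_⟩
  set φ := extChartAt (𝓡 m) x with hφ
  have hle : chartVolume g x O ≤ riemVolume g O :=
    (le_iSup (fun q => chartVolume g q) x : chartVolume g x ≤ riemVolume g) O
  rw [h0, nonpos_iff_eq_zero, chartVolume_apply g x hO.measurableSet] at hle
  have hopen : IsOpen (φ.symm ⁻¹' O ∩ φ.target) := by
    rw [inter_comm]
    exact (continuousOn_extChartAt_symm x).isOpen_inter_preimage (isOpen_extChartAt_target x) hO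
  have hne : (φ.symm ⁻¹' O ∩ φ.target).Nonempty := by
    refine ⟨φ x, ?_, mem_extChartAt_target x⟩
    rw [mem_preimage, extChartAt_to_inv]
    exact hx
  rw [lintegral_eq_zero_iff' ((aemeasurable_chartDensity g x).mono_measure
    (Measure.restrict_mono inter_subset_right le_rfl))] at hle
  rw [Filter.EventuallyEq, ae_restrict_iff' hopen.measurableSet] at hle
  have hzero : volume (φ.symm ⁻¹' O ∩ φ.target) = 0 := by
    refine measure_mono_null (fun y hy => ?_) hle
    simp only [mem_compl_iff, mem_ofPred_eq, not_forall]
    refine ⟨hy, ?_⟩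
    have := chartDensity_pos g hy.2
    simpa using this
  exact (hopen.measure_pos volume hne).ne' hzero

/-- Integration over a compact subset of the domain of a chart. -/
theorem setIntegral_riemVolume [T2Space M] (g : Metric m M) (p : M) {K : Set M} (hK : IsCompact K)
    (hp : K ⊆ (extChartAt (𝓡 m) p).source) {f : M → ℝ} (hf : ContinuousOn f K) :
    ∫ x in K, f x ∂(riemVolume g) = ∫ y in extChartAt (𝓡 m) p '' K,
      chartDensity g p y * f ((extChartAt (𝓡 m) p).symm y) := by
  set φ := extChartAt (𝓡 m) p with hφ
  have himg : φ '' K = φ.symm ⁻¹' K ∩ φ.target := by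
    rw [φ.image_eq_target_inter_inv_preimage hp, inter_comm]
  have hKc : IsCompact (φ '' K) := hK.image_of_continuousOn
    ((continuousOn_extChartAt p).mono hp)
  have hsub : φ '' K ⊆ φ.target := himg ▸ inter_subset_right
  have hmeq : (riemVolume g).restrict K = Measure.map φ.symm
      (((volume : Measure (Model m)).restrict (φ '' K)).withDensity
        fun y => ENNReal.ofReal (chartDensity g p y)) := by
    ext s hs
    have hac : ((volume : Measure (Model m)).restrict (φ '' K)).withDensity
        (fun y => ENNReal.ofReal (chartDensity g p y)) ≪
        (volume : Measure (Model m)).restrict φ.target :=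
      (withDensity_absolutelyContinuous _ _).trans
        (Measure.restrict_mono hsub le_rfl).absolutelyContinuous
    rw [Measure.restrict_apply hs, riemVolume_apply g p (hs.inter hK.measurableSet)
      (inter_subset_right.trans hp), chartVolume_apply g p (hs.inter hK.measurableSet),
      Measure.map_apply_of_aemeasurable (aemeasurable_extChartAt_symm p hac) hs,
      withDensity_apply', Measure.restrict_restrict' hKc.measurableSet, himg, preimage_inter,
      inter_assoc]
  have hfm : AEStronglyMeasurable f ((riemVolume g).restrict K) :=
    hf.aestronglyMeasurable_of_isCompact hK hK.measurableSet
  have hac : ((volume : Measure (Model m)).restrict (φ '' K)).withDensity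
      (fun y => ENNReal.ofReal (chartDensity g p y)) ≪
      (volume : Measure (Model m)).restrict φ.target :=
    (withDensity_absolutelyContinuous _ _).trans
      (Measure.restrict_mono hsub le_rfl).absolutelyContinuous
  rw [hmeq] at hfm ⊢
  rw [integral_map (aemeasurable_extChartAt_symm p hac) hfm,
    integral_withDensity_eq_integral_toReal_smul₀
      ((aemeasurable_chartDensity g p).mono_measure (Measure.restrict_mono hsub le_rfl))
      (Eventually.of_forall fun y => ENNReal.ofReal_lt_top)]
  refine setIntegral_congr_fun hKc.measurableSet fun y hy => ?_
  simp only [smul_eq_mul]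
  rw [ENNReal.toReal_ofReal (chartDensity_pos g (hsub hy)).le]

end Volume

/-! ### Conformality as a matrix identity; flux and tension -/

section Tension

open Matrix

variable {m n : ℕ} {M : Type*} [TopologicalSpace M] [ChartedSpace (Model m) M]
  {N : Type*} [TopologicalSpace N] [ChartedSpace (Model n) N]

variable (m n) in
/-- The points of the domain of the chart around `p` that `u` maps to the domain of the chart
around `q`. -/
def chartDomain (p : M) (q : N) (u : M → N) : Set M :=
  (extChartAt (𝓡 m) p).source ∩ u ⁻¹' (extChartAt (𝓡 n) q).source

variable (m n) in
/-- The coordinates of the points of `chartDomain`. -/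
def coordDomain (p : M) (q : N) (u : M → N) : Set (Model m) :=
  (extChartAt (𝓡 m) p).target ∩ (extChartAt (𝓡 m) p).symm ⁻¹' (u ⁻¹' (extChartAt (𝓡 n) q).source)

theorem isOpen_chartDomain {p : M} {q : N} {u : M → N} (hu : Continuous u) :
    IsOpen (chartDomain m n p q u) :=
  (isOpen_extChartAt_source p).inter ((isOpen_extChartAt_source q).preimage hu)

theorem isOpen_coordDomain {p : M} {q : N} {u : M → N} (hu : Continuous u) :
    IsOpen (coordDomain m n p q u) :=
  (continuousOn_extChartAt_symm p).isOpen_inter_preimage (isOpen_extChartAt_target p)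
    ((isOpen_extChartAt_source q).preimage hu)

theorem mem_coordDomain {p : M} {q : N} {u : M → N} {x : M} (hx : x ∈ chartDomain m n p q u) :
    extChartAt (𝓡 m) p x ∈ coordDomain m n p q u := by
  refine ⟨(extChartAt (𝓡 m) p).map_source hx.1, ?_⟩
  rw [mem_preimage, (extChartAt (𝓡 m) p).left_inv hx.1]
  exact hx.2

theorem chartRep_mem_target {p : M} {q : N} {u : M → N} {y : Model m}
    (hy : y ∈ coordDomain m n p q u) : chartRep m n p q u y ∈ (extChartAt (𝓡 n) q).target :=
  (extChartAt (𝓡 n) q).map_source hy.2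

variable [IsManifold (𝓡 m) ∞ M] [IsManifold (𝓡 n) ∞ N]

theorem surjective_fderiv_chartRep {p : M} {q : N} {u : M → N} (hu : ContMDiff (𝓡 m) (𝓡 n) ∞ u)
    (hs : ∀ x, Function.Surjective (mfderiv (𝓡 m) (𝓡 n) u x)) {y : Model m}
    (hy : y ∈ coordDomain m n p q u) :
    Function.Surjective (fderiv ℝ (chartRep m n p q u) y) := by
  set x := (extChartAt (𝓡 m) p).symm y with hx
  rw [(hasFDerivAt_chartRep hy.1 hy.2 (hu.contMDiffAt.mdifferentiableAt (by simp))).fderiv]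
  intro w
  obtain ⟨v, hv⟩ : ∃ v : Model m, dMap m n u x v = dChartSymm q (chartRep m n p q u y) w :=
    hs x (dChartSymm q (chartRep m n p q u y) w)
  refine ⟨dChart p x v, ?_⟩
  have hqs : (extChartAt (𝓡 n) q).symm (chartRep m n p q u y) = u x :=
    (extChartAt (𝓡 n) q).left_inv hy.2
  have h1 := dChart_dChartSymm (chartRep_mem_target hy) w
  rw [hqs] at h1
  change dChart q (u x) (dMap m n u x (dChartSymm p y (dChart p x v))) = w
  rw [dChartSymm_dChart hy.1, hv, h1]

/-- The Gram matrix of the gradients of the coordinate functions of a submersion is positive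
definite. -/
theorem posDef_mul_inv_mul_transpose {G : Matrix (Fin m) (Fin m) ℝ} (hG : G.PosDef)
    {L : Model m →L[ℝ] Model n} (hL : Function.Surjective L) :
    (clmMat L * G⁻¹ * (clmMat L)ᵀ).PosDef := by
  have h := hG.inv.mul_mul_conjTranspose_same (B := clmMat L) ?_
  · rwa [Matrix.conjTranspose_eq_transpose_of_trivial] at h
  · intro v w hvw
    -- Positive definiteness needs the transpose of the matrix of `L` to be injective; testing on
    -- preimages of the basis vectors, surjectivity of `L` gives this.
    have h1 : ∀ z : Model m, v ⬝ᵥ (L z).ofLp = w ⬝ᵥ (L z).ofLp := fun z => by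
      rw [← clmMat_mulVec, Matrix.dotProduct_mulVec, Matrix.dotProduct_mulVec]
      exact congrArg (· ⬝ᵥ z.ofLp) hvw
    ext i
    obtain ⟨z, hz⟩ := hL (EuclideanSpace.single i 1)
    simpa [hz] using h1 z

/-- Horizontal conformality in charts: `H A G⁻¹ Aᵀ = λ² I`. -/
theorem chartGram_mul_jac (g : Metric m M) (h : Metric n N) {p : M} {q : N} {u : M → N}
    (hu : ContMDiff (𝓡 m) (𝓡 n) ∞ u)
    (hs : ∀ x, Function.Surjective (mfderiv (𝓡 m) (𝓡 n) u x)) {lam : M → ℝ}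
    (hlam : ∀ x, ∀ X Y : TangentSpace (𝓡 m) x, IsHorizontal n g u x X → IsHorizontal n g u x Y →
      h.inner (u x) (mfderiv (𝓡 m) (𝓡 n) u x X) (mfderiv (𝓡 m) (𝓡 n) u x Y)
        = lam x ^ 2 * g.inner x X Y) {y : Model m} (hy : y ∈ coordDomain m n p q u) :
    chartGram h q (chartRep m n p q u y) * jac (chartRep m n p q u) y * (chartGram g p y)⁻¹
        * (jac (chartRep m n p q u) y)ᵀ
      = (lam ((extChartAt (𝓡 m) p).symm y) ^ 2) • (1 : Matrix (Fin n) (Fin n) ℝ) := by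
  set x := (extChartAt (𝓡 m) p).symm y with hx
  set G := chartGram g p y with hG
  set H := chartGram h q (chartRep m n p q u y) with hH
  set A := jac (chartRep m n p q u) y with hA
  have hGu : IsUnit G.det := isUnit_iff_ne_zero.2 (chartGram_det_pos g hy.1).ne'
  have hGs : (G⁻¹)ᵀ = G⁻¹ := by rw [Matrix.transpose_nonsing_inv, chartGram_transpose]
  have hKpos : (A * G⁻¹ * Aᵀ).PosDef := posDef_mul_inv_mul_transpose (chartGram_posDef g hy.1)
    (surjective_fderiv_chartRep hu hs hy)
  set K := A * G⁻¹ * Aᵀ with hK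
  have hKu : IsUnit K.det := isUnit_iff_ne_zero.2 hKpos.det_pos.ne'
  have hKs : Kᵀ = K := by
    rw [hK]; simp only [Matrix.transpose_mul, Matrix.transpose_transpose, hGs, Matrix.mul_assoc]
  have hqs : (extChartAt (𝓡 n) q).symm (chartRep m n p q u y) = u x :=
    (extChartAt (𝓡 n) q).left_inv hy.2
  have hfd := (hasFDerivAt_chartRep hy.1 hy.2 (hu.contMDiffAt.mdifferentiableAt (by simp))).fderiv
  have hdu : ∀ v : Model m, dMap m n u x (dChartSymm p y v)
      = dChartSymm q (chartRep m n p q u y) (fderiv ℝ (chartRep m n p q u) y v) := by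
    intro v
    rw [hfd]
    have := dChartSymm_dChart (chartRep_mem_target hy) (dMap m n u x (dChartSymm p y v))
    rw [hqs] at this
    exact this.symm
  -- the gradients of the coordinates of `u`
  let X : Fin n → Model m := fun α => WithLp.toLp 2 ((G⁻¹ * Aᵀ).col α)
  have hX : ∀ α, (X α).ofLp = (G⁻¹ * Aᵀ) *ᵥ Pi.single α 1 := fun α => by
    rw [Matrix.mulVec_single_one]
  have hGX : ∀ α (v : Model m), metricForm g x (dChartSymm p y (X α)) (dChartSymm p y v)
      = (fderiv ℝ (chartRep m n p q u) y v) α := by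
    intro α v
    rw [metricForm_symm, metricForm_dChartSymm, hX, Matrix.mulVec_mulVec, ← hG,
      Matrix.mul_nonsing_inv_cancel_left _ _ hGu, Matrix.dotProduct_mulVec,
      Matrix.vecMul_transpose, hA, jac_mulVec]
    simp
  have hhor : ∀ α, IsHorizontal n g u x (dChartSymm p y (X α)) := by
    intro α w hw
    have e : dChartSymm p y (dChart p x w) = w := dChartSymm_dChart hy.1 w
    have h1 := hGX α (dChart p x w)
    rw [e] at h1
    refine h1.trans ?_
    have h2 : dChartSymm q (chartRep m n p q u y)
        (fderiv ℝ (chartRep m n p q u) y (dChart p x w)) = 0 := by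
      rw [← hdu, e]
      exact hw
    have h3 := dChart_dChartSymm (chartRep_mem_target hy)
      (fderiv ℝ (chartRep m n p q u) y (dChart p x w))
    rw [h2, map_zero] at h3
    rw [← h3]; rfl
  have hAX : ∀ α, fderiv ℝ (chartRep m n p q u) y (X α) = WithLp.toLp 2 (K.col α) := by
    intro α
    have : (fderiv ℝ (chartRep m n p q u) y (X α)).ofLp = K.col α := by
      rw [← jac_mulVec, hX, Matrix.mulVec_mulVec, ← Matrix.mul_assoc, ← hA, ← hK,
        Matrix.mulVec_single_one]
    rw [← this]
  have hKc : ∀ α, K α = K.col α := fun α => by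
    funext β
    exact congrFun (congrFun hKs.symm α) β
  -- Conformality tested on the gradients of the coordinates of `u`, which are horizontal. Both
  -- `g`-products and images of these gradients are given by `K`, and cancelling the invertible `K`
  -- leaves `H K = λ² I`.
  have hKHK : K * H * K = (lam x ^ 2) • K := by
    ext α β
    have h1 : metricForm h (u x) (dMap m n u x (dChartSymm p y (X α)))
        (dMap m n u x (dChartSymm p y (X β)))
        = lam x ^ 2 * metricForm g x (dChartSymm p y (X α)) (dChartSymm p y (X β)) :=
      hlam x (dChartSymm p y (X α)) (dChartSymm p y (X β)) (hhor α) (hhor β)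
    rw [hGX, hdu, hdu, ← hqs, metricForm_dChartSymm, hAX, hAX] at h1
    have h2 : (K * H * K) α β = K.col α ⬝ᵥ (H *ᵥ K.col β) := by
      rw [Matrix.mul_assoc, Matrix.mul_apply', ← hKc]
      rfl
    rw [h2]
    refine h1.trans ?_
    rw [Matrix.smul_apply, smul_eq_mul]
    congr 1
  have h3 := congrArg (fun Z => K⁻¹ * Z) hKHK
  simp only [Matrix.mul_assoc, Matrix.nonsing_inv_mul_cancel_left _ _ hKu, Matrix.mul_smul,
    Matrix.nonsing_inv_mul _ hKu] at h3
  rw [← h3, hK]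
  simp only [Matrix.mul_assoc]

/-! ### The tension of a horizontally conformal map in charts -/

/-- The vector fields `ρ J⁻¹ ∑ₐ h_{βα} grad uᵅ` in charts, where `ρ` and `J` are the densities of
the two metrics. -/
def chartFlux (g : Metric m M) (h : Metric n N) (p : M) (q : N) (u : M → N) (β : Fin n)
    (j : Fin m) (y : Model m) : ℝ :=
  chartDensity g p y / chartDensity h q (chartRep m n p q u y) *
    (chartGram h q (chartRep m n p q u y) * jac (chartRep m n p q u) y * (chartGram g p y)⁻¹) β j

/-- The divergence of `chartFlux`, in coordinates. -/
def chartTension (g : Metric m M) (h : Metric n N) (p : M) (q : N) (u : M → N) (β : Fin n)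
    (y : Model m) : ℝ :=
  (chartDensity g p y)⁻¹ *
    ∑ j, fderiv ℝ (chartFlux g h p q u β j) y (EuclideanSpace.single j 1)

theorem contDiffAt_chartDensity_chartRep (h : Metric n N) {p : M} {q : N} {u : M → N}
    (hu : ContMDiff (𝓡 m) (𝓡 n) ∞ u) {y : Model m} (hy : y ∈ coordDomain m n p q u) :
    ContDiffAt ℝ ∞ (fun z => chartDensity h q (chartRep m n p q u z)) y :=
  ContDiffAt.comp (g := chartDensity h q) y (contDiffAt_chartDensity h (chartRep_mem_target hy))
    (contDiffAt_chartRep hy.1 hy.2 hu)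

theorem contDiffAt_chartFlux (g : Metric m M) (h : Metric n N) {p : M} {q : N} {u : M → N}
    (hu : ContMDiff (𝓡 m) (𝓡 n) ∞ u) (β : Fin n) (j : Fin m) {y : Model m}
    (hy : y ∈ coordDomain m n p q u) : ContDiffAt ℝ ∞ (chartFlux g h p q u β j) y := by
  have h1 := contDiffAt_chartRep hy.1 hy.2 hu
  refine ((contDiffAt_chartDensity g hy.1).div (contDiffAt_chartDensity_chartRep h hu hy)
    (chartDensity_pos h (chartRep_mem_target hy)).ne').mul ?_
  refine contDiffAt_matrix_mul (contDiffAt_matrix_mul (fun α α' => ?_) (contDiffAt_jac h1))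
    (contDiffAt_inv (fun i j => contDiffAt_chartGram g hy.1 i j) (chartGram_det_pos g hy.1).ne') β j
  exact ContDiffAt.comp (g := fun z => chartGram h q z α α') y
    (contDiffAt_chartGram h (chartRep_mem_target hy) α α') h1

theorem continuousOn_chartTension (g : Metric m M) (h : Metric n N) {p : M} {q : N} {u : M → N}
    (hu : ContMDiff (𝓡 m) (𝓡 n) ∞ u) (β : Fin n) :
    ContinuousOn (chartTension g h p q u β) (coordDomain m n p q u) := by
  intro y hy
  refine ContinuousAt.continuousWithinAt (ContinuousAt.mul ?_ ?_)
  · exact (contDiffAt_chartDensity g hy.1).continuousAt.inv₀ (chartDensity_pos g hy.1).ne'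
  · exact tendsto_finsetSum _ fun j _ => ((contDiffAt_chartFlux g h hu β
      j hy).continuousAt_fderiv (by simp)).clm_apply continuousAt_const

variable (n) in
/-- The variation field of a variation, in the chart around `q`. -/
def varField (q : N) (U : ℝ → M → N) (x : M) : Model n :=
  deriv (fun t => (extChartAt (𝓡 n) q (U t x) : Model n)) 0

end Tension

/-! ### Variation fields in charts -/

section FirstVariation

open Matrix

variable {m n : ℕ} {M : Type*} {N : Type*} [TopologicalSpace N] [ChartedSpace (Model n) N]

theorem varField_eq_zero {q : N} {U : ℝ → M → N} {x : M} (hx : ∀ t, U t x = U 0 x) :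
    varField n q U x = 0 := by
  unfold varField
  simp_rw [hx]
  exact deriv_const _ _

variable [TopologicalSpace M] [ChartedSpace (Model m) M]
  [IsManifold (𝓡 m) ∞ M] [IsManifold (𝓡 n) ∞ N]

/-- Identifies the variation field, defined pointwise on `M`, with the partial time derivative that
appears in the coordinate first variation formula. -/
theorem varField_symm {p : M} {q : N} {U : ℝ → M → N}
    (hU : ContMDiff (𝓘(ℝ, ℝ).prod (𝓡 m)) (𝓡 n) ∞ (fun z : ℝ × M => U z.1 z.2)) {y : Model m}
    (hy : y ∈ coordDomain m n p q (U 0)) :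
    varField n q U ((extChartAt (𝓡 m) p).symm y)
      = fderiv ℝ (chartVar m n p q U) ((0 : ℝ), y) (1, 0) := by
  have h1 := (contDiffAt_chartVar (t := 0) hy.1 hy.2 hU).differentiableAt (by simp)
  exact (HasFDerivAt.comp_hasDerivAt (l := chartVar m n p q U) (0 : ℝ) h1.hasFDerivAt
      ((hasDerivAt_id (0 : ℝ)).prodMk (hasDerivAt_const (0 : ℝ) y))).deriv

theorem contDiffAt_varField {p : M} {q : N} {U : ℝ → M → N}
    (hU : ContMDiff (𝓘(ℝ, ℝ).prod (𝓡 m)) (𝓡 n) ∞ (fun z : ℝ × M => U z.1 z.2)) {y : Model m}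
    (hy : y ∈ coordDomain m n p q (U 0)) :
    ContDiffAt ℝ ∞ (fun z => varField n q U ((extChartAt (𝓡 m) p).symm z)) y := by
  have hV := contDiffAt_chartVar (t := 0) hy.1 hy.2 hU
  have h1 : ContDiffAt ℝ ∞ (fderiv ℝ (chartVar m n p q U)) ((0 : ℝ), y) :=
    hV.fderiv_right (by simp)
  have h2 : ContDiffAt ℝ ∞ (fun z : Model m => fderiv ℝ (chartVar m n p q U) ((0 : ℝ), z)) y :=
    ContDiffAt.comp (g := fderiv ℝ (chartVar m n p q U)) y h1
      (contDiffAt_const.prodMk contDiffAt_id)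
  refine (h2.clm_apply (contDiffAt_const (c := ((1 : ℝ), (0 : Model m))))).congr_of_eventuallyEq ?_
  filter_upwards [(isOpen_coordDomain (contMDiff_slice hU 0).continuous).mem_nhds hy] with z hz
  exact varField_symm hU hz

end FirstVariation

/-! ### First variation formula for conformal maps to a surface -/

section FirstVariationSurface

open Matrix

variable {m : ℕ} {M : Type*} [TopologicalSpace M] [ChartedSpace (Model m) M]
  {N : Type*} [TopologicalSpace N] [ChartedSpace (Model 2) N]
  [IsManifold (𝓡 m) ∞ M] [IsManifold (𝓡 2) ∞ N]

/-- The first variation of the energy density of a horizontally conformal map to a surface. -/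
theorem deriv_energyDensity_mul_chartDensity (g : Metric m M) (h : Metric 2 N) {p : M} {q : N}
    {U : ℝ → M → N}
    (hU : ContMDiff (𝓘(ℝ, ℝ).prod (𝓡 m)) (𝓡 2) ∞ (fun z : ℝ × M => U z.1 z.2))
    (hu : IsHorizontallyConformal g h (U 0)) {y : Model m}
    (hy : y ∈ coordDomain m 2 p q (U 0)) :
    chartDensity g p y
        * deriv (fun t => energyDensity g h (U t) ((extChartAt (𝓡 m) p).symm y)) 0
      = ∑ β, ∑ j, chartFlux g h p q (U 0) β j y *
        fderiv ℝ (fun z => chartDensity h q (chartRep m 2 p q (U 0) z)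
          * varField 2 q U ((extChartAt (𝓡 m) p).symm z) β) y (EuclideanSpace.single j 1) := by
  obtain ⟨hsm, hs, lam, -, -, hlam⟩ := hu
  set x := (extChartAt (𝓡 m) p).symm y with hx
  have hc : Continuous fun t => U t x :=
    hU.continuous.comp (continuous_id.prodMk continuous_const)
  have h1 : ∀ᶠ t in 𝓝 (0 : ℝ), energyDensity g h (U t) x
      = matrixEnergy (chartGram g p y) (chartGram h q (chartVar m 2 p q U (t, y)))
        (jac (fun z => chartVar m 2 p q U (t, z)) y) := by
    filter_upwards [hc.continuousAt.eventually ((isOpen_extChartAt_source q).mem_nhds hy.2)]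
      with t ht
    exact energyDensity_eq_matrixEnergy g h hy.1 ht
      ((contMDiff_slice hU t).contMDiffAt.mdifferentiableAt (by simp))
  have hq := chartRep_mem_target hy
  have h2 := hasDerivAt_matrixEnergy (G := chartGram g p y) (H := chartGram h q)
    (contDiffAt_chartVar (t := 0) hy.1 hy.2 hU) (chartGram_transpose g p y)
    (fun α β => contDiffAt_chartGram h hq α β) (chartGram_transpose h q _)
    (chartGram_det_pos h hq) (chartGram_mul_jac g h hsm hs hlam hy)
  rw [Filter.EventuallyEq.deriv_eq h1, h2.deriv, Finset.mul_sum]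
  refine Finset.sum_congr rfl fun β _ => ?_
  rw [Finset.mul_sum]
  refine Finset.sum_congr rfl fun j _ => ?_
  have h3 : (fun z => √((chartGram h q (chartVar m 2 p q U (0, z))).det)
      * (fderiv ℝ (chartVar m 2 p q U) (0, z) (1, 0)) β) =ᶠ[𝓝 y]
      fun z => chartDensity h q (chartRep m 2 p q (U 0) z)
          * varField 2 q U ((extChartAt (𝓡 m) p).symm z) β := by
    filter_upwards [(isOpen_coordDomain hsm.continuous).mem_nhds hy] with z hz
    rw [varField_symm hU hz]
    rfl
  rw [h3.fderiv_eq, ← mul_assoc]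
  congr 1
  unfold chartFlux chartDensity
  rw [mul_div_assoc', div_mul_eq_mul_div]
  rfl

variable [T2Space M] [SecondCountableTopology M] [MeasurableSpace M] [BorelSpace M]

/-- The first variation formula for variations supported in the domain of a chart. -/
theorem setIntegral_deriv_energyDensity (g : Metric m M) (h : Metric 2 N) {p : M} {q : N}
    {U : ℝ → M → N}
    (hU : ContMDiff (𝓘(ℝ, ℝ).prod (𝓡 m)) (𝓡 2) ∞ (fun z : ℝ × M => U z.1 z.2))
    (hu : IsHorizontallyConformal g h (U 0)) {K : Set M} (hK : IsCompact K)
    (hKp : K ⊆ chartDomain m 2 p q (U 0)) (hUK : ∀ t, ∀ x ∉ K, U t x = U 0 x) :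
    ∫ x in K, deriv (fun t => energyDensity g h (U t) x) 0 ∂(riemVolume g)
      = -∫ x in K, ∑ β, chartDensity h q (extChartAt (𝓡 2) q (U 0 x)) * varField 2 q U x β
        * chartTension g h p q (U 0) β (extChartAt (𝓡 m) p x) ∂(riemVolume g) := by
  have hsm := hu.1
  set O := coordDomain m 2 p q (U 0) with hO
  have hOo : IsOpen O := isOpen_coordDomain hsm.continuous
  set k := extChartAt (𝓡 m) p '' K with hk
  have hKs : K ⊆ (extChartAt (𝓡 m) p).source := fun x hx => (hKp hx).1
  have hkc : IsCompact k := hK.image_of_continuousOn ((continuousOn_extChartAt p).mono hKs)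
  have hkO : k ⊆ O := by
    rintro _ ⟨x, hx, rfl⟩
    exact mem_coordDomain (hKp hx)
  -- The test functions `J V^β`. They vanish off `k`, as the variation is stationary outside `K`, so
  -- the divergence theorem produces no boundary term.
  let f : Fin 2 → Model m → ℝ := fun β z => chartDensity h q (chartRep m 2 p q (U 0) z)
          * varField 2 q U ((extChartAt (𝓡 m) p).symm z) β
  have hf : ∀ β, ∀ y ∈ O, ContDiffAt ℝ 1 (f β) y := fun β y hy =>
    ((contDiffAt_chartDensity_chartRep h hsm hy).mul
      (contDiffAt_euclidean.1 (contDiffAt_varField hU hy) β)).of_le one_le_infty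
  have hf0 : ∀ β, ∀ y ∈ O, y ∉ k → f β y = 0 := by
    intro β y hy hyk
    have : (extChartAt (𝓡 m) p).symm y ∉ K := fun hx =>
      hyk ⟨_, hx, (extChartAt (𝓡 m) p).right_inv hy.1⟩
    simp only [f, varField_eq_zero (n := 2) (q := q) (fun t => hUK t _ this)]
    simp
  have hS : ∀ β j, ∀ y ∈ O, ContDiffAt ℝ 1 (chartFlux g h p q (U 0) β j) y := fun β j y hy =>
    (contDiffAt_chartFlux g h hsm β j hy).of_le one_le_infty
  have hcf : ∀ β, ContinuousOn (f β) k := fun β y hy =>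
    (hf β y (hkO hy)).continuousAt.continuousWithinAt
  have hinv : ∀ x ∈ K, (extChartAt (𝓡 m) p).symm (extChartAt (𝓡 m) p x) = x := fun x hx =>
    (extChartAt (𝓡 m) p).left_inv (hKs hx)
  rw [setIntegral_riemVolume g p hK hKs, setIntegral_riemVolume g p hK hKs]
  rotate_left
  · have h1 : ContinuousOn (fun y => ∑ β, f β y * chartTension g h p q (U 0) β y) k :=
      continuousOn_finsetSum _ fun β _ => (hcf β).mul
        ((continuousOn_chartTension g h hsm β).mono hkO)
    refine (h1.comp ((continuousOn_extChartAt p).mono hKs) (mapsTo_image _ _)).congr ?_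
    intro x hx
    simp only [f, Function.comp_apply, chartRep, hinv x hx]
  · exact ((continuous_deriv_energyDensity_variation g h hU).comp
      (Continuous.prodMk_right (0 : ℝ))).continuousOn
  · have e1 : ∫ y in k, chartDensity g p y
        * deriv (fun t => energyDensity g h (U t) ((extChartAt (𝓡 m) p).symm y)) 0
        = ∫ y in k, ∑ β, ∑ j, chartFlux g h p q (U 0) β j y *
          fderiv ℝ (f β) y (EuclideanSpace.single j 1) :=
      setIntegral_congr_fun hkc.measurableSet fun y hy =>
        deriv_energyDensity_mul_chartDensity g h hU hu (hkO hy)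
    have e2 : ∫ y in k, chartDensity g p y * ∑ β, chartDensity h q (extChartAt (𝓡 2) q (U 0
          ((extChartAt (𝓡 m) p).symm y))) * varField 2 q U ((extChartAt (𝓡 m) p).symm y) β
        * chartTension g h p q (U 0) β (extChartAt (𝓡 m) p ((extChartAt (𝓡 m) p).symm y))
        = ∫ y in k, ∑ β, f β y * ∑ j, fderiv ℝ (chartFlux g h p q (U 0) β j) y
          (EuclideanSpace.single j 1) := by
      refine setIntegral_congr_fun hkc.measurableSet fun y hy => ?_
      have hρ := (chartDensity_pos g (hkO hy).1).ne'
      simp only [(extChartAt (𝓡 m) p).right_inv (hkO hy).1, Finset.mul_sum]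
      refine Finset.sum_congr rfl fun β _ => ?_
      simp only [f, chartTension, chartRep, Finset.mul_sum]
      refine Finset.sum_congr rfl fun j _ => ?_
      field_simp
    rw [e1, e2, integral_finsetSum, integral_finsetSum, ← Finset.sum_neg_distrib]
    · exact Finset.sum_congr rfl fun β _ =>
        setIntegral_sum_mul_fderiv hOo hkc hkO (hf β) (hf0 β) (hS β)
    · intro β _
      refine ContinuousOn.integrableOn_compact hkc (ContinuousOn.mul (hcf β) ?_)
      exact continuousOn_finsetSum _ fun j _ y hy => ((hS β j y
        (hkO hy)).continuousAt_fderiv one_ne_zero |>.clm_apply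
          continuousAt_const).continuousWithinAt
    · intro β _
      refine ContinuousOn.integrableOn_compact hkc ?_
      exact continuousOn_finsetSum _ fun j _ y hy => ((hS β j y
        (hkO hy)).continuousAt.mul ((hf β y (hkO hy)).continuousAt_fderiv one_ne_zero |>.clm_apply
          continuousAt_const)).continuousWithinAt

end FirstVariationSurface

/-! ### Localizing variations by cut-off functions -/

section Localization

variable {m : ℕ} {M N : Type*}

/-- The variation `U` slowed down by the factor `f`. -/
def scaledVariation (f : M → ℝ) (U : ℝ → M → N) (t : ℝ) (x : M) : N := U (f x * t) x

theorem scaledVariation_zero (f : M → ℝ) (U : ℝ → M → N) : scaledVariation f U 0 = U 0 := by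
  funext x; simp [scaledVariation]

variable [TopologicalSpace N] [ChartedSpace (Model 2) N]

/-- Reparametrising time at each point multiplies the variation field by `f`. Thus fields along `u`
are cut off without any linear structure on the target. -/
theorem varField_scaledVariation (q : N) (f : M → ℝ) (U : ℝ → M → N) (x : M) :
    varField 2 q (scaledVariation f U) x = f x • varField 2 q U x := by
  have := deriv_comp_mul_left (f x) (fun t => (extChartAt (𝓡 2) q (U t x) : Model 2)) 0
  rw [mul_zero] at this
  exact this

variable [TopologicalSpace M] [ChartedSpace (Model m) M]

theorem contMDiff_scaledVariation {f : M → ℝ} (hf : ContMDiff (𝓡 m) 𝓘(ℝ, ℝ) ∞ f) {U : ℝ → M → N}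
    (hU : ContMDiff (𝓘(ℝ, ℝ).prod (𝓡 m)) (𝓡 2) ∞ (fun z : ℝ × M => U z.1 z.2)) :
    ContMDiff (𝓘(ℝ, ℝ).prod (𝓡 m)) (𝓡 2) ∞
      (fun z : ℝ × M => scaledVariation f U z.1 z.2) :=
  hU.comp (((hf.comp contMDiff_snd).mul contMDiff_fst).prodMk contMDiff_snd)

variable [IsManifold (𝓡 m) ∞ M] [IsManifold (𝓡 2) ∞ N]

/-- The first variation of the energy density is additive with respect to partitions of unity. -/
theorem sum_deriv_energyDensity_scaledVariation (g : Metric m M) (h : Metric 2 N)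
    {U : ℝ → M → N}
    (hU : ContMDiff (𝓘(ℝ, ℝ).prod (𝓡 m)) (𝓡 2) ∞ (fun z : ℝ × M => U z.1 z.2))
    (hu : IsHorizontallyConformal g h (U 0)) {ι : Type*} (s : Finset ι) {f : ι → M → ℝ}
    (hf : ∀ i, ContMDiff (𝓡 m) 𝓘(ℝ, ℝ) ∞ (f i)) {x : M}
    (hsum : ∀ᶠ z in 𝓝 x, ∑ i ∈ s, f i z = 1) :
    ∑ i ∈ s, deriv (fun t => energyDensity g h (scaledVariation (f i) U t) x) 0
      = deriv (fun t => energyDensity g h (U t) x) 0 := by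
  have hxD : x ∈ chartDomain m 2 x (U 0 x) (U 0) :=
    ⟨mem_extChartAt_source x, mem_extChartAt_source (U 0 x)⟩
  set y := extChartAt (𝓡 m) x x with hy
  have hyD : y ∈ coordDomain m 2 x (U 0 x) (U 0) := mem_coordDomain hxD
  have hxy : (extChartAt (𝓡 m) x).symm y = x := extChartAt_to_inv x
  -- For a horizontally conformal map the first variation of the density depends on the variation
  -- only through its field, linearly and to first order; the fields of the scaled variations add up
  -- to that of `U`.
  have key := deriv_energyDensity_mul_chartDensity g h hU hu hyD
  have hkey := fun i => deriv_energyDensity_mul_chartDensity g h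
    (U := scaledVariation (f i) U) (p := x) (q := U 0 x) (y := y)
    (contMDiff_scaledVariation (hf i) hU) (by rwa [scaledVariation_zero])
    (by rwa [scaledVariation_zero])
  rw [hxy] at key
  simp only [scaledVariation_zero, hxy, varField_scaledVariation] at hkey
  refine mul_left_cancel₀ (chartDensity_pos g hyD.1).ne' ?_
  rw [key, Finset.mul_sum, Finset.sum_congr rfl fun i _ => hkey i, Finset.sum_comm]
  refine Finset.sum_congr rfl fun β _ => ?_
  rw [Finset.sum_comm]
  refine Finset.sum_congr rfl fun j _ => ?_
  rw [← Finset.mul_sum]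
  congr 1
  have hd : ∀ i ∈ s, DifferentiableAt ℝ (fun z => chartDensity h (U 0 x)
      (chartRep m 2 x (U 0 x) (U 0) z) * (f i ((extChartAt (𝓡 m) x).symm z)
        • varField 2 (U 0 x) U ((extChartAt (𝓡 m) x).symm z)) β) y := by
    intro i _
    have h1 : ContDiffAt ℝ ∞ (fun z => f i ((extChartAt (𝓡 m) x).symm z)) y :=
      ((hf i).contMDiffAt.comp y (contMDiffAt_chart_symm hyD.1)).contDiffAt
    exact ((contDiffAt_chartDensity_chartRep h hu.1 hyD).mul (contDiffAt_euclidean.1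
      (h1.smul (contDiffAt_varField hU hyD)) β)).differentiableAt (by simp)
  have e := fderiv_fun_sum hd
  rw [← _root_.sum_apply, ← e]
  congr 1
  refine Filter.EventuallyEq.fderiv_eq ?_
  have hc : ContinuousAt (extChartAt (𝓡 m) x).symm y := (contMDiffAt_chart_symm hyD.1).continuousAt
  -- The formula differentiates the field, so the functions must sum to `1` on a neighbourhood of
  -- `x` and not only at `x`.
  have hs2 := hc.eventually (by rw [hxy]; exact hsum)
  filter_upwards [hs2] with z hz
  rw [← Finset.mul_sum]
  congr 1
  simp only [PiLp.smul_apply, smul_eq_mul]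
  rw [← Finset.sum_mul, hz, one_mul]

end Localization

/-! ### Variations with prescribed field -/

section BumpVariation

variable {m n : ℕ} {M : Type*} [TopologicalSpace M] [ChartedSpace (Model m) M]
  {N : Type*} [TopologicalSpace N] [ChartedSpace (Model n) N]
  [IsManifold (𝓡 n) ∞ N]

/-- Near each point there are variations in each coordinate direction of the target with prescribed
compactly supported profile, up to a positive factor. -/
theorem exists_bump_variation {u : M → N} (hu : ContMDiff (𝓡 m) (𝓡 n) ∞ u) {q : N} {x₀ : M}
    (hx₀ : u x₀ ∈ (extChartAt (𝓡 n) q).source) :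
    ∃ O, IsOpen O ∧ x₀ ∈ O ∧ O ⊆ u ⁻¹' (extChartAt (𝓡 n) q).source ∧
      ∀ f : M → ℝ, ContMDiff (𝓡 m) 𝓘(ℝ, ℝ) ∞ f → HasCompactSupport f → tsupport f ⊆ O → ∀ β : Fin n,
        ∃ (U : ℝ → M → N) (ε : ℝ), 0 < ε ∧
          ContMDiff (𝓘(ℝ, ℝ).prod (𝓡 m)) (𝓡 n) ∞ (fun z : ℝ × M => U z.1 z.2) ∧
          U 0 = u ∧ (∀ t, ∀ x ∉ tsupport f, U t x = u x) ∧
          ∀ x ∈ O, varField n q U x = (ε * f x) • EuclideanSpace.single β (1 : ℝ) := by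
  classical
  set φ := extChartAt (𝓡 n) q with hφ
  -- A ball of radius `r` fits into the target of the chart: half of it is spent on the position of
  -- `u x`, the other half on the displacement.
  obtain ⟨r, hr, hball⟩ := Metric.isOpen_iff.1 (isOpen_extChartAt_target (I := 𝓡 n) q) (φ (u x₀))
    (φ.map_source hx₀)
  have hcφ : ContinuousOn (fun x => φ (u x)) (u ⁻¹' φ.source) :=
    (continuousOn_extChartAt q).comp hu.continuous.continuousOn fun x hx => hx
  refine ⟨(u ⁻¹' φ.source) ∩ (fun x => φ (u x)) ⁻¹' Metric.ball (φ (u x₀)) (r / 2),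
    hcφ.isOpen_inter_preimage ((isOpen_extChartAt_source q).preimage hu.continuous)
      Metric.isOpen_ball, ⟨hx₀, Metric.mem_ball_self (by positivity)⟩, inter_subset_left, ?_⟩
  set O := (u ⁻¹' φ.source) ∩ (fun x => φ (u x)) ⁻¹' Metric.ball (φ (u x₀)) (r / 2) with hO
  have hOo : IsOpen O := hcφ.isOpen_inter_preimage
    ((isOpen_extChartAt_source q).preimage hu.continuous) Metric.isOpen_ball
  intro f hf hfc hfO β
  obtain ⟨C, hC⟩ : ∃ C, ∀ x, ‖f x‖ ≤ C := hfc.exists_bound_of_continuous hf.continuous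
  have hC0 : 0 ≤ C := (norm_nonneg _).trans (hC x₀)
  set ε := r / 2 / (C + 1) with hε
  have hεpos : 0 < ε := by positivity
  let e : Model n := EuclideanSpace.single β (1 : ℝ)
  -- A variation must exist for all times. The sine has velocity `1` at `0` and stays bounded, so
  -- with this `ε` the displacement never exceeds `r / 2`.
  let γ : ℝ × M → Model n := fun z => φ (u z.2) + (ε * Real.sin z.1 * f z.2) • e
  have hγ : ∀ t, ∀ x ∈ O, γ (t, x) ∈ φ.target := by
    intro t x hx
    refine hball ?_
    have h1 : ‖(ε * Real.sin t * f x) • e‖ ≤ r / 2 := by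
      rw [norm_smul]
      have he : ‖e‖ = 1 := by simp [e]
      rw [he, mul_one, norm_mul, norm_mul, Real.norm_of_nonneg hεpos.le]
      calc ε * ‖Real.sin t‖ * ‖f x‖ ≤ ε * 1 * (C + 1) := by
            gcongr
            · exact Real.abs_sin_le_one t
            · linarith [hC x]
        _ = r / 2 := by rw [hε]; field_simp
    have h2 : dist (φ (u x)) (φ (u x₀)) < r / 2 := hx.2
    rw [Metric.mem_ball, dist_eq_norm]
    calc ‖γ (t, x) - φ (u x₀)‖ = ‖(φ (u x) - φ (u x₀)) + (ε * Real.sin t * f x) • e‖ := by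
          congr 1; simp only [γ]; abel
      _ ≤ ‖φ (u x) - φ (u x₀)‖ + ‖(ε * Real.sin t * f x) • e‖ := norm_add_le _ _
      _ < r := by rw [← dist_eq_norm]; linarith
  let U : ℝ → M → N := fun t x => if x ∈ O then φ.symm (γ (t, x)) else u x
  have hU0 : ∀ t, ∀ x ∉ tsupport f, U t x = u x := by
    intro t x hx
    by_cases hxO : x ∈ O
    · simp only [U, if_pos hxO, γ, image_eq_zero_of_notMem_tsupport hx]
      rw [mul_zero, zero_smul, add_zero, φ.left_inv hxO.1]
    · simp only [U, if_neg hxO]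
  refine ⟨U, ε, hεpos, ?_, ?_, hU0, ?_⟩
  · rintro ⟨t, x⟩
    by_cases hxO : x ∈ O
    · have h1 : ContMDiffAt (𝓘(ℝ, ℝ).prod (𝓡 m)) 𝓘(ℝ, Model n) ∞ γ (t, x) := by
        have ha : ContMDiffAt (𝓘(ℝ, ℝ).prod (𝓡 m)) 𝓘(ℝ, Model n) ∞
            (fun z : ℝ × M => (φ (u z.2) : Model n)) (t, x) :=
          ContMDiffAt.comp (t, x) (g := fun x => φ (u x))
            ((contMDiffAt_chart hxO.1).comp x hu.contMDiffAt) contMDiffAt_snd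
        have hb : ContMDiffAt (𝓘(ℝ, ℝ).prod (𝓡 m)) 𝓘(ℝ, ℝ) ∞
            (fun z : ℝ × M => ε * Real.sin z.1 * f z.2) (t, x) :=
          (contMDiffAt_const.mul (Real.contDiff_sin.contMDiff.contMDiffAt.comp (t, x)
            contMDiffAt_fst)).mul (hf.contMDiffAt.comp (t, x) contMDiffAt_snd)
        exact ha.add (hb.smul contMDiffAt_const)
      have h2 : ContMDiffAt (𝓘(ℝ, ℝ).prod (𝓡 m)) (𝓡 n) ∞ (fun z => φ.symm (γ z)) (t, x) :=
        ContMDiffAt.comp (t, x) (contMDiffAt_chart_symm (hγ t x hxO)) h1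
      refine h2.congr_of_eventuallyEq ?_
      filter_upwards [(hOo.preimage continuous_snd).mem_nhds (show (t, x) ∈ Prod.snd ⁻¹' O from hxO)]
        with z hz
      exact if_pos hz
    · have hxt : x ∉ tsupport f := fun hx => hxO (hfO hx)
      refine (hu.contMDiffAt.comp (t, x) contMDiffAt_snd).congr_of_eventuallyEq ?_
      filter_upwards [((isClosed_tsupport f).isOpen_compl.preimage continuous_snd).mem_nhds
        (show (t, x) ∈ Prod.snd ⁻¹' (tsupport f)ᶜ from hxt)] with z hz
      exact hU0 z.1 z.2 hz
  · funext x
    by_cases hxO : x ∈ O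
    · simp only [U, if_pos hxO, γ, Real.sin_zero]
      rw [mul_zero, zero_mul, zero_smul, add_zero, φ.left_inv hxO.1]
    · simp only [U, if_neg hxO]
  · intro x hxO
    have h1 : (fun t => (φ (U t x) : Model n)) = fun t => φ (u x) + (Real.sin t) • ((ε * f x) • e) := by
      funext t
      simp only [U, if_pos hxO]
      rw [φ.right_inv (hγ t x hxO)]
      simp only [γ, smul_smul]
      ring_nf
    unfold varField
    rw [← hφ, h1]
    have h2 := ((Real.hasDerivAt_sin 0).smul_const ((ε * f x) • e)).const_add (φ (u x))
    rw [Real.cos_zero, one_smul] at h2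
    exact h2.deriv

end BumpVariation

/-! ### Fundamental lemma; independence of the source chart -/

section Localize

variable {m : ℕ} {M : Type*} [TopologicalSpace M] [ChartedSpace (Model m) M]
  {N : Type*} [TopologicalSpace N] [ChartedSpace (Model 2) N]
  [IsManifold (𝓡 m) ∞ M] [IsManifold (𝓡 2) ∞ N]

theorem continuousOn_chartDensity_comp (h : Metric 2 N) {u : M → N} (hu : Continuous u) (q : N) :
    ContinuousOn (fun x => chartDensity h q (extChartAt (𝓡 2) q (u x)))
      (u ⁻¹' (extChartAt (𝓡 2) q).source) :=
  (continuousOn_chartDensity h q).comp ((continuousOn_extChartAt q).comp hu.continuousOn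
    fun _ hx => hx) fun _ hx => (extChartAt (𝓡 2) q).map_source hx

theorem continuousOn_chartTension_comp (g : Metric m M) (h : Metric 2 N) {p : M} {q : N}
    {u : M → N} (hu : ContMDiff (𝓡 m) (𝓡 2) ∞ u) (β : Fin 2) :
    ContinuousOn (fun x => chartTension g h p q u β (extChartAt (𝓡 m) p x))
      (chartDomain m 2 p q u) :=
  (continuousOn_chartTension g h hu β).comp ((continuousOn_extChartAt p).mono inter_subset_left)
    fun _ hx => mem_coordDomain hx

variable [T2Space M] [SecondCountableTopology M] [MeasurableSpace M] [BorelSpace M]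

/-- The fundamental lemma of the calculus of variations, for sections along `u` in charts. -/
theorem eq_of_forall_setIntegral_varField_eq (g : Metric m M) (h : Metric 2 N) {u : M → N}
    (hu : ContMDiff (𝓡 m) (𝓡 2) ∞ u) {q : N} {O : Set M} (hO : IsOpen O)
    (hOq : O ⊆ u ⁻¹' (extChartAt (𝓡 2) q).source) {T T' : Fin 2 → M → ℝ}
    (hT : ∀ β, ContinuousOn (T β) O) (hT' : ∀ β, ContinuousOn (T' β) O)
    (H : ∀ (U : ℝ → M → N) (K : Set M), IsCompact K → K ⊆ O →
      ContMDiff (𝓘(ℝ, ℝ).prod (𝓡 m)) (𝓡 2) ∞ (fun z : ℝ × M => U z.1 z.2) → U 0 = u →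
      (∀ t, ∀ x ∉ K, U t x = u x) →
      ∫ x in K, ∑ β, chartDensity h q (extChartAt (𝓡 2) q (u x)) * varField 2 q U x β * T β x
          ∂(riemVolume g)
        = ∫ x in K, ∑ β, chartDensity h q (extChartAt (𝓡 2) q (u x)) * varField 2 q U x β * T' β x
          ∂(riemVolume g)) {x₀ : M} (hx₀ : x₀ ∈ O) (β : Fin 2) : T β x₀ = T' β x₀ := by
  obtain ⟨W, hWo, hxW, hWq, hW⟩ := exists_bump_variation hu (hOq hx₀)
  have hJc := continuousOn_chartDensity_comp h hu.continuous q
  have := ChartedSpace.locallyCompactSpace (Model m) M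
  have := isLocallyFiniteMeasure_riemVolume g
  have := isOpenPosMeasure_riemVolume g
  have hVo : IsOpen (W ∩ O) := hWo.inter hO
  set J : M → ℝ := fun x => chartDensity h q (extChartAt (𝓡 2) q (u x)) with hJ
  have hJT : ∀ T : Fin 2 → M → ℝ, (∀ β, ContinuousOn (T β) O) →
      ContinuousOn (fun x => J x * T β x) (W ∩ O) := fun T hT =>
    (hJc.mono (inter_subset_left.trans hWq)).mul ((hT β).mono inter_subset_right)
  have hc : ContinuousOn (fun x => J x * T β x - J x * T' β x) (W ∩ O) :=
    (hJT T hT).sub (hJT T' hT')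
  -- Bump variations in direction `β` realise every smooth test function supported in `W ∩ O`, up to
  -- the factor `ε`. This yields equality almost everywhere, and continuity makes it pointwise; the
  -- factor `J` is positive.
  have hae := IsOpen.ae_eq_zero_of_integral_contMDiff_smul_eq_zero (𝓡 m) hVo
    (hc.locallyIntegrableOn (μ := riemVolume g) hVo.measurableSet) ?_
  · have h1 : EqOn (fun x => J x * T β x - J x * T' β x) (fun _ => 0) (W ∩ O) :=
      Measure.eqOn_open_of_ae_eq (μ := riemVolume g)
        ((ae_restrict_iff' hVo.measurableSet).2 hae) hVo hc continuousOn_const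
    have h2 := h1 ⟨hxW, hx₀⟩
    simp only [← mul_sub] at h2
    have h3 : 0 < J x₀ :=
      chartDensity_pos h ((extChartAt (𝓡 2) q).map_source (hOq hx₀))
    exact sub_eq_zero.1 ((mul_eq_zero.1 h2).resolve_left h3.ne')
  · intro f hf hfc hfV
    obtain ⟨U, ε, hε, hU, hU0, hUK, hUv⟩ := hW f hf hfc (hfV.trans inter_subset_left) β
    have h1 := H U (tsupport f) hfc (hfV.trans inter_subset_right) hU hU0 hUK
    have h2 : ∀ T : Fin 2 → M → ℝ, ∫ x in tsupport f, ∑ β, J x * varField 2 q U x β * T β x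
          ∂(riemVolume g) = ε * ∫ x in tsupport f, f x * (J x * T β x) ∂(riemVolume g) := by
      intro T
      rw [← integral_const_mul]
      refine setIntegral_congr_fun hfc.isCompact.measurableSet fun x hx => ?_
      simp only [hUv x (hfV hx).1, PiLp.smul_apply, PiLp.single_apply]
      rw [Finset.sum_eq_single β]
      · simp; ring
      · intro b _ hb; simp [hb]
      · simp
    rw [h2, h2] at h1
    have h3 := mul_left_cancel₀ hε.ne' h1
    have hint : ∀ T : Fin 2 → M → ℝ, (∀ β, ContinuousOn (T β) O) →
        IntegrableOn (fun x => f x * (J x * T β x)) (tsupport f) (riemVolume g) := fun T hT =>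
      ContinuousOn.integrableOn_compact hfc.isCompact
        (hf.continuous.continuousOn.mul ((hJT T hT).mono hfV))
    rw [← setIntegral_eq_integral_of_forall_compl_eq_zero (s := tsupport f)]
    · simp only [smul_eq_mul, mul_sub]
      rw [integral_sub (hint T hT) (hint T' hT'), h3, sub_self]
    · intro x hx
      rw [image_eq_zero_of_notMem_tsupport hx, zero_smul]

/-- The first variation formula pairs the tension with the variation field, so the fundamental lemma
applies with comparison function `0`. -/
theorem chartTension_eq_zero_of_forall_setIntegral (g : Metric m M) (h : Metric 2 N) {u : M → N}
    (hu : IsHorizontallyConformal g h u) {p : M} {q : N} {O : Set M} (hO : IsOpen O)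
    (hOD : O ⊆ chartDomain m 2 p q u)
    (H : ∀ (U : ℝ → M → N) (K : Set M), IsCompact K → K ⊆ O →
      ContMDiff (𝓘(ℝ, ℝ).prod (𝓡 m)) (𝓡 2) ∞ (fun z : ℝ × M => U z.1 z.2) → U 0 = u →
      (∀ t, ∀ x ∉ K, U t x = u x) →
      ∫ x in K, deriv (fun t => energyDensity g h (U t) x) 0 ∂(riemVolume g) = 0)
    {x₀ : M} (hx₀ : x₀ ∈ O) (β : Fin 2) :
    chartTension g h p q u β (extChartAt (𝓡 m) p x₀) = 0 := by
  refine eq_of_forall_setIntegral_varField_eq g h hu.1 (q := q) hO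
    (T := fun β x => chartTension g h p q u β (extChartAt (𝓡 m) p x)) (T' := fun _ _ => 0)
    (fun x hx => (hOD hx).2) (fun β => (continuousOn_chartTension_comp g h hu.1 β).mono hOD)
    (fun β => continuousOn_const) (fun U K hK hKO hU hU0 hUK => ?_) hx₀ β
  subst hU0
  have h1 := setIntegral_deriv_energyDensity g h hU hu hK (hKO.trans hOD) hUK
  rw [H U K hK hKO hU rfl hUK] at h1
  simpa using h1.symm

/-- The chart tension does not depend on the chart of the source. -/
theorem chartTension_eq_chartTension (g : Metric m M) (h : Metric 2 N) {u : M → N}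
    (hu : IsHorizontallyConformal g h u) {p p' : M} {q : N} {x₀ : M}
    (hx₀ : x₀ ∈ chartDomain m 2 p q u) (hx₀' : x₀ ∈ chartDomain m 2 p' q u) (β : Fin 2) :
    chartTension g h p q u β (extChartAt (𝓡 m) p x₀)
      = chartTension g h p' q u β (extChartAt (𝓡 m) p' x₀) := by
  have hc := hu.1.continuous
  refine eq_of_forall_setIntegral_varField_eq g h hu.1 (q := q)
    (T := fun β x => chartTension g h p q u β (extChartAt (𝓡 m) p x))
    (T' := fun β x => chartTension g h p' q u β (extChartAt (𝓡 m) p' x))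
    ((isOpen_chartDomain hc).inter (isOpen_chartDomain hc))
    (fun x hx => hx.1.2)
    (fun β => (continuousOn_chartTension_comp g h hu.1 β).mono inter_subset_left)
    (fun β => (continuousOn_chartTension_comp g h hu.1 β).mono inter_subset_right)
    (fun U K hK hKO hU hU0 hUK => ?_) ⟨hx₀, hx₀'⟩ β
  subst hU0
  -- Both tensions represent the same first variation, which does not refer to any source chart;
  -- this avoids transforming divergences by hand.
  have h1 := setIntegral_deriv_energyDensity g h hU hu hK (hKO.trans inter_subset_left) hUK
  have h2 := setIntegral_deriv_energyDensity g h hU hu hK (hKO.trans inter_subset_right) hUK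
  exact neg_injective (h1.symm.trans h2)

end Localize

/-! ### Horizontal lifts of coordinate fields -/

section HorizontalLift

open Matrix

variable {m n : ℕ} {M : Type*} [TopologicalSpace M] [ChartedSpace (Model m) M]
  {N : Type*} [TopologicalSpace N] [ChartedSpace (Model n) N]
  [IsManifold (𝓡 m) ∞ M]

variable (n) in
/-- The Gram matrix of the gradients of the coordinates of `u`. -/
def gradGram (g : Metric m M) (p : M) (q : N) (u : M → N) (y : Model m) :
    Matrix (Fin n) (Fin n) ℝ :=
  jac (chartRep m n p q u) y * (chartGram g p y)⁻¹ * (jac (chartRep m n p q u) y)ᵀ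

variable (n) in
/-- The horizontal lift of the `β`-th coordinate vector field of the target, in charts. -/
def chartLift (g : Metric m M) (p : M) (q : N) (u : M → N) (β : Fin n) (y : Model m) : Model m :=
  WithLp.toLp 2 (((chartGram g p y)⁻¹ * (jac (chartRep m n p q u) y)ᵀ
    * (gradGram n g p q u y)⁻¹).col β)

/-- The horizontal lifts are orthogonal to the kernel of the differential. -/
theorem dotProduct_chartGram_chartLift (g : Metric m M) {p : M} {q : N} {u : M → N}
    {y : Model m} (hy : y ∈ coordDomain m n p q u) {v : Model m}
    (hv : fderiv ℝ (chartRep m n p q u) y v = 0) (β : Fin n) :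
    v.ofLp ⬝ᵥ (chartGram g p y *ᵥ (chartLift n g p q u β y).ofLp) = 0 := by
  have hG : IsUnit (chartGram g p y).det := isUnit_iff_ne_zero.2 (chartGram_det_pos g hy.1).ne'
  rw [chartLift, ← Matrix.mulVec_single_one, Matrix.mulVec_mulVec, Matrix.mul_assoc,
    Matrix.mul_nonsing_inv_cancel_left _ _ hG, ← Matrix.mulVec_mulVec, Matrix.dotProduct_mulVec,
    Matrix.vecMul_transpose, jac_mulVec, hv]
  simp

variable [IsManifold (𝓡 n) ∞ N]

theorem isVertical_iff_fderiv_chartRep {p : M} {q : N} {u : M → N}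
    (hu : ContMDiff (𝓡 m) (𝓡 n) ∞ u) {y : Model m} (hy : y ∈ coordDomain m n p q u)
    (w : Model m) :
    IsVertical n u ((extChartAt (𝓡 m) p).symm y) w ↔
      fderiv ℝ (chartRep m n p q u) y (dChart p ((extChartAt (𝓡 m) p).symm y) w) = 0 := by
  rw [(hasFDerivAt_chartRep hy.1 hy.2 (hu.contMDiffAt.mdifferentiableAt (by simp))).fderiv]
  change dMap m n u _ w = 0 ↔ dChart q (u _) (dMap m n u _ (dChartSymm p y (dChart p _ w))) = 0
  rw [dChartSymm_dChart hy.1]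
  refine ⟨fun h => by rw [h, map_zero], fun h => ?_⟩
  have h1 := dChartSymm_dChart (chartRep_mem_target hy)
    (dMap m n u ((extChartAt (𝓡 m) p).symm y) w)
  rw [show (extChartAt (𝓡 n) q).symm (chartRep m n p q u y) = u ((extChartAt (𝓡 m) p).symm y) from
    (extChartAt (𝓡 n) q).left_inv hy.2] at h1
  rw [← h1, h, map_zero]

theorem gradGram_posDef (g : Metric m M) {p : M} {q : N} {u : M → N}
    (hu : ContMDiff (𝓡 m) (𝓡 n) ∞ u)
    (hs : ∀ x, Function.Surjective (mfderiv (𝓡 m) (𝓡 n) u x)) {y : Model m}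
    (hy : y ∈ coordDomain m n p q u) : (gradGram n g p q u y).PosDef :=
  posDef_mul_inv_mul_transpose (chartGram_posDef g hy.1) (surjective_fderiv_chartRep hu hs hy)

/-- The lift is a column of `G⁻¹ Aᵀ K⁻¹`, and multiplying by `A` on the left gives `K K⁻¹ = 1`. -/
theorem fderiv_chartRep_chartLift (g : Metric m M) {p : M} {q : N} {u : M → N}
    (hu : ContMDiff (𝓡 m) (𝓡 n) ∞ u)
    (hs : ∀ x, Function.Surjective (mfderiv (𝓡 m) (𝓡 n) u x)) {y : Model m}
    (hy : y ∈ coordDomain m n p q u) (β : Fin n) :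
    fderiv ℝ (chartRep m n p q u) y (chartLift n g p q u β y) = EuclideanSpace.single β 1 := by
  have hK : IsUnit (gradGram n g p q u y).det :=
    isUnit_iff_ne_zero.2 (gradGram_posDef g hu hs hy).det_pos.ne'
  have h1 : (fderiv ℝ (chartRep m n p q u) y (chartLift n g p q u β y)).ofLp = Pi.single β 1 := by
    rw [← jac_mulVec, chartLift, ← Matrix.mulVec_single_one, Matrix.mulVec_mulVec,
      ← Matrix.mul_assoc, ← Matrix.mul_assoc]
    change (gradGram n g p q u y * (gradGram n g p q u y)⁻¹) *ᵥ _ = _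
    rw [Matrix.mul_nonsing_inv _ hK, Matrix.one_mulVec]
  ext i
  simp [h1, Pi.single_apply]

theorem contDiffAt_chartLift (g : Metric m M) {p : M} {q : N} {u : M → N}
    (hu : ContMDiff (𝓡 m) (𝓡 n) ∞ u)
    (hs : ∀ x, Function.Surjective (mfderiv (𝓡 m) (𝓡 n) u x)) {y : Model m}
    (hy : y ∈ coordDomain m n p q u) (β : Fin n) :
    ContDiffAt ℝ ∞ (chartLift n g p q u β) y := by
  have hA := contDiffAt_jac (contDiffAt_chartRep hy.1 hy.2 hu)
  have hGi := contDiffAt_inv (fun i j => contDiffAt_chartGram g hy.1 i j)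
    (chartGram_det_pos g hy.1).ne'
  refine contDiffAt_euclidean.2 fun i => ?_
  exact contDiffAt_matrix_mul (contDiffAt_matrix_mul hGi fun i j => hA j i)
    (contDiffAt_inv (contDiffAt_matrix_mul (contDiffAt_matrix_mul hA hGi) fun i j => hA j i)
      (gradGram_posDef g hu hs hy).det_pos.ne') i β

end HorizontalLift

/-! ### Identification of tangent vectors at the center of a chart -/

section Curvature

open Matrix

variable {m : ℕ} {M : Type*} [TopologicalSpace M] [ChartedSpace (Model m) M]
  [IsManifold (𝓡 m) ∞ M]

/-- At its center the preferred chart has the identity as differential. Coordinate formulas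
evaluated there, in particular that of `covDeriv`, need no change of basis. -/
theorem dChartSymm_self (p : M) (v : Model m) : dChartSymm p (extChartAt (𝓡 m) p p) v = v := by
  have h := dChartSymm_dChart (mem_extChartAt_target (I := 𝓡 m) p) v
  rwa [extChartAt_to_inv, dChart_self] at h

theorem metricForm_self (g : Metric m M) (p : M) (v w : Model m) :
    metricForm g p v w = v.ofLp ⬝ᵥ (chartGram g p (extChartAt (𝓡 m) p p) *ᵥ w.ofLp) := by
  have h := metricForm_dChartSymm g p (extChartAt (𝓡 m) p p) v w
  rwa [extChartAt_to_inv, dChartSymm_self, dChartSymm_self] at h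

theorem coordField_self (p : M) (W : (x : M) → TangentSpace (𝓡 m) x) :
    coordField p W (extChartAt (𝓡 m) p p) = W p := by
  have : ∀ x, x = p → dChart p x (W x) = W p := by
    rintro x rfl
    rw [dChart_self]; rfl
  exact this _ (extChartAt_to_inv p)

theorem contDiffAt_coordField {p : M} {y : Model m} (hy : y ∈ (extChartAt (𝓡 m) p).target)
    {W : (x : M) → TangentSpace (𝓡 m) x} (hW : ContMDiffAt (𝓡 m) (𝓡 m).tangent ∞
      (fun x => (⟨x, W x⟩ : TangentBundle (𝓡 m) M)) ((extChartAt (𝓡 m) p).symm y)) :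
    ContDiffAt ℝ ∞ (coordField p W) y :=
  ((((contMDiffAt_section_iff_dChart ((extChartAt (𝓡 m) p).map_target hy) W).1 hW).comp y
    (contMDiffAt_chart_symm hy)) : ContMDiffAt _ _ _ _ _).contDiffAt

end Curvature

/-! ### Tension as mean curvature of the fibers -/

section Minimal

open Matrix

variable {m : ℕ} {M : Type*} [TopologicalSpace M] [ChartedSpace (Model m) M]
  {N : Type*} [TopologicalSpace N] [ChartedSpace (Model 2) N]
  [IsManifold (𝓡 m) ∞ M] [IsManifold (𝓡 2) ∞ N]

/-- The place where the target must be a surface. Conformality gives `H = λ² K⁻¹`, so the flux is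
`λ² / √det H` times `ρ` times the lift; in dimension two this quotient is `√det K`. -/
theorem chartFlux_eq_chartLift (g : Metric m M) (h : Metric 2 N) {p : M} {q : N} {u : M → N}
    (hu : IsHorizontallyConformal g h u) {y : Model m} (hy : y ∈ coordDomain m 2 p q u)
    (β : Fin 2) (j : Fin m) :
    chartFlux g h p q u β j y
      = √((chartGram g p y).det) * √((gradGram 2 g p q u y).det) * chartLift 2 g p q u β y j := by
  obtain ⟨hsm, hs, lam, -, hpos, hlam⟩ := hu
  have hconf := chartGram_mul_jac g h hsm hs hlam hy
  set l := lam ((extChartAt (𝓡 m) p).symm y)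
  have hl : 0 < l := hpos _
  set H := chartGram h q (chartRep m 2 p q u y) with hH
  set A := jac (chartRep m 2 p q u) y with hA
  set G := chartGram g p y with hG
  have hKpos := gradGram_posDef g hsm hs hy
  set K := gradGram 2 g p q u y with hK
  have hHK : H * K = (l ^ 2) • (1 : Matrix (Fin 2) (Fin 2) ℝ) := by
    rw [← hconf, hK, gradGram]
    simp only [Matrix.mul_assoc]
    rfl
  have hKu : IsUnit K.det := isUnit_iff_ne_zero.2 hKpos.det_pos.ne'
  have hHe : H = (l ^ 2) • K⁻¹ := by
    have := congrArg (· * K⁻¹) hHK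
    simpa [Matrix.mul_assoc, Matrix.mul_nonsing_inv _ hKu] using this
  have hGs : (G⁻¹)ᵀ = G⁻¹ := by rw [Matrix.transpose_nonsing_inv, chartGram_transpose]
  have hKs : (K⁻¹)ᵀ = K⁻¹ := by
    rw [Matrix.transpose_nonsing_inv, hK, gradGram]
    simp only [Matrix.transpose_mul, Matrix.transpose_transpose, ← hG, hGs, Matrix.mul_assoc]
  have hX : chartLift 2 g p q u β y j = (K⁻¹ * A * G⁻¹) β j := by
    have : (K⁻¹ * A * G⁻¹) = (G⁻¹ * Aᵀ * K⁻¹)ᵀ := by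
      simp only [Matrix.transpose_mul, Matrix.transpose_transpose, hGs, hKs, Matrix.mul_assoc]
    rw [this]
    rfl
  have hHd : 0 < H.det := chartGram_det_pos h (chartRep_mem_target hy)
  -- The determinant of `l ^ 2` times the `2 × 2` identity is `l ^ 4`; in dimension `n` the
  -- right-hand side would be `l ^ n`.
  have hdet : √H.det * √K.det = l ^ 2 := by
    rw [← Real.sqrt_mul hHd.le, ← Matrix.det_mul, hHK, Matrix.det_smul]
    simp only [Fintype.card_fin, Matrix.det_one, mul_one]
    exact Real.sqrt_sq (by positivity)
  have hJ := Real.sqrt_pos.2 hHd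
  rw [chartFlux, hX, ← hH, ← hA, ← hG, hHe, Matrix.smul_mul, Matrix.smul_mul, Matrix.smul_apply,
    smul_eq_mul, ← hdet]
  change √G.det / √H.det * _ = _
  field_simp

/-- The tension of a horizontally conformal map is proportional to the mean curvature of its
fibers. -/
theorem chartTension_eq_inner_covDeriv (hm : 2 ≤ m) (g : Metric m M) (h : Metric 2 N) {p : M}
    {q : N} {u : M → N} (hu : IsHorizontallyConformal g h u)
    (hq : u p ∈ (extChartAt (𝓡 2) q).source) {V : Set M}
    {W : Fin (m - 2) → (x : M) → TangentSpace (𝓡 m) x} (hpV : p ∈ V)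
    (hW : IsVerticalFrame 2 g u V W) (β : Fin 2) :
    chartTension g h p q u β (extChartAt (𝓡 m) p p)
      = -√((gradGram 2 g p q u (extChartAt (𝓡 m) p p)).det) *
        metricForm g p (∑ a, covDeriv g (W a) p (W a p) : Model m)
          (chartLift 2 g p q u β (extChartAt (𝓡 m) p p)) := by
  have hp : extChartAt (𝓡 m) p p ∈ coordDomain m 2 p q u :=
    mem_coordDomain ⟨mem_extChartAt_source p, hq⟩
  have hxy : (extChartAt (𝓡 m) p).symm (extChartAt (𝓡 m) p p) = p := extChartAt_to_inv p
  have hsm := hu.1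
  have hs := hu.2.1
  set y : Model m := extChartAt (𝓡 m) p p with hy
  obtain ⟨hVo, hWs, hWv, hWo⟩ := hW
  have hDo := isOpen_coordDomain (m := m) (n := 2) (p := p) (q := q) hsm.continuous
  -- the frame in the chart
  let w : Fin (m - 2) → Model m → Model m := fun a => coordField p (W a)
  have hwy : ∀ a, w a y = W a p := fun a => coordField_self p (W a)
  have hws : ∀ a, ContDiffAt ℝ ∞ (w a) y := fun a =>
    contDiffAt_coordField hp.1 (by rw [hxy]; exact (hWs a).contMDiffAt (hVo.mem_nhds hpV))
  have hVy : ∀ᶠ z in 𝓝 y, (extChartAt (𝓡 m) p).symm z ∈ V := by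
    have hc : ContinuousAt (extChartAt (𝓡 m) p).symm y :=
      (contMDiffAt_chart_symm hp.1).continuousAt
    exact hc.eventually (by rw [hxy]; exact hVo.mem_nhds hpV)
  have hwv : ∀ a, ∀ᶠ z in 𝓝 y, fderiv ℝ (chartRep m 2 p q u) z (w a z) = 0 := by
    intro a
    filter_upwards [hVy, hDo.mem_nhds hp] with z hz hzD
    exact (isVertical_iff_fderiv_chartRep hsm hzD _).1 (hWv _ hz a)
  let Wm : Matrix (Fin m) (Fin (m - 2)) ℝ := Matrix.of fun i a => w a y i
  have hAW : jac (chartRep m 2 p q u) y * Wm = 0 := by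
    ext α a
    have h1 := (hwv a).self_of_nhds
    have h2 : (jac (chartRep m 2 p q u) y *ᵥ (w a y).ofLp) α = 0 := by
      rw [jac_mulVec, h1]; rfl
    exact h2
  have hquad : ∀ (B : Matrix (Fin m) (Fin m) ℝ) a b,
      (Wmᵀ * B * Wm) a b = (w a y).ofLp ⬝ᵥ (B *ᵥ (w b y).ofLp) := by
    intro B a b
    rw [Matrix.mul_assoc, Matrix.mul_apply']
    rfl
  have hWW : Wmᵀ * chartGram g p y * Wm = 1 := by
    ext a b
    rw [hquad, Matrix.one_apply, ← hWo p hpV a b, hwy, hwy]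
    exact (metricForm_self g p (W a p) (W b p)).symm
  have hK := gradGram_posDef g hsm hs hp
  have hX := contDiffAt_chartLift g hsm hs hp β
  -- The lift projects to the constant field `e_β`, so the divergence of the flux is half the
  -- vertical trace of the Lie derivative of the metric along it.
  have key := sum_fderiv_density_mul (G := chartGram g p) (f := chartRep m 2 p q u)
    (X := chartLift 2 g p q u β) (y := y) (W := Wm) hm (contDiffAt_chartRep hp.1 hp.2 hsm) hX
    (c := EuclideanSpace.single β 1)
    (by filter_upwards [hDo.mem_nhds hp] with z hz using fderiv_chartRep_chartLift g hsm hs hz β)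
    (fun i j => contDiffAt_chartGram g hp.1 i j) (chartGram_transpose g p y)
    (chartGram_det_pos g hp.1) hK.det_pos hAW hWW
  have hflux : ∀ j, chartFlux g h p q u β j =ᶠ[𝓝 y] fun z => √((chartGram g p z).det)
      * √((jac (chartRep m 2 p q u) z * (chartGram g p z)⁻¹
        * (jac (chartRep m 2 p q u) z)ᵀ).det) * chartLift 2 g p q u β z j := fun j => by
    filter_upwards [hDo.mem_nhds hp] with z hz using chartFlux_eq_chartLift g h hu hz β j
  have hsum : ∑ j, fderiv ℝ (chartFlux g h p q u β j) y (EuclideanSpace.single j 1) = _ :=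
    (Finset.sum_congr rfl fun j _ => by rw [(hflux j).fderiv_eq]).trans key
  set S := (Matrix.of fun i j => fderiv ℝ (fun z => chartGram g p z i j) y
      (chartLift 2 g p q u β y)) + (jac (chartLift 2 g p q u β) y)ᵀ * chartGram g p y
      + chartGram g p y * jac (chartLift 2 g p q u β) y with hS
  -- Each frame field is vertical near `p`, hence orthogonal to the lift on a neighbourhood, as
  -- needed to differentiate the orthogonality relation.
  have hcov : ∀ a, metricForm g p (covDeriv g (W a) p (W a p) : Model m)
      (chartLift 2 g p q u β y) = -(1 / 2) * (w a y).ofLp ⬝ᵥ (S *ᵥ (w a y).ofLp) := by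
    intro a
    rw [hS, ← inner_covDeriv_self (G := chartGram g p) (w := w a) (X := chartLift 2 g p q u β)
      (fun i j => (contDiffAt_chartGram g hp.1 i j).differentiableAt (by simp))
      ((hws a).differentiableAt (by simp)) (hX.differentiableAt (by simp))
      (chartGram_transpose g p y) (isUnit_iff_ne_zero.2 (chartGram_det_pos g hp.1).ne')]
    · have hc : ∀ k, (show Model m from covDeriv g (W a) p (W a p)) k = fderiv ℝ (w a) y (w a y) k
          + ∑ i, ∑ j, chartChristoffel (chartGram g p) y k i j * w a y i * w a y j := by
        intro k
        have : ∀ v : Model m, v = w a y → (show Model m from covDeriv g (W a) p v) k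
          = fderiv ℝ (w a) y (w a y) k
          + ∑ i, ∑ j, chartChristoffel (chartGram g p) y k i j * w a y i * w a y j := by
          rintro v rfl
          rfl
        exact this _ (hwy a).symm
      have hC : ∀ C : Model m, (∀ k, C k = fderiv ℝ (w a) y (w a y) k
          + ∑ i, ∑ j, chartChristoffel (chartGram g p) y k i j * w a y i * w a y j) →
          metricForm g p C (chartLift 2 g p q u β y) = ∑ k, ∑ l, chartGram g p y k l *
            (fderiv ℝ (w a) y (w a y) k + ∑ i, ∑ j,
              chartChristoffel (chartGram g p) y k i j * w a y i * w a y j) *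
            chartLift 2 g p q u β y l := by
        intro C hC
        rw [metricForm_self]
        simp only [dotProduct, Matrix.mulVec, Finset.mul_sum, ← hy]
        refine Finset.sum_congr rfl fun k _ => Finset.sum_congr rfl fun l _ => ?_
        rw [← hC]
        ring
      exact hC _ hc
    · filter_upwards [hwv a, hDo.mem_nhds hp] with z hz hzD
      rw [← dotProduct_chartGram_chartLift g hzD hz β]
      simp only [dotProduct, Matrix.mulVec, Finset.mul_sum]
      refine Finset.sum_congr rfl fun k _ => Finset.sum_congr rfl fun l _ => ?_
      ring
  have hsumcov : metricForm g p (∑ a, covDeriv g (W a) p (W a p) : Model m)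
      (chartLift 2 g p q u β y) = -((1 / 2) * (Wmᵀ * S * Wm).trace) := by
    have h1 : metricForm g p (∑ a, covDeriv g (W a) p (W a p) : Model m)
        (chartLift 2 g p q u β y) = ∑ a, metricForm g p (covDeriv g (W a) p (W a p) : Model m)
        (chartLift 2 g p q u β y) := by
      erw [map_sum]
      rw [_root_.sum_apply]
    rw [h1, Matrix.trace, Finset.mul_sum, ← Finset.sum_neg_distrib]
    refine Finset.sum_congr rfl fun a _ => ?_
    rw [hcov, Matrix.diag_apply, hquad]
    ring
  have hρ := (chartDensity_pos g hp.1).ne'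
  rw [chartTension, hsum, hsumcov]
  change (chartDensity g p y)⁻¹ * (chartDensity g p y * √(gradGram 2 g p q u y).det * _) = _
  field_simp

end Minimal

/-! ### Vertical frames and the span of the horizontal lifts -/

section VerticalFrame

open Matrix

variable {m n : ℕ} {M : Type*} [TopologicalSpace M] [ChartedSpace (Model m) M]
  {N : Type*} [TopologicalSpace N] [ChartedSpace (Model n) N]
  [IsManifold (𝓡 m) ∞ M] [IsManifold (𝓡 n) ∞ N]

/-- A submersion has local smooth orthonormal frames of its vertical distribution. -/
theorem exists_isVerticalFrame (g : Metric m M) {u : M → N} (hu : ContMDiff (𝓡 m) (𝓡 n) ∞ u)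
    (hs : ∀ x, Function.Surjective (mfderiv (𝓡 m) (𝓡 n) u x)) (p : M) :
    ∃ (V : Set M) (W : Fin (m - n) → (x : M) → TangentSpace (𝓡 m) x),
      p ∈ V ∧ IsVerticalFrame n g u V W := by
  have hp : extChartAt (𝓡 m) p p ∈ coordDomain m n p (u p) u :=
    mem_coordDomain ⟨mem_extChartAt_source p, mem_extChartAt_source (u p)⟩
  set y : Model m := extChartAt (𝓡 m) p p with hy
  set f := chartRep m n p (u p) u with hf
  have hDo := isOpen_coordDomain (m := m) (n := n) (p := p) (q := u p) hu.continuous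
  have hD := hDo.mem_nhds hp
  obtain ⟨w, hw, hwo⟩ := exists_orthonormal_ker (chartGram_transpose g p y)
    (fun v hv => dotProduct_chartGram_pos g hp.1 hv) (fderiv ℝ f y)
    (surjective_fderiv_chartRep hu hs hp)
  -- Subtracting the horizontal lift of the image projects the fixed vector `w a` into the kernel at
  -- nearby points. At `y` nothing is subtracted, so the family is orthonormal there and
  -- Gram–Schmidt applies.
  let P : Fin (m - n) → Model m → Model m := fun a z =>
    w a - ∑ β, (fderiv ℝ f z (w a)) β • chartLift n g p (u p) u β z
  obtain ⟨Q, hQs, hQL, hQo, -⟩ := exists_orthonormal_fields (G := chartGram g p) (y := y)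
    (by filter_upwards [hD] with z hz i j using contDiffAt_chartGram g hz.1 i j)
    (Eventually.of_forall fun z => chartGram_transpose g p z) (fderiv ℝ f) (m - n) P
    (by
      filter_upwards [hD] with z hz a
      have h1 : ContDiffAt ℝ ∞ (fderiv ℝ f) z :=
        (contDiffAt_chartRep hz.1 hz.2 hu).fderiv_right (by simp)
      exact contDiffAt_const.sub (ContDiffAt.sum fun β _ =>
        (contDiffAt_euclidean.1 (h1.clm_apply contDiffAt_const) β).smul
          (contDiffAt_chartLift g hu hs hz β)))
    (by
      filter_upwards [hD] with z hz a
      have h1 : ∀ β, fderiv ℝ f z (chartLift n g p (u p) u β z) = EuclideanSpace.single β 1 :=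
        fderiv_chartRep_chartLift g hu hs hz
      simp only [P, map_sub, map_sum, map_smul, h1]
      ext i
      simp [Pi.single_apply])
    (by
      intro a b
      have h1 : ∀ a, P a y = w a := fun a => by simp [P, hw]
      rw [h1, h1, hwo])
  obtain ⟨O, hOsub, hOo, hyO⟩ := mem_nhds_iff.1 (inter_mem hD (inter_mem hQs (inter_mem hQL hQo)))
  let V : Set M := (extChartAt (𝓡 m) p).source ∩ extChartAt (𝓡 m) p ⁻¹' O
  have hVo : IsOpen V := (continuousOn_extChartAt p).isOpen_inter_preimage
    (isOpen_extChartAt_source p) hOo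
  let W : Fin (m - n) → (x : M) → TangentSpace (𝓡 m) x := fun a x =>
    dChartSymm p (extChartAt (𝓡 m) p x) (Q a (extChartAt (𝓡 m) p x))
  have hinv : ∀ x ∈ V, (extChartAt (𝓡 m) p).symm (extChartAt (𝓡 m) p x) = x := fun x hx =>
    (extChartAt (𝓡 m) p).left_inv hx.1
  have hWQ : ∀ x ∈ V, ∀ a, dChart p x (W a x) = Q a (extChartAt (𝓡 m) p x) := by
    intro x hx a
    have h1 := dChart_dChartSymm (hOsub hx.2).1.1 (Q a (extChartAt (𝓡 m) p x))
    rwa [hinv x hx] at h1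
  refine ⟨V, W, ⟨mem_extChartAt_source p, hyO⟩, hVo, fun a x hx => ?_, fun x hx a => ?_,
    fun x hx a b => ?_⟩
  · refine ContMDiffAt.contMDiffWithinAt ((contMDiffAt_section_iff_dChart hx.1 _).2 ?_)
    have h1 : ContMDiffAt (𝓡 m) (𝓡 m) ∞ (Q a) (extChartAt (𝓡 m) p x) :=
      ((hOsub hx.2).2.1 a).contMDiffAt
    refine (h1.comp x (contMDiffAt_chart hx.1)).congr_of_eventuallyEq ?_
    filter_upwards [hVo.mem_nhds hx] with z hz using hWQ z hz a
  · have h1 := isVertical_iff_fderiv_chartRep hu (hOsub hx.2).1 (W a x)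
    rw [hinv x hx, hWQ x hx] at h1
    exact h1.2 ((hOsub hx.2).2.2.1 a)
  · have h1 := metricForm_dChartSymm g p (extChartAt (𝓡 m) p x) (Q a (extChartAt (𝓡 m) p x))
      (Q b (extChartAt (𝓡 m) p x))
    rw [hinv x hx, (hOsub hx.2).2.2.2 a b] at h1
    exact h1

theorem isHorizontal_chartLift (g : Metric m M) {p : M} {q : N} {u : M → N}
    (hu : ContMDiff (𝓡 m) (𝓡 n) ∞ u) (hq : u p ∈ (extChartAt (𝓡 n) q).source) (β : Fin n) :
    IsHorizontal n g u p (chartLift n g p q u β (extChartAt (𝓡 m) p p)) := by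
  have hp : extChartAt (𝓡 m) p p ∈ coordDomain m n p q u :=
    mem_coordDomain ⟨mem_extChartAt_source p, hq⟩
  intro w hw
  have h1 := isVertical_iff_fderiv_chartRep hu hp w
  rw [extChartAt_to_inv, dChart_self] at h1
  have h2 := dotProduct_chartGram_chartLift g hp (v := w) (h1.1 hw) β
  have h3 : metricForm g p (w : Model m) (chartLift n g p q u β (extChartAt (𝓡 m) p p)) = 0 :=
    (metricForm_self g p w _).trans h2
  exact (metricForm_symm g p _ w).trans h3

/-- The horizontal space is spanned by the horizontal lifts of the coordinate vectors. -/
theorem IsHorizontal.eq_sum_chartLift {g : Metric m M} {p : M} {q : N} {u : M → N}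
    (hu : ContMDiff (𝓡 m) (𝓡 n) ∞ u)
    (hs : ∀ x, Function.Surjective (mfderiv (𝓡 m) (𝓡 n) u x))
    (hq : u p ∈ (extChartAt (𝓡 n) q).source) {Z : Model m} (hZ : IsHorizontal n g u p Z) :
    ∃ c : Fin n → ℝ, Z = ∑ β, c β • chartLift n g p q u β (extChartAt (𝓡 m) p p) := by
  have hp : extChartAt (𝓡 m) p p ∈ coordDomain m n p q u :=
    mem_coordDomain ⟨mem_extChartAt_source p, hq⟩
  set y : Model m := extChartAt (𝓡 m) p p with hy
  set L := fderiv ℝ (chartRep m n p q u) y with hL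
  refine ⟨fun β => L Z β, ?_⟩
  -- `D` is vertical by construction and orthogonal to all vertical vectors as a combination of
  -- horizontal ones; hence `g(D, D) = 0`.
  set D : Model m := Z - ∑ β, L Z β • chartLift n g p q u β y with hD
  have hLD : L D = 0 := by
    have h1 : ∀ β, L (chartLift n g p q u β y) = EuclideanSpace.single β 1 :=
      fderiv_chartRep_chartLift g hu hs hp
    simp only [hD, map_sub, map_sum, map_smul, h1]
    ext i
    simp [Pi.single_apply]
  have hv : IsVertical n u p D := by
    have h1 := isVertical_iff_fderiv_chartRep hu hp D
    rw [extChartAt_to_inv, dChart_self] at h1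
    exact h1.2 hLD
  have hZD : metricForm g p Z D = 0 := hZ D hv
  have hXD : ∀ β, metricForm g p (chartLift n g p q u β y) D = 0 := fun β =>
    isHorizontal_chartLift g hu hq β D hv
  have hDD : metricForm g p D D = 0 := by
    have h1 : metricForm g p D
        = metricForm g p Z - ∑ β, L Z β • metricForm g p (chartLift n g p q u β y) := by
      simp only [hD, map_sub, map_sum, map_smul]
    rw [h1, _root_.sub_apply, _root_.sum_apply, hZD]
    simp only [_root_.smul_apply, hXD, smul_zero, Finset.sum_const_zero, sub_zero]
  have h0 : D = 0 := by
    by_contra hne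
    exact (metricForm_pos g p hne).ne' hDD
  exact sub_eq_zero.1 h0

end VerticalFrame

/-! ### Minimal fibers versus vanishing tension -/

section MinimalIff

variable {m : ℕ} {M : Type*} [TopologicalSpace M] [ChartedSpace (Model m) M]
  {N : Type*} [TopologicalSpace N] [ChartedSpace (Model 2) N]
  [IsManifold (𝓡 m) ∞ M] [IsManifold (𝓡 2) ∞ N]

/-- Minimality is a condition on all vertical frames; the existence of one frame near `p` makes it
usable. -/
theorem FibersMinimal.chartTension_eq_zero (hm : 2 ≤ m) (g : Metric m M) (h : Metric 2 N)
    {u : M → N} (hu : IsHorizontallyConformal g h u) (hmin : FibersMinimal 2 g u) (p : M) {q : N}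
    (hq : u p ∈ (extChartAt (𝓡 2) q).source) (β : Fin 2) :
    chartTension g h p q u β (extChartAt (𝓡 m) p p) = 0 := by
  obtain ⟨V, W, hpV, hW⟩ := exists_isVerticalFrame g hu.1 hu.2.1 p
  rw [chartTension_eq_inner_covDeriv hm g h hu hq hpV hW]
  refine mul_eq_zero_of_right _ ?_
  exact hmin p V W hpV hW _ (isHorizontal_chartLift g hu.1 hq β)

/-- The factor `-√det K` is nonzero, so vanishing tension makes the mean curvature orthogonal to
each lift, and the lifts span the horizontal space. -/
theorem fibersMinimal_of_chartTension_eq_zero (hm : 2 ≤ m) (g : Metric m M) (h : Metric 2 N)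
    {u : M → N} (hu : IsHorizontallyConformal g h u)
    (ht : ∀ p β, chartTension g h p (u p) u β (extChartAt (𝓡 m) p p) = 0) :
    FibersMinimal 2 g u := by
  intro p V W hpV hW Z hZ
  have hq := mem_extChartAt_source (I := 𝓡 2) (u p)
  have hp : extChartAt (𝓡 m) p p ∈ coordDomain m 2 p (u p) u :=
    mem_coordDomain ⟨mem_extChartAt_source p, hq⟩
  obtain ⟨c, hc⟩ := IsHorizontal.eq_sum_chartLift hu.1 hu.2.1 hq hZ
  have h1 : ∀ β, metricForm g p (∑ a, covDeriv g (W a) p (W a p) : TangentSpace (𝓡 m) p)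
      (chartLift 2 g p (u p) u β (extChartAt (𝓡 m) p p)) = 0 := by
    intro β
    have h2 := chartTension_eq_inner_covDeriv hm g h hu hq hpV hW β
    rw [ht] at h2
    exact (mul_eq_zero.1 h2.symm).resolve_left
      (neg_ne_zero.2 (Real.sqrt_pos.2 (gradGram_posDef g hu.1 hu.2.1 hp).det_pos).ne')
  have h3 : ∀ C : Model m, (∀ β, metricForm g p C
      (chartLift 2 g p (u p) u β (extChartAt (𝓡 m) p p)) = 0) → metricForm g p C Z = 0 := by
    intro C hC
    rw [hc, map_sum]
    simp only [map_smul, hC, smul_zero, Finset.sum_const_zero]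
  exact h3 _ h1

end MinimalIff

/-! ### Zeros of the second derivative of `F` -/

section ZeroSet

/-- Near an interior point of its zero set, an increasing function is affine with positive slope. -/
theorem exists_deriv_eq_const {F : ℝ → ℝ} (hmono : StrictMonoOn F (Ici 0))
    (hF : ContDiffOn ℝ 2 F (Ioi 0)) {t : ℝ} (ht : t ∈ interior (zeroSet F)) :
    ∃ c : ℝ, 0 < c ∧ ∀ᶠ s in 𝓝 t, deriv F s = c := by
  obtain ⟨r, hr, hball⟩ := Metric.mem_nhds_iff.1 (mem_interior_iff_mem_nhds.1 ht)
  have hpos : ∀ s ∈ Metric.ball t r, 0 < s := fun s hs => (hball hs).1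
  have hd : DifferentiableOn ℝ (deriv F) (Metric.ball t r) :=
    (((contDiffOn_succ_iff_deriv_of_isOpen (n := 1) isOpen_Ioi).1 hF).2.2.differentiableOn
      one_ne_zero).mono hpos
  have hd0 : EqOn (deriv (deriv F)) 0 (Metric.ball t r) := by
    intro s hs
    have h1 := (hball hs).2
    have h2 := hpos s hs
    simpa [h2.ne'] using h1
  have hconst : ∀ s ∈ Metric.ball t r, deriv F s = deriv F t := fun s hs =>
    Metric.isOpen_ball.is_const_of_deriv_eq_zero (convex_ball t r).isPreconnected hd hd0 hs
      (Metric.mem_ball_self hr)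
  -- Strict monotonicity alone would allow a zero derivative at one point. But the derivative is
  -- constant on the ball, and by the mean value theorem it equals a difference quotient of `F`,
  -- which is positive.
  refine ⟨deriv F t, ?_, Filter.eventually_of_mem (Metric.ball_mem_nhds t hr) hconst⟩
  have hlt : t < t + r / 2 := by linarith
  have hIcc : Icc t (t + r / 2) ⊆ Metric.ball t r := by
    intro s hs
    rw [Metric.mem_ball, Real.dist_eq, abs_lt]
    constructor <;> linarith [hs.1, hs.2]
  have hFd : DifferentiableOn ℝ F (Ioi 0) := hF.differentiableOn two_ne_zero
  obtain ⟨s, hs, hs'⟩ := exists_deriv_eq_slope F hlt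
    (hFd.continuousOn.mono fun s hs => hpos s (hIcc hs))
    (hFd.mono fun s hs => hpos s (hIcc (Ioo_subset_Icc_self hs)))
  rw [← hconst s (hIcc (Ioo_subset_Icc_self hs)), hs']
  have ht0 : 0 < t := hpos t (Metric.mem_ball_self hr)
  have := hmono (mem_Ici.2 ht0.le) (mem_Ici.2 (ht0.le.trans hlt.le)) hlt
  exact div_pos (by linarith) (by linarith)

/-- For an analytic function, accumulating zeros fill the half-line. -/
theorem zeroSet_eq_Ioi {F : ℝ → ℝ} (hF : AnalyticOn ℝ F (Ioi 0)) {t : ℝ} (ht : 0 < t)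
    (hacc : AccPt t (𝓟 (zeroSet F))) : zeroSet F = Ioi 0 := by
  have h1 : AnalyticOnNhd ℝ (deriv (deriv F)) (Ioi 0) :=
    ((isOpen_Ioi.analyticOn_iff_analyticOnNhd.1 hF).deriv).deriv
  have h2 : EqOn (deriv (deriv F)) 0 (Ioi 0) := by
    refine h1.eqOn_zero_of_preconnected_of_frequently_eq_zero isPreconnected_Ioi ht ?_
    rw [accPt_iff_frequently_nhdsNE] at hacc
    refine hacc.mono fun s hs => ?_
    have h3 := hs.1
    simpa [h3.ne'] using hs.2
  refine Subset.antisymm (fun s hs => hs.1) fun s hs => ⟨hs, ?_⟩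
  rw [h2 hs]
  simp

end ZeroSet

/-! ### First variation of the `F`-energy -/

section Density

variable {m n : ℕ} {M : Type*} [TopologicalSpace M] [ChartedSpace (Model m) M]
  {N : Type*} [TopologicalSpace N] [ChartedSpace (Model n) N]
  [IsManifold (𝓡 m) ∞ M] [IsManifold (𝓡 n) ∞ N]

theorem energyDensity_congr (g : Metric m M) (h : Metric n N) {u v : M → N} {x : M}
    (huv : u =ᶠ[𝓝 x] v) : energyDensity g h u x = energyDensity g h v x := by
  have hd : dMap m n u x = dMap m n v x := huv.mfderiv_eq
  rw [energyDensity_eq_gramAt, energyDensity_eq_gramAt, hd, huv.self_of_nhds]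

theorem deriv_energyDensity_eq_zero (g : Metric m M) (h : Metric n N) {U : ℝ → M → N}
    {K : Set M} (hK : IsClosed K) (hUK : ∀ t, ∀ x ∉ K, U t x = U 0 x) {x : M} (hx : x ∉ K) :
    deriv (fun t => energyDensity g h (U t) x) 0 = 0 := by
  have h1 : ∀ t, energyDensity g h (U t) x = energyDensity g h (U 0) x := fun t =>
    energyDensity_congr g h (by
      filter_upwards [hK.isOpen_compl.mem_nhds hx] with z hz using hUK t z hz)
  simp_rw [h1]
  exact deriv_const _ _

theorem continuous_deriv_energyDensity (g : Metric m M) (h : Metric n N) {U : ℝ → M → N}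
    (hU : ContMDiff (𝓘(ℝ, ℝ).prod (𝓡 m)) (𝓡 n) ∞ (fun z : ℝ × M => U z.1 z.2)) :
    Continuous fun x => deriv (fun t => energyDensity g h (U t) x) 0 := by
  have h1 := (continuous_deriv_energyDensity_variation g h hU).comp (Continuous.prodMk_right (0 : ℝ))
  simpa only [Function.comp_def] using h1

theorem continuous_energyDensity (g : Metric m M) (h : Metric n N) {u : M → N}
    (hu : ContMDiff (𝓡 m) (𝓡 n) ∞ u) : Continuous (energyDensity g h u) := by
  have hU : ContMDiff (𝓘(ℝ, ℝ).prod (𝓡 m)) (𝓡 n) ∞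
      (fun z : ℝ × M => (fun _ : ℝ => u) z.1 z.2) := hu.comp contMDiff_snd
  have h1 := (continuous_energyDensity_variation g h (U := fun _ => u) hU).comp
    (Continuous.prodMk_right (0 : ℝ))
  simpa only [Function.comp_def] using h1

variable [T2Space M] [SecondCountableTopology M] [MeasurableSpace M] [BorelSpace M]

/-- The first variation of the `F`-energy. -/
theorem hasDerivAt_energyOn (g : Metric m M) (h : Metric n N) {F : ℝ → ℝ}
    (hF : ContDiffOn ℝ 1 F (Ioi 0)) {U : ℝ → M → N}
    (hU : ContMDiff (𝓘(ℝ, ℝ).prod (𝓡 m)) (𝓡 n) ∞ (fun z : ℝ × M => U z.1 z.2))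
    (hpos : ∀ x, 0 < energyDensity g h (U 0) x) {K : Set M} (hK : IsCompact K) :
    HasDerivAt (fun t => energyOn g h F K (U t))
      (∫ x in K, deriv F (energyDensity g h (U 0) x)
        * deriv (fun t => energyDensity g h (U t) x) 0 ∂(riemVolume g)) 0 := by
  have := isLocallyFiniteMeasure_riemVolume g
  have hc := continuous_energyDensity_variation g h hU
  have hFd : ∀ s, 0 < s → HasDerivAt F (deriv F s) s := fun s hs =>
    ((hF.differentiableOn one_ne_zero).differentiableAt (Ioi_mem_nhds hs)).hasDerivAt
  -- `F` is only differentiable on the open half-line, so `Ω` is the open set of pairs where the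
  -- energy density of the variation is positive; it contains the slice at time `0`.
  exact hasDerivAt_setIntegral_of_continuousOn hK hK.measure_lt_top
    (Ω := (fun z : ℝ × M => energyDensity g h (U z.1) z.2) ⁻¹' Ioi 0) (isOpen_Ioi.preimage hc)
    (fun x _ => hpos x)
    (Φ := fun z => F (energyDensity g h (U z.1) z.2))
    (Φ' := fun z => deriv F (energyDensity g h (U z.1) z.2)
      * deriv (fun s => energyDensity g h (U s) z.2) z.1)
    (hF.continuousOn.comp hc.continuousOn fun z hz => hz)
    (((hF.continuousOn_deriv_of_isOpen isOpen_Ioi le_rfl).comp hc.continuousOn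
      fun z hz => hz).mul (continuous_deriv_energyDensity_variation g h hU).continuousOn)
    fun z hz => (hFd _ hz).comp z.1 (hasDerivAt_energyDensity_variation g h hU z.1 z.2)

end Density

/-! ### The equivalence for locally constant `F'` -/

section Main

variable {m : ℕ} {M : Type*} [TopologicalSpace M] [ChartedSpace (Model m) M]
  {N : Type*} [TopologicalSpace N] [ChartedSpace (Model 2) N]
  [IsManifold (𝓡 m) ∞ M] [IsManifold (𝓡 2) ∞ N]

/-- Half the trace of `H K = λ² I` in dimension two: the energy density is `λ²`. -/
theorem energyDensity_pos (g : Metric m M) (h : Metric 2 N) {u : M → N}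
    (hu : IsHorizontallyConformal g h u) (x : M) : 0 < energyDensity g h u x := by
  obtain ⟨hsm, hs, lam, -, hpos, hlam⟩ := hu
  have hy : extChartAt (𝓡 m) x x ∈ coordDomain m 2 x (u x) u :=
    mem_coordDomain ⟨mem_extChartAt_source x, mem_extChartAt_source (u x)⟩
  have hconf := chartGram_mul_jac g h hsm hs hlam hy
  have he := energyDensity_eq_matrixEnergy g h hy.1 hy.2
    (hsm.contMDiffAt.mdifferentiableAt (by simp))
  rw [extChartAt_to_inv] at he hconf
  have hl := hpos x
  rw [he, matrixEnergy, Matrix.mul_assoc, Matrix.trace_mul_comm, ← Matrix.mul_assoc, hconf]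
  simp only [Matrix.trace_smul, Matrix.trace_one, Fintype.card_fin, smul_eq_mul]
  positivity

variable [T2Space M] [SecondCountableTopology M] [MeasurableSpace M] [BorelSpace M]

/-- If `F'` is locally constant and nonzero on the values of the energy density, the fibers of a
horizontally conformal map to a surface are minimal iff the map is `F`-harmonic. -/
theorem fibersMinimal_iff_isFHarmonic (hm : 2 ≤ m) (g : Metric m M) (h : Metric 2 N) {u : M → N}
    (hu : IsHorizontallyConformal g h u) {F : ℝ → ℝ} (hF : ContDiffOn ℝ 1 F (Ioi 0))
    (hloc : ∀ x, ∃ c : ℝ, 0 < c ∧ ∀ᶠ z in 𝓝 x, deriv F (energyDensity g h u z) = c) :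
    FibersMinimal 2 g u ↔ IsFHarmonic g h F u := by
  have hsm := hu.1
  have hepos := energyDensity_pos g h hu
  have := ChartedSpace.locallyCompactSpace (Model m) M
  have := isLocallyFiniteMeasure_riemVolume g
  choose c hc hcev using hloc
  -- Neighbourhoods small enough for `F'(e_u)` to be constant and for a single pair of charts to be
  -- used.
  have hO : ∀ x, ∃ O, IsOpen O ∧ x ∈ O ∧ O ⊆ chartDomain m 2 x (u x) u ∧
      ∀ z ∈ O, deriv F (energyDensity g h u z) = c x := by
    intro x
    obtain ⟨O, hO, hOo, hxO⟩ := mem_nhds_iff.1 (inter_mem (hcev x)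
      ((isOpen_chartDomain hsm.continuous).mem_nhds
        (⟨mem_extChartAt_source x, mem_extChartAt_source (u x)⟩ : x ∈ chartDomain m 2 x (u x) u)))
    exact ⟨O, hOo, hxO, fun z hz => (hO hz).2, fun z hz => (hO hz).1⟩
  choose O hOo hxO hOD hOc using hO
  have hlocal : ∀ x (U : ℝ → M → N) (K : Set M), K ⊆ O x → IsCompact K → U 0 = u →
      ∫ z in K, deriv F (energyDensity g h u z) * deriv (fun t => energyDensity g h (U t) z) 0
        ∂(riemVolume g)
      = c x * ∫ z in K, deriv (fun t => energyDensity g h (U t) z) 0 ∂(riemVolume g) := by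
    intro x U K hKO hK _
    rw [← integral_const_mul]
    exact setIntegral_congr_fun hK.measurableSet fun z hz => by
      simp only [hOc x z (hKO hz)]
  constructor
  · intro hmin
    refine ⟨hsm, fun U K hK hU hU0 hUK => ?_⟩
    subst hU0
    have hder := hasDerivAt_energyOn g h hF hU hepos hK
    refine hder.congr_deriv ?_
    -- The constants `c x` may vary with `x`, so a general variation is split into pieces each
    -- supported where `F'(e_u)` is constant.
    obtain ⟨f, hf⟩ := SmoothPartitionOfUnity.exists_isSubordinate (𝓡 m) isClosed_univ O hOo
      fun x _ => mem_iUnion.2 ⟨x, hxO x⟩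
    have hlf : LocallyFinite fun i => tsupport (f i) := f.locallyFinite.closure
    have hfin := hlf.finite_nonempty_inter_compact hK
    set s := hfin.toFinset with hs
    have hsum : ∀ x ∈ K, ∀ᶠ z in 𝓝 x, ∑ i ∈ s, f i z = 1 := by
      intro x hx
      -- By local finiteness the supports of the remaining functions have a closed union, which
      -- misses `x`. So the finite sum over `s` is `1` near `x`.
      have hcl : IsClosed (⋃ i : {i // i ∉ s}, tsupport (f i)) :=
        (hlf.comp_injective Subtype.val_injective).isClosed_iUnion fun i => isClosed_tsupport _
      have hxn : x ∉ ⋃ i : {i // i ∉ s}, tsupport (f i) := by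
        intro hx'
        obtain ⟨i, hi⟩ := mem_iUnion.1 hx'
        exact i.2 (hfin.mem_toFinset.2 ⟨x, hi, hx⟩)
      filter_upwards [hcl.isOpen_compl.mem_nhds hxn] with z hz
      rw [← f.sum_eq_one (mem_univ z)]
      refine (finsum_eq_sum_of_support_subset _ fun i hi => ?_).symm
      by_contra his
      exact hz (mem_iUnion.2 ⟨⟨i, his⟩, subset_tsupport _ hi⟩)
    have hcF : Continuous fun x => deriv F (energyDensity g h (U 0) x) :=
      (hF.continuousOn_deriv_of_isOpen isOpen_Ioi le_rfl).comp_continuous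
        (continuous_energyDensity g h hsm) hepos
    have hUi : ∀ i, ContMDiff (𝓘(ℝ, ℝ).prod (𝓡 m)) (𝓡 2) ∞
        (fun z : ℝ × M => scaledVariation (f i) U z.1 z.2) := fun i =>
      contMDiff_scaledVariation (f i).contMDiff hU
    have e1 : ∫ x in K, deriv F (energyDensity g h (U 0) x)
        * deriv (fun t => energyDensity g h (U t) x) 0 ∂(riemVolume g)
        = ∫ x in K, ∑ i ∈ s, deriv F (energyDensity g h (U 0) x)
        * deriv (fun t => energyDensity g h (scaledVariation (f i) U t) x) 0 ∂(riemVolume g) :=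
      setIntegral_congr_fun hK.measurableSet fun x hx => by
        simp only [← Finset.mul_sum]
        rw [sum_deriv_energyDensity_scaledVariation g h hU hu s (fun i => (f i).contMDiff)
          (hsum x hx)]
    rw [e1, integral_finsetSum]
    swap
    · exact fun i _ => ((hcF.mul (continuous_deriv_energyDensity g h (hUi i))).continuousOn
        ).integrableOn_compact hK
    refine Finset.sum_eq_zero fun i _ => ?_
    have hKi : IsCompact (K ∩ tsupport (f i)) := hK.inter_right (isClosed_tsupport _)
    have hKiO : K ∩ tsupport (f i) ⊆ O i := inter_subset_right.trans (hf i)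
    have hU0' := scaledVariation_zero (f i) U
    have hUK' : ∀ t, ∀ x ∉ K ∩ tsupport (f i),
        scaledVariation (f i) U t x = scaledVariation (f i) U 0 x := by
      intro t x hx
      rw [hU0', scaledVariation]
      by_cases hxK : x ∈ K
      · rw [image_eq_zero_of_notMem_tsupport fun hxt => hx ⟨hxK, hxt⟩, zero_mul]
      · exact hUK _ x hxK
    -- Outside the support of `f i` the scaled variation is stationary, so the domain of integration
    -- shrinks to a compact subset of `O i`.
    have e2 : ∫ x in K, deriv F (energyDensity g h (U 0) x)
        * deriv (fun t => energyDensity g h (scaledVariation (f i) U t) x) 0 ∂(riemVolume g)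
        = ∫ x in K ∩ tsupport (f i), deriv F (energyDensity g h (U 0) x)
        * deriv (fun t => energyDensity g h (scaledVariation (f i) U t) x) 0 ∂(riemVolume g) := by
      refine (setIntegral_eq_of_subset_of_forall_sdiff_eq_zero hK.measurableSet
        inter_subset_left fun x hx => ?_)
      rw [deriv_energyDensity_eq_zero g h hKi.isClosed hUK' hx.2, mul_zero]
    rw [e2, hlocal i _ _ hKiO hKi hU0',
      setIntegral_deriv_energyDensity g h (hUi i) (by rwa [hU0']) hKi
        (by rw [hU0']; exact hKiO.trans (hOD i)) hUK', hU0']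
    refine mul_eq_zero_of_right _ (neg_eq_zero.2 ?_)
    rw [setIntegral_congr_fun (g := fun _ => 0) hKi.measurableSet, integral_zero]
    intro x hx
    refine Finset.sum_eq_zero fun β _ => mul_eq_zero_of_right _ ?_
    have hxD := hOD i (hKiO hx)
    -- Minimality gives vanishing tension only at the center of a source chart, so the source chart
    -- is recentered at `x`.
    rw [chartTension_eq_chartTension g h hu hxD (⟨mem_extChartAt_source x, hxD.2⟩ :
      x ∈ chartDomain m 2 x _ (U 0))]
    exact hmin.chartTension_eq_zero hm g h hu x hxD.2 β
  · intro hharm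
    refine fibersMinimal_of_chartTension_eq_zero hm g h hu fun p β => ?_
    refine chartTension_eq_zero_of_forall_setIntegral g h hu (hOo p) (hOD p)
      (fun U K hK hKO hU hU0 hUK => ?_) (hxO p) β
    -- For a variation supported in `O p`, the derivative of the `F`-energy is `c p > 0` times that
    -- of the energy, so the latter vanishes as well.
    have h1 := hharm.2 U K hK hU hU0 hUK
    subst hU0
    have h2 := h1.unique (hasDerivAt_energyOn g h hF hU hepos hK)
    rw [hlocal p U K hKO hK rfl] at h2
    exact (mul_eq_zero.1 h2.symm).resolve_left (hc p).ne'

end Main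

end FHarmonic

end

/-! ### The theorem -/

theorem theorem3p5 {m : ℕ} (hm : 2 < m)
    {M : Type*} [TopologicalSpace M] [T2Space M] [SecondCountableTopology M]
    [ChartedSpace (EuclideanSpace ℝ (Fin m)) M] [IsManifold (𝓡 m) ∞ M]
    [MeasurableSpace M] [BorelSpace M]
    {N : Type*} [TopologicalSpace N] [T2Space N] [SecondCountableTopology N]
    [ChartedSpace (EuclideanSpace ℝ (Fin 2)) N] [IsManifold (𝓡 2) ∞ N]
    (gM : FHarmonic.Metric m M) (gN : FHarmonic.Metric 2 N)
    (u : M → N) (hu : FHarmonic.IsHorizontallyConformal gM gN u)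
    (F : ℝ → ℝ) (hF0 : F 0 = 0) (hFmono : StrictMonoOn F (Set.Ici 0))
    (hFC2 : ContDiffOn ℝ 2 F (Set.Ioi 0))
    (hzeros :
      (AnalyticOn ℝ F (Set.Ioi 0) ∧ ∃ t₀ : ℝ, 0 < t₀ ∧ AccPt t₀ (𝓟 (FHarmonic.zeroSet F))) ∨
      ∀ x : M, FHarmonic.energyDensity gM gN u x ∈ interior (FHarmonic.zeroSet F)) :
    (FHarmonic.FibersMinimal 2 gM u ↔ FHarmonic.IsFHarmonic gM gN F u) ∧
    (FHarmonic.IsFHarmonic gM gN F u ↔ FHarmonic.IsHarmonic gM gN u) := by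
  have hsm := hu.1
  have hpos := FHarmonic.energyDensity_pos gM gN hu
  -- In the analytic case the zero set is the whole open half-line, which contains all values of the
  -- positive function `e_u`. Both alternatives thus reduce to the second.
  have hint : ∀ x : M, FHarmonic.energyDensity gM gN u x ∈ interior (FHarmonic.zeroSet F) := by
    rcases hzeros with ⟨han, t₀, ht₀, hacc⟩ | hint
    · intro x
      rw [FHarmonic.zeroSet_eq_Ioi han ht₀ hacc, interior_Ioi]
      exact hpos x
    · exact hint
  have hF : FHarmonic.FibersMinimal 2 gM u ↔ FHarmonic.IsFHarmonic gM gN F u := by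
    refine FHarmonic.fibersMinimal_iff_isFHarmonic hm.le gM gN hu
      (hFC2.of_le one_le_two) fun x => ?_
    obtain ⟨c, hc, hev⟩ := FHarmonic.exists_deriv_eq_const hFmono hFC2 (hint x)
    exact ⟨c, hc, (FHarmonic.continuous_energyDensity gM gN hsm).continuousAt.eventually hev⟩
  -- The same criterion for the identity function, with constant derivative `1`; minimality of the
  -- fibers links the two kinds of harmonicity.
  have hid : FHarmonic.FibersMinimal 2 gM u ↔ FHarmonic.IsHarmonic gM gN u :=
    FHarmonic.fibersMinimal_iff_isFHarmonic hm.le gM gN hu contDiffOn_id fun x =>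
      ⟨1, one_pos, Filter.Eventually.of_forall fun z => deriv_id _⟩
  exact ⟨hF, hF.symm.trans hid⟩
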